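/- Let $M$ and $K$ be smooth manifolds (Hausdorff, second countable, without boundary) of dimensions $m$ and $k$ (in Kaluza--Klein theory $m=4$), and let $P=M\times K$ with projection $\pi:P\to M$. A \emph{submersive metric} $g_P\simeq(g_M,A,g_K)$ on $P$ is a smooth metric of the form $$g_P(w,w')=g_M(w_M,w'_M)+g_K\big(w_K-A(w_M),\,w'_K-A(w'_M)\big),\qquad w=w_M+w_K\in TM\oplus TK,$$ where $g_M$ is a pseudo-Riemannian metric on $M$, $A$ is a one-form on $M$ with values in the vector fields on $K$, and $g_K=g_K(x)$, $x\in M$, is a family of Riemannian metrics on $K$. The basic lift of $X\in TM$ is $X^{\mathcal H}=X+A(X)$. On each manifold $\mathrm{div}_g(W)=g^{rs}g(\nabla_{u_r}W,u_s)$, where $\nabla$ is the Levi-Civita connection, extended complex-linearly to complexified vector fields; $\mathrm{vol}_{g_K}$ is the Riemannian volume measure of $g_K(x)$ on the fibre over $x$. A subset $S\subseteq P$ is called fibrewise relatively compact if $\overline S\cap\pi^{-1}(C)$ is compact for every compact $C\subseteq M$; when $K$ is compact every subset has this property. (1) Let $W$ be a smooth vector field on $P$ such that $\{W\neq0\}$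 is fibrewise relatively compact. For a basis $\{X_\mu\}$ of $T_xM$ (for instance the value at $x$ of a $g_M$-orthonormal trivialization), put $$\hat W_M:=\sum_{\mu,\nu}g_M^{\mu\nu}\Big(\int_K g_P(W,X_\mu^{\mathcal H})\,\mathrm{vol}_{g_K}\Big)X_\nu .$$ Then the integrands are integrable, $\hat W_M$ does not depend on the basis and is a smooth vector field on $M$, the function $\mathrm{div}_{g_P}(W)$ is integrable on each fibre, and $$\int_K\mathrm{div}_{g_P}(W)\,\mathrm{vol}_{g_K}=\mathrm{div}_{g_M}(\hat W_M)\qquad\text{on }M.$$ (2) Suppose in addition that $g_P$ is Lorentzian (signature $(-,+,\dots,+)$) and that $P$ is oriented and time-oriented and carries a spin structure, with group $\mathrm{Spin}^+(m+k-1,1)$. Let gamma matrices $\Gamma_0,\dots,\Gamma_{m+k-1}$ of size $2^{\lfloor (m+k)/2\rfloor}$ be given with $\{\Gamma_r,\Gamma_s\}=-2\eta_{rs}$, $\Gamma_0^\dagger=\Gamma_0$, $\Gamma_l^\dagger=-\Gamma_l$ for $l\ge1$, and let $\langle\Phi,\Psi\rangle_{\Gamma_0}=(\Gamma_0\Phi)^\dagger\Psi$.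 Let $\Phi,\Psi$ be smooth sections of the complex spinor bundle of $P$, let $D^P\Psi=g_P^{rs}\,u_r\cdot\nabla_{u_s}\Psi$ be the Dirac operator (with $\nabla$ the lift of the Levi-Civita connection and $\{u_r\}$ a local orthonormal frame), and define $$j_P(\Phi,\Psi)=g_P^{rs}\,\langle\Phi,u_r\cdot\Psi\rangle_{\Gamma_0}\,u_s,\qquad j_M(\Phi,\Psi)=g_M^{\mu\nu}\Big(\int_K\langle\Phi,X_\mu^{\mathcal H}\cdot\Psi\rangle_{\Gamma_0}\,\mathrm{vol}_{g_K}\Big)X_\nu .$$ Assume that $\{j_P(\Phi,\Psi)\ne0\}$ is fibrewise relatively compact (automatic if $K$ is compact). Then the integrals defining $j_M(\Phi,\Psi)$ converge, $j_M(\Phi,\Psi)$ is independent of the basis $\{X_\mu\}$ and is a smooth section of $TM\otimes\mathbb C$, the function $\mathrm{div}_{g_P}[j_P(\Phi,\Psi)]$ is integrable on each fibre, and $$\mathrm{div}_{g_M}[\,j_M(\Phi,\Psi)\,]=\int_K\mathrm{div}_{g_P}[\,j_P(\Phi,\Psi)\,]\,\mathrm{vol}_{g_K}\qquad\text{on }M.$$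 In particular, if $D^P\Phi=0$ and $D^P\Psi=0$, then $\mathrm{div}_{g_M}[\,j_M(\Phi,\Psi)\,]=0$. -/

import Mathlib

open scoped Manifold ContDiff TensorProduct
open Bundle MeasureTheory

noncomputable section

/-! ### Pseudo-Riemannian metrics, Levi-Civita connection, divergence -/

section PseudoRiemannian

variable {E : Type*} [NormedAddCommGroup E] [NormedSpace ℝ E] [FiniteDimensional ℝ E]
  {H : Type*} [TopologicalSpace H] (I : ModelWithCorners ℝ E H)
  {N : Type*} [TopologicalSpace N] [ChartedSpace H N] [IsManifold I ∞ N]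

/-- Smoothness of a vector field on the set `s`. -/
def SmoothVectorFieldOn (W : (p : N) → TangentSpace I p) (s : Set N) : Prop :=
  ContMDiffOn I (I.prod 𝓘(ℝ, E)) ∞ (fun p ↦ TotalSpace.mk' E p (W p)) s

variable (N) in
/-- A smooth pseudo-Riemannian metric of arbitrary signature. -/
structure PseudoRiemannianMetric where
  inner (p : N) : TangentSpace I p →L[ℝ] TangentSpace I p →L[ℝ] ℝ
  symm (p : N) (v w : TangentSpace I p) : inner p v w = inner p w v
  nondegenerate (p : N) (v : TangentSpace I p) (hv : ∀ w, inner p v w = 0) : v = 0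
  contMDiff : ContMDiff I (I.prod 𝓘(ℝ, E →L[ℝ] E →L[ℝ] ℝ)) ∞
    (fun p ↦ TotalSpace.mk' (E →L[ℝ] E →L[ℝ] ℝ) p (inner p))

variable {I}

/-- The matrix `g^{rs}` inverse to the Gram matrix `g_{rs} = g (b r) (b s)` of a basis `b`. -/
def inverseGram {V : Type*} [AddCommGroup V] [Module ℝ V] [TopologicalSpace V]
    {ι : Type*} [Fintype ι] [DecidableEq ι]
    (g : V →L[ℝ] V →L[ℝ] ℝ) (b : Module.Basis ι ℝ V) : Matrix ι ι ℝ :=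
  (Matrix.of fun r s ↦ g (b r) (b s))⁻¹

/-- A basis of the tangent space at `p` (the tangent space is a copy of the model space `E`).
All expressions below that use it are contractions, independent of the basis. -/
def tangentBasis (p : N) : Module.Basis (Fin (Module.finrank ℝ E)) ℝ (TangentSpace I p) :=
  Module.finBasis ℝ E

/-- The metric written in the chart around `p`: at the coordinate point `z`, the value
`g_{ij}(z) uⁱ vʲ` for `u, v` in the model space. -/
def chartMetric (g : (q : N) → TangentSpace I q →L[ℝ] TangentSpace I q →L[ℝ] ℝ)
    (p : N) (z u v : E) : ℝ :=
  let q := (extChartAt I p).symm z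
  let T : E →L[ℝ] TangentSpace I q :=
    (trivializationAt E (TangentSpace I : N → Type _) p).symmL ℝ q
  g q (T u) (T v)

/-- The components of the vector field `W` in the chart around `p`, at the coordinate point `z`. -/
def chartField (W : (q : N) → TangentSpace I q) (p : N) (z : E) : E :=
  let q := (extChartAt I p).symm z
  (trivializationAt E (TangentSpace I : N → Type _) p).continuousLinearMapAt ℝ q (W q)

/-- The Christoffel term `Γ(v, w)` at `p` in the chart around `p`:
`Γ(v, w)ˡ = ½ gʲˡ (∂_v g_{wj} + ∂_w g_{vj} - ∂_j g_{vw})`. -/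
def christoffel (g : (q : N) → TangentSpace I q →L[ℝ] TangentSpace I q →L[ℝ] ℝ)
    (p : N) (v w : TangentSpace I p) : TangentSpace I p :=
  let D (a c d : E) : ℝ := fderiv ℝ (fun z ↦ chartMetric g p z c d) (extChartAt I p p) a
  let b := tangentBasis (I := I) p
  ∑ j, ∑ l, (inverseGram (g p) b j l *
    ((1 / 2 : ℝ) * (D v w (b j) + D w v (b j) - D (b j) v w))) • b l

/-- The Levi-Civita covariant derivative `(∇_v W)(p) = ∂_v W + Γ(v, W)`, for manifolds without
boundary, computed in the chart around `p`. -/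
def leviCivita (g : (q : N) → TangentSpace I q →L[ℝ] TangentSpace I q →L[ℝ] ℝ)
    (W : (q : N) → TangentSpace I q) (p : N) (v : TangentSpace I p) : TangentSpace I p :=
  let dW : TangentSpace I p := fderiv ℝ (chartField W p) (extChartAt I p p) v
  dW + christoffel g p v (W p)

/-- The divergence `div_g W = g^{rs} g(∇_{u_r} W, u_s)`. -/
def divergence (g : (q : N) → TangentSpace I q →L[ℝ] TangentSpace I q →L[ℝ] ℝ)
    (W : (q : N) → TangentSpace I q) (p : N) : ℝ :=
  let b := tangentBasis (I := I) p
  ∑ r, ∑ s, inverseGram (g p) b r s * g p (leviCivita g W p (b r)) (b s)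

/-- Real part of a complexified vector field, i.e. of a section of `ℂ ⊗ TN`. -/
def reField (J : (p : N) → ℂ ⊗[ℝ] TangentSpace I p) (p : N) : TangentSpace I p :=
  TensorProduct.lid ℝ (TangentSpace I p) (Complex.reLm.rTensor (TangentSpace I p) (J p))

/-- Imaginary part of a complexified vector field. -/
def imField (J : (p : N) → ℂ ⊗[ℝ] TangentSpace I p) (p : N) : TangentSpace I p :=
  TensorProduct.lid ℝ (TangentSpace I p) (Complex.imLm.rTensor (TangentSpace I p) (J p))

/-- The complex-linear extension of the divergence to complexified vector fields. -/
def complexDivergence (g : (q : N) → TangentSpace I q →L[ℝ] TangentSpace I q →L[ℝ] ℝ)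
    (J : (q : N) → ℂ ⊗[ℝ] TangentSpace I q) (p : N) : ℂ :=
  (divergence g (reField J) p : ℂ) + Complex.I * (divergence g (imField J) p : ℂ)

end PseudoRiemannian

/-! ### The Riemannian volume measure -/

section Volume

variable {k : ℕ} {K : Type*} [TopologicalSpace K] [ChartedSpace (EuclideanSpace ℝ (Fin k)) K]
  [IsManifold (𝓡 k) ∞ K] [MeasurableSpace K]

/-- The measure `√|det g_{ij}| dz¹ ⋯ dzᵏ` on the domain of the chart around `y`. -/
def chartVolume
    (g : (y : K) → TangentSpace (𝓡 k) y →L[ℝ] TangentSpace (𝓡 k) y →L[ℝ] ℝ) (y : K) :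
    Measure K :=
  let b := EuclideanSpace.basisFun (Fin k) ℝ
  Measure.map (extChartAt (𝓡 k) y).symm
    ((volume.restrict (extChartAt (𝓡 k) y).target).withDensity fun z ↦
      ENNReal.ofReal
        (Real.sqrt |(Matrix.of fun i j ↦ chartMetric (I := 𝓡 k) g y z (b i) (b j)).det|))

/-- The Riemannian volume measure `vol_g`. The local measures `chartVolume g y` agree on the
overlaps of the chart domains, and `vol_g`, the measure that restricts to each of them, is their
supremum in the lattice of measures. -/
def riemannianVolume
    (g : (y : K) → TangentSpace (𝓡 k) y →L[ℝ] TangentSpace (𝓡 k) y →L[ℝ] ℝ) : Measure K :=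
  ⨆ y : K, chartVolume g y

end Volume

/-! ### Submersive metrics on `M × K` -/

section Submersive

variable {m k : ℕ}
  {M : Type*} [TopologicalSpace M] [ChartedSpace (EuclideanSpace ℝ (Fin m)) M]
  {K : Type*} [TopologicalSpace K] [ChartedSpace (EuclideanSpace ℝ (Fin k)) K]

/-- The pullback `(v, w) ↦ B (T v) (T w)` of a bilinear form. -/
def pullbackForm {V V' : Type*} [AddCommGroup V] [Module ℝ V] [TopologicalSpace V]
    [IsTopologicalAddGroup V] [ContinuousConstSMul ℝ V]
    [AddCommGroup V'] [Module ℝ V'] [TopologicalSpace V']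
    [IsTopologicalAddGroup V'] [ContinuousConstSMul ℝ V']
    (B : V →L[ℝ] V →L[ℝ] ℝ) (T : V' →L[ℝ] V) : V' →L[ℝ] V' →L[ℝ] ℝ :=
  (ContinuousLinearMap.precomp ℝ T).comp (B.comp T)

/-- The form `g_P(w, w') = g_M(w_M, w'_M) + g_K(w_K - A(w_M), w'_K - A(w'_M))`. On vertical `U, V`
and on `X, Y ∈ TM` it reads `g_P(U, V) = g_K(U, V)`, `g_P(X, V) = -g_K(A X, V)` and
`g_P(X, Y) = g_M(X, Y) + g_K(A X, A Y)`. -/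
def submersiveForm (p : M × K)
    (gM : TangentSpace (𝓡 m) p.1 →L[ℝ] TangentSpace (𝓡 m) p.1 →L[ℝ] ℝ)
    (gK : TangentSpace (𝓡 k) p.2 →L[ℝ] TangentSpace (𝓡 k) p.2 →L[ℝ] ℝ)
    (A : TangentSpace (𝓡 m) p.1 →L[ℝ] TangentSpace (𝓡 k) p.2) :
    TangentSpace ((𝓡 m).prod (𝓡 k)) p →L[ℝ] TangentSpace ((𝓡 m).prod (𝓡 k)) p →L[ℝ] ℝ :=
  let wM := ContinuousLinearMap.fst ℝ (TangentSpace (𝓡 m) p.1) (TangentSpace (𝓡 k) p.2)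
  let wK := ContinuousLinearMap.snd ℝ (TangentSpace (𝓡 m) p.1) (TangentSpace (𝓡 k) p.2)
  pullbackForm gM wM + pullbackForm gK (wK - A.comp wM)

theorem submersiveForm_apply (p : M × K)
    (gM : TangentSpace (𝓡 m) p.1 →L[ℝ] TangentSpace (𝓡 m) p.1 →L[ℝ] ℝ)
    (gK : TangentSpace (𝓡 k) p.2 →L[ℝ] TangentSpace (𝓡 k) p.2 →L[ℝ] ℝ)
    (A : TangentSpace (𝓡 m) p.1 →L[ℝ] TangentSpace (𝓡 k) p.2)
    (v w : TangentSpace (𝓡 m) p.1 × TangentSpace (𝓡 k) p.2) :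
    submersiveForm p gM gK A v w = gM v.1 w.1 + gK (v.2 - A v.1) (w.2 - A w.1) :=
  rfl

variable [IsManifold (𝓡 m) ∞ M] [IsManifold (𝓡 k) ∞ K]

variable (m k M K) in
/-- A submersive metric `g_P ≃ (g_M, A, g_K)` on `P = M × K`: a pseudo-Riemannian metric `g_M` on
the base, a one-form `A` on `M` with values in the vector fields on `K`, and a family `g_K(x)` of
Riemannian metrics on `K` parametrised by `x ∈ M`, such that the resulting `g_P` is smooth. -/
structure SubmersiveMetric where
  gM : PseudoRiemannianMetric (𝓡 m) M
  gK (x : M) : ContMDiffRiemannianMetric (𝓡 k) ∞ (EuclideanSpace ℝ (Fin k))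
    (fun y : K ↦ TangentSpace (𝓡 k) y)
  A (p : M × K) : TangentSpace (𝓡 m) p.1 →L[ℝ] TangentSpace (𝓡 k) p.2
  contMDiff : ContMDiff ((𝓡 m).prod (𝓡 k))
    (((𝓡 m).prod (𝓡 k)).prod
      𝓘(ℝ, (EuclideanSpace ℝ (Fin m) × EuclideanSpace ℝ (Fin k)) →L[ℝ]
        (EuclideanSpace ℝ (Fin m) × EuclideanSpace ℝ (Fin k)) →L[ℝ] ℝ)) ∞
    (fun p : M × K ↦ TotalSpace.mk'
      ((EuclideanSpace ℝ (Fin m) × EuclideanSpace ℝ (Fin k)) →L[ℝ]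
        (EuclideanSpace ℝ (Fin m) × EuclideanSpace ℝ (Fin k)) →L[ℝ] ℝ)
      (E := fun p : M × K ↦ TangentSpace ((𝓡 m).prod (𝓡 k)) p →L[ℝ]
        TangentSpace ((𝓡 m).prod (𝓡 k)) p →L[ℝ] ℝ)
      p (submersiveForm p (gM.inner p.1) ((gK p.1).inner p.2) (A p)))

namespace SubmersiveMetric

/-- The metric `g_P` on `P = M × K`. -/
def gP (G : SubmersiveMetric m k M K) : PseudoRiemannianMetric ((𝓡 m).prod (𝓡 k)) (M × K) where
  inner p := submersiveForm p (G.gM.inner p.1) ((G.gK p.1).inner p.2) (G.A p)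
  symm p v w := by
    erw [submersiveForm_apply, submersiveForm_apply, G.gM.symm, (G.gK p.1).symm]
  nondegenerate p v hv := by
    change TangentSpace (𝓡 m) p.1 × TangentSpace (𝓡 k) p.2 at v
    obtain ⟨a, u⟩ := v
    have h2 : u - G.A p a = 0 := by
      by_contra h
      have h0 := hv ((0, u - G.A p a) : TangentSpace (𝓡 m) p.1 × TangentSpace (𝓡 k) p.2)
      erw [submersiveForm_apply] at h0
      simp only [map_zero, zero_add, sub_zero] at h0
      exact absurd h0 ((G.gK p.1).pos p.2 _ h).ne'
    have h1 : a = 0 := by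
      refine G.gM.nondegenerate p.1 a fun b ↦ ?_
      have h0 := hv ((b, G.A p b) : TangentSpace (𝓡 m) p.1 × TangentSpace (𝓡 k) p.2)
      erw [submersiveForm_apply] at h0
      simpa only [sub_self, map_zero, add_zero] using h0
    subst h1
    rw [map_zero, sub_zero] at h2
    subst h2
    rfl
  contMDiff := G.contMDiff

/-- The basic lift `X^ℋ = X + A(X)` to the point `p` of a vector `X` tangent to the base. -/
def horizontalLift (G : SubmersiveMetric m k M K) (p : M × K) (X : TangentSpace (𝓡 m) p.1) :
    TangentSpace ((𝓡 m).prod (𝓡 k)) p :=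
  ((X, G.A p X) : TangentSpace (𝓡 m) p.1 × TangentSpace (𝓡 k) p.2)

variable [MeasurableSpace K]

/-- The volume measure of `g_K(x)` on the fibre over `x`. -/
def fibreVolume (G : SubmersiveMetric m k M K) (x : M) : Measure K :=
  riemannianVolume (G.gK x).inner

/-- `g_M^{μν} (∫_K g_P(W, X_μ^ℋ) vol_{g_K}) X_ν`, for a basis `X` of the tangent space at `x`. -/
def fibreProjectionIn (G : SubmersiveMetric m k M K)
    (W : (p : M × K) → TangentSpace ((𝓡 m).prod (𝓡 k)) p) (x : M)
    {ι : Type*} [Fintype ι] [DecidableEq ι] (X : Module.Basis ι ℝ (TangentSpace (𝓡 m) x)) :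
    TangentSpace (𝓡 m) x :=
  ∑ μ, ∑ ν, (inverseGram (G.gM.inner x) X μ ν *
    ∫ y, G.gP.inner (x, y) (W (x, y)) (G.horizontalLift (x, y) (X μ)) ∂(G.fibreVolume x)) • X ν

/-- The averaged projection `Ŵ_M` of `W` to the base. -/
def fibreProjection (G : SubmersiveMetric m k M K)
    (W : (p : M × K) → TangentSpace ((𝓡 m).prod (𝓡 k)) p) (x : M) : TangentSpace (𝓡 m) x :=
  G.fibreProjectionIn W x (tangentBasis x)

end SubmersiveMetric

/-- A subset of `M × K` has fibrewise compact closure if its closure is proper over `M`. -/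
def FibrewiseRelativelyCompact (S : Set (M × K)) : Prop :=
  ∀ C : Set M, IsCompact C → IsCompact (closure S ∩ Prod.fst ⁻¹' C)

end Submersive

/-! ### Gamma matrices and the spin group -/

section Gamma

/-- The diagonal entries of `η = diag(-1, 1, …, 1)` in dimension `q + 1`. -/
def minkowskiSign {q : ℕ} (r : Fin (q + 1)) : ℝ := if r = 0 then -1 else 1

/-- Gamma matrices of signature `(q, 1)` on the spinor space `Δ_{q,1}` of complex dimension
`2^⌊(q+1)/2⌋`, with `{Γ_r, Γ_s} = -2 η_{rs}`. -/
structure GammaMatrices (q : ℕ) where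
  mat : Fin (q + 1) → Matrix (Fin (2 ^ ((q + 1) / 2))) (Fin (2 ^ ((q + 1) / 2))) ℂ
  sq (r : Fin (q + 1)) : mat r * mat r = (-minkowskiSign r) • (1 : Matrix _ _ ℂ)
  anticomm (r s : Fin (q + 1)) (h : r ≠ s) : mat r * mat s + mat s * mat r = 0
  conjTranspose_zero : (mat 0).conjTranspose = mat 0
  conjTranspose_of_ne (r : Fin (q + 1)) (h : r ≠ 0) : (mat r).conjTranspose = -mat r

/-- The quadratic form `v ↦ -η(v, v)`, so that `v · v = -η(v, v)` in its Clifford algebra. -/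
def negMinkowski (q : ℕ) : QuadraticForm ℝ (Fin (q + 1) → ℝ) :=
  QuadraticMap.weightedSumSquares ℝ fun r : Fin (q + 1) ↦ -minkowskiSign r

namespace GammaMatrices

variable {q : ℕ}

/-- The matrix `∑ vʳ Γ_r` of Clifford multiplication by `v`. -/
def slash (Γ : GammaMatrices q) :
    (Fin (q + 1) → ℝ) →ₗ[ℝ] Matrix (Fin (2 ^ ((q + 1) / 2))) (Fin (2 ^ ((q + 1) / 2))) ℂ :=
  Fintype.linearCombination ℝ Γ.mat

theorem slash_mul_slash (Γ : GammaMatrices q) (v : Fin (q + 1) → ℝ) :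
    Γ.slash v * Γ.slash v = algebraMap ℝ _ (negMinkowski q v) := by
  have hanti (r t : Fin (q + 1)) : Γ.mat r * Γ.mat t + Γ.mat t * Γ.mat r =
      if r = t then (-2 * minkowskiSign r) • (1 : Matrix _ _ ℂ) else 0 := by
    split_ifs with h
    · subst h
      rw [Γ.sq, ← add_smul]
      congr 1
      ring
    · exact Γ.anticomm r t h
  have h2 : (2 : ℝ) • (Γ.slash v * Γ.slash v) =
      (2 : ℝ) • algebraMap ℝ (Matrix _ _ ℂ) (negMinkowski q v) := by
    have e1 : Γ.slash v * Γ.slash v = ∑ r, ∑ t, (v r * v t) • (Γ.mat r * Γ.mat t) := by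
      simp only [slash, Fintype.linearCombination_apply, Finset.sum_mul, Finset.mul_sum,
        smul_mul_smul_comm]
      exact Finset.sum_comm
    have e2 : Γ.slash v * Γ.slash v = ∑ r, ∑ t, (v r * v t) • (Γ.mat t * Γ.mat r) := by
      rw [e1]
      refine Finset.sum_comm.trans (Finset.sum_congr rfl fun r _ ↦ Finset.sum_congr rfl fun t _ ↦ ?_)
      rw [mul_comm (v t)]
    rw [two_smul]
    nth_rewrite 1 [e1]
    rw [e2]
    simp only [← Finset.sum_add_distrib, ← smul_add, hanti, smul_ite, smul_zero,
      Finset.sum_ite_eq, Finset.mem_univ, if_true]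
    rw [Algebra.algebraMap_eq_smul_one, smul_smul, negMinkowski,
      QuadraticMap.weightedSumSquares_apply, Finset.mul_sum, Finset.sum_smul]
    refine Finset.sum_congr rfl fun r _ ↦ ?_
    rw [smul_smul]
    congr 1
    simp only [smul_eq_mul]
    ring
  exact smul_right_injective _ (two_ne_zero' ℝ) h2

/-- The representation of the Clifford algebra on `Δ_{q,1}` determined by the gamma matrices. -/
def rep (Γ : GammaMatrices q) :
    CliffordAlgebra (negMinkowski q) →ₐ[ℝ]
      Matrix (Fin (2 ^ ((q + 1) / 2))) (Fin (2 ^ ((q + 1) / 2))) ℂ :=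
  CliffordAlgebra.lift (negMinkowski q) ⟨Γ.slash, Γ.slash_mul_slash⟩

end GammaMatrices

end Gamma

/-! ### Spin structures, spinors and the Dirac operator -/

section Spin

variable {E : Type*} [NormedAddCommGroup E] [NormedSpace ℝ E] [FiniteDimensional ℝ E]
  {H : Type*} [TopologicalSpace H] {I : ModelWithCorners ℝ E H}
  {N : Type*} [TopologicalSpace N] [ChartedSpace H N] [IsManifold I ∞ N]

/-- The components `v^r = η^{rr} g(v, u_r)` of a tangent vector in an orthonormal frame `u`. -/
def frameComponents {q : ℕ} (g : PseudoRiemannianMetric I N)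
    (u : Fin (q + 1) → (p : N) → TangentSpace I p) (p : N) (v : TangentSpace I p) :
    Fin (q + 1) → ℝ :=
  fun r ↦ minkowskiSign r * g.inner p v (u r p)

/-- A spin structure on an oriented, time-oriented Lorentzian manifold `(N, g)` of dimension
`q + 1`, given by local data: an open cover by domains of smooth, (oriented and time-oriented)
`g`-orthonormal frames, and smooth lifts of the transition functions of these frames to
`Spin⁺(q, 1)` that satisfy the cocycle condition. The spin group acts through its faithful
representation on `Δ_{q,1}`, and `S` covers the change of frame `Λ` if
`S Γ_s S⁻¹ = Λʳ_s Γ_r`. -/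
structure SpinStructure {q : ℕ} (Γ : GammaMatrices q) (g : PseudoRiemannianMetric I N)
    (ι : Type*) where
  dom : ι → Set N
  isOpen_dom (i : ι) : IsOpen (dom i)
  indexAt : N → ι
  mem_indexAt (p : N) : p ∈ dom (indexAt p)
  frame (i : ι) : Fin (q + 1) → (p : N) → TangentSpace I p
  smooth_frame (i : ι) (r : Fin (q + 1)) : SmoothVectorFieldOn I (frame i r) (dom i)
  orthonormal (i : ι) (p : N) (hp : p ∈ dom i) (r s : Fin (q + 1)) :
    g.inner p (frame i r p) (frame i s p) = if r = s then minkowskiSign r else 0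
  trans (i j : ι) (p : N) : Matrix (Fin (2 ^ ((q + 1) / 2))) (Fin (2 ^ ((q + 1) / 2))) ℂ
  trans_mem (i j : ι) (p : N) (hi : p ∈ dom i) (hj : p ∈ dom j) :
    ∃ a ∈ spinGroup (negMinkowski q), Γ.rep a = trans i j p
  smooth_trans (i j : ι) (a b : Fin (2 ^ ((q + 1) / 2))) :
    ContMDiffOn I 𝓘(ℝ, ℂ) ∞ (fun p ↦ trans i j p a b) (dom i ∩ dom j)
  covering (i j : ι) (p : N) (hi : p ∈ dom i) (hj : p ∈ dom j) (v : TangentSpace I p) :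
    Γ.slash (frameComponents g (frame i) p v) * trans i j p =
      trans i j p * Γ.slash (frameComponents g (frame j) p v)
  cocycle (i j l : ι) (p : N) (hi : p ∈ dom i) (hj : p ∈ dom j) (hl : p ∈ dom l) :
    trans i j p * trans j l p = trans i l p

variable {q : ℕ} {Γ : GammaMatrices q} {g : PseudoRiemannianMetric I N} {ι : Type*}

/-- A smooth section of the complex spinor bundle: its representatives `Ψ i` in the trivialisations
induced by the frames of the spin structure, related by the transition functions. -/
structure Spinor (S : SpinStructure Γ g ι) where
  val : ι → N → Fin (2 ^ ((q + 1) / 2)) → ℂ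
  smooth (i : ι) : ContMDiffOn I 𝓘(ℝ, Fin (2 ^ ((q + 1) / 2)) → ℂ) ∞ (val i) (S.dom i)
  compat (i j : ι) (p : N) (hi : p ∈ S.dom i) (hj : p ∈ S.dom j) :
    val i p = (S.trans i j p).mulVec (val j p)

namespace Spinor

variable {S : SpinStructure Γ g ι}

/-- `⟨Φ, v · Ψ⟩_{Γ₀} = (Γ₀ Φ)† (v · Ψ)` for a tangent vector `v` at `p`, where `v · Ψ` is Clifford
multiplication. -/
def cliffordPairing (Φ Ψ : Spinor S) (p : N) (v : TangentSpace I p) : ℂ :=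
  let i := S.indexAt p
  star ((Γ.mat 0).mulVec (Φ.val i p)) ⬝ᵥ
    (Γ.slash (frameComponents g (S.frame i) p v)).mulVec (Ψ.val i p)

/-- The spinor covariant derivative in the trivialisation `i`:
`∇_v Ψ = ∂_v Ψ + ¼ g^{ar} g^{bs} g(∇_v u_a, u_b) u_r · u_s · Ψ`. -/
def covDeriv (Ψ : Spinor S) (i : ι) (p : N) (v : TangentSpace I p) :
    Fin (2 ^ ((q + 1) / 2)) → ℂ :=
  let dΨ : Fin (2 ^ ((q + 1) / 2)) → ℂ :=
    mfderiv I 𝓘(ℝ, Fin (2 ^ ((q + 1) / 2)) → ℂ) (Ψ.val i) p v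
  dΨ + (1 / 4 : ℝ) • ∑ r, ∑ s, (minkowskiSign r * minkowskiSign s *
      g.inner p (leviCivita g.inner (S.frame i r) p v) (S.frame i s p)) •
        (Γ.mat r * Γ.mat s).mulVec (Ψ.val i p)

/-- The Dirac operator `g^{rs} u_r · ∇_{u_s} Ψ` in the trivialisation `i`. -/
def dirac (Ψ : Spinor S) (i : ι) (p : N) : Fin (2 ^ ((q + 1) / 2)) → ℂ :=
  ∑ r, minkowskiSign r • (Γ.mat r).mulVec (Ψ.covDeriv i p (S.frame i r p))

/-- `Ψ` lies in the kernel of the Dirac operator. -/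
def InKerDirac (Ψ : Spinor S) : Prop := ∀ i, ∀ p ∈ S.dom i, Ψ.dirac i p = 0

/-- The current `j(Φ, Ψ) = g^{rs} ⟨Φ, u_r · Ψ⟩_{Γ₀} u_s`, a section of `ℂ ⊗ TN`. -/
def current (Φ Ψ : Spinor S) (p : N) : ℂ ⊗[ℝ] TangentSpace I p :=
  let u := S.frame (S.indexAt p)
  ∑ r, ((minkowskiSign r : ℂ) * Φ.cliffordPairing Ψ p (u r p)) ⊗ₜ[ℝ] u r p

end Spinor

end Spin

/-! ### The current on the base -/

section BaseCurrent

variable {m k : ℕ}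
  {M : Type*} [TopologicalSpace M] [ChartedSpace (EuclideanSpace ℝ (Fin m)) M]
  [IsManifold (𝓡 m) ∞ M]
  {K : Type*} [TopologicalSpace K] [ChartedSpace (EuclideanSpace ℝ (Fin k)) K]
  [IsManifold (𝓡 k) ∞ K] [MeasurableSpace K]
  {q : ℕ} {Γ : GammaMatrices q} {ι : Type*}

namespace SubmersiveMetric

/-- `g_M^{μν} (∫_K ⟨Φ, X_μ^ℋ · Ψ⟩_{Γ₀} vol_{g_K}) X_ν`, for a basis `X` of the tangent space
at `x`. -/
def baseCurrentIn (G : SubmersiveMetric m k M K) {S : SpinStructure Γ G.gP ι} (Φ Ψ : Spinor S)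
    (x : M) {κ : Type*} [Fintype κ] [DecidableEq κ]
    (X : Module.Basis κ ℝ (TangentSpace (𝓡 m) x)) : ℂ ⊗[ℝ] TangentSpace (𝓡 m) x :=
  ∑ μ, ∑ ν, ((inverseGram (G.gM.inner x) X μ ν : ℂ) *
    ∫ y, Φ.cliffordPairing Ψ (x, y) (G.horizontalLift (x, y) (X μ)) ∂(G.fibreVolume x)) ⊗ₜ[ℝ] X ν

/-- The current `j_M(Φ, Ψ)` on the base, a section of `ℂ ⊗ TM`. -/
def baseCurrent (G : SubmersiveMetric m k M K) {S : SpinStructure Γ G.gP ι} (Φ Ψ : Spinor S)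
    (x : M) : ℂ ⊗[ℝ] TangentSpace (𝓡 m) x :=
  G.baseCurrentIn Φ Ψ x (tangentBasis x)

end SubmersiveMetric

end BaseCurrent

end

noncomputable section

/-! ### Contractions with a nondegenerate symmetric form -/

section Contraction

variable {V : Type*} [AddCommGroup V] [Module ℝ V] [TopologicalSpace V]
  {ι : Type*} [Fintype ι] [DecidableEq ι]

/-- The Gram matrix of a bilinear form in a basis. -/
def gramMatrix (B : V →L[ℝ] V →L[ℝ] ℝ) (b : Module.Basis ι ℝ V) : Matrix ι ι ℝ :=
  Matrix.of fun r s ↦ B (b r) (b s)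

theorem inverseGram_eq (B : V →L[ℝ] V →L[ℝ] ℝ) (b : Module.Basis ι ℝ V) :
    inverseGram B b = (gramMatrix B b)⁻¹ := rfl

/-- Symmetry and nondegeneracy of a bilinear form. -/
structure IsMetricForm (B : V →L[ℝ] V →L[ℝ] ℝ) : Prop where
  symm (v w : V) : B v w = B w v
  nondegenerate (v : V) (hv : ∀ w, B v w = 0) : v = 0

namespace IsMetricForm

variable {B : V →L[ℝ] V →L[ℝ] ℝ}

theorem det_gramMatrix_ne_zero (hB : IsMetricForm B) (b : Module.Basis ι ℝ V) :
    (gramMatrix B b).det ≠ 0 := by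
  intro h
  obtain ⟨v, hv0, hv⟩ := Matrix.exists_vecMul_eq_zero_iff.2 h
  have hx : ∑ i, v i • b i = 0 := by
    refine hB.nondegenerate _ fun w ↦ ?_
    rw [← b.sum_repr w, map_sum]
    refine Finset.sum_eq_zero fun j _ ↦ ?_
    have := congrFun hv j
    simp only [Matrix.vecMul, dotProduct, gramMatrix, Matrix.of_apply, Pi.zero_apply] at this
    simp [this]
  exact hv0 (funext fun i ↦ Fintype.linearIndependent_iff.1 b.linearIndependent v hx i)

theorem isUnit_det (hB : IsMetricForm B) (b : Module.Basis ι ℝ V) :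
    IsUnit (gramMatrix B b).det := (hB.det_gramMatrix_ne_zero b).isUnit

omit [Fintype ι] [DecidableEq ι] in
theorem gramMatrix_transpose (hB : IsMetricForm B) (b : Module.Basis ι ℝ V) :
    (gramMatrix B b).transpose = gramMatrix B b := by
  ext i j; exact hB.symm _ _

theorem inverseGram_comm (hB : IsMetricForm B) (b : Module.Basis ι ℝ V) (i j : ι) :
    inverseGram B b i j = inverseGram B b j i := by
  have := congrFun (congrFun (Matrix.transpose_nonsing_inv (gramMatrix B b)) j) i
  rw [hB.gramMatrix_transpose] at this
  exact this

theorem sum_inverseGram_mul (hB : IsMetricForm B) (b : Module.Basis ι ℝ V) (i j : ι) :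
    ∑ l, inverseGram B b i l * B (b l) (b j) = if i = j then 1 else 0 := by
  have := congrFun (congrFun (Matrix.nonsing_inv_mul _ (hB.isUnit_det b)) i) j
  rw [Matrix.mul_apply, Matrix.one_apply] at this
  exact this

theorem sum_mul_inverseGram (hB : IsMetricForm B) (b : Module.Basis ι ℝ V) (i j : ι) :
    ∑ l, B (b i) (b l) * inverseGram B b l j = if i = j then 1 else 0 := by
  have := congrFun (congrFun (Matrix.mul_nonsing_inv _ (hB.isUnit_det b)) i) j
  rw [Matrix.mul_apply, Matrix.one_apply] at this
  exact this

/-- A vector is recovered from its products with the members of a basis; more generally, a linear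
functional is represented by its contraction. -/
theorem inner_sum_inverseGram (hB : IsMetricForm B) (b : Module.Basis ι ℝ V) (c : V →ₗ[ℝ] ℝ)
    (w : V) : B (∑ j, ∑ l, (inverseGram B b j l * c (b j)) • b l) w = c w := by
  have key (t : ι) : B (∑ j, ∑ l, (inverseGram B b j l * c (b j)) • b l) (b t) = c (b t) := by
    simp only [map_sum, map_smul, sum_apply, smul_apply,
      smul_eq_mul]
    calc ∑ j, ∑ l, inverseGram B b j l * c (b j) * B (b l) (b t)
        = ∑ j, c (b j) * ∑ l, inverseGram B b j l * B (b l) (b t) := by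
          refine Finset.sum_congr rfl fun j _ ↦ ?_
          rw [Finset.mul_sum]
          exact Finset.sum_congr rfl fun l _ ↦ by ring
      _ = c (b t) := by simp [hB.sum_inverseGram_mul]
  have : (B (∑ j, ∑ l, (inverseGram B b j l * c (b j)) • b l)).toLinearMap = c := b.ext key
  exact DFunLike.congr_fun this w

theorem sum_inverseGram_smul (hB : IsMetricForm B) (b : Module.Basis ι ℝ V) (v : V) :
    ∑ j, ∑ l, (inverseGram B b j l * B v (b j)) • b l = v := by
  rw [← sub_eq_zero]
  refine hB.nondegenerate _ fun w ↦ ?_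
  have := hB.inner_sum_inverseGram b (B v).toLinearMap w
  simp only [ContinuousLinearMap.coe_coe] at this
  rw [map_sub, sub_apply, this, sub_self]

theorem sum_inverseGram_eq_trace (hB : IsMetricForm B) (b : Module.Basis ι ℝ V) (L : V →ₗ[ℝ] V) :
    ∑ j, ∑ l, inverseGram B b j l * B (L (b j)) (b l) = LinearMap.trace ℝ V L := by
  rw [LinearMap.trace_eq_matrix_trace ℝ b, Matrix.trace]
  refine Finset.sum_congr rfl fun j _ ↦ ?_
  rw [Matrix.diag_apply, LinearMap.toMatrix_apply]
  calc ∑ l, inverseGram B b j l * B (L (b j)) (b l)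
      = ∑ l, ∑ i, b.repr (L (b j)) i * (B (b i) (b l) * inverseGram B b l j) := by
        refine Finset.sum_congr rfl fun l _ ↦ ?_
        nth_rewrite 1 [← b.sum_repr (L (b j))]
        rw [hB.inverseGram_comm]
        simp only [map_sum, map_smul, sum_apply,
          smul_apply, smul_eq_mul, Finset.mul_sum]
        exact Finset.sum_congr rfl fun i _ ↦ by ring
    _ = b.repr (L (b j)) j := by
        rw [Finset.sum_comm]
        simp only [← Finset.mul_sum, hB.sum_mul_inverseGram]
        simp

/-- The endomorphism that represents the form `C` with respect to `B`. -/
theorem exists_endomorphism (hB : IsMetricForm B) (b : Module.Basis ι ℝ V)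
    (C : V →L[ℝ] V →L[ℝ] ℝ) : ∃ L : V →ₗ[ℝ] V, ∀ v w, C v w = B (L v) w :=
  ⟨{  toFun := fun v ↦ ∑ j, ∑ l, (inverseGram B b j l * C v (b j)) • b l
      map_add' := fun u v ↦ by
        simp only [map_add, add_apply, mul_add, add_smul, Finset.sum_add_distrib]
      map_smul' := fun c v ↦ by
        simp only [map_smul, smul_apply, smul_eq_mul, Finset.smul_sum, smul_smul,
          RingHom.id_apply, mul_left_comm] },
    fun v w ↦ (hB.inner_sum_inverseGram b (C v).toLinearMap w).symm⟩

/-- Contractions do not depend on the basis. -/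
theorem contraction_eq (hB : IsMetricForm B) (b : Module.Basis ι ℝ V)
    {κ : Type*} [Fintype κ] [DecidableEq κ] (b' : Module.Basis κ ℝ V) (C : V →L[ℝ] V →L[ℝ] ℝ) :
    ∑ j, ∑ l, inverseGram B b j l * C (b j) (b l) =
      ∑ j, ∑ l, inverseGram B b' j l * C (b' j) (b' l) := by
  obtain ⟨L, hL⟩ := hB.exists_endomorphism b C
  simp only [hL, hB.sum_inverseGram_eq_trace]

end IsMetricForm

end Contraction

section Jacobi

variable {E : Type*} [NormedAddCommGroup E] [NormedSpace ℝ E] {ι : Type*} [Fintype ι] [DecidableEq ι]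

/-- Jacobi's formula. -/
theorem hasFDerivAt_det {A : E → Matrix ι ι ℝ} {A' : ι → ι → E →L[ℝ] ℝ} {z : E}
    (hA : ∀ i j, HasFDerivAt (fun z ↦ A z i j) (A' i j) z) :
    HasFDerivAt (fun z ↦ (A z).det) (∑ i, ∑ j, (A z).adjugate j i • A' i j) z := by
  let D : ContinuousMultilinearMap ℝ (fun _ : ι ↦ ι → ℝ) ℝ :=
    { (Matrix.detRowAlternating (n := ι) (R := ℝ)).toMultilinearMap with
      cont := Continuous.matrix_det continuous_id }
  have hrow : HasFDerivAt (fun z ↦ (A z : ι → ι → ℝ))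
      (ContinuousLinearMap.pi fun i ↦ ContinuousLinearMap.pi fun j ↦ A' i j) z :=
    hasFDerivAt_pi.2 fun i ↦ hasFDerivAt_pi.2 fun j ↦ hA i j
  have := (D.hasFDerivAt (A z)).comp z hrow
  refine this.congr_fderiv ?_
  ext v
  refine (ContinuousMultilinearMap.linearDeriv_apply D (A z) _).trans ?_
  simp only [sum_apply, smul_apply, smul_eq_mul]
  refine Finset.sum_congr rfl fun i _ ↦ ?_
  change ((A z).updateRow i fun j ↦ A' i j v).det = _
  rw [← Matrix.det_transpose, ← Matrix.updateCol_transpose, ← Matrix.cramer_apply,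
    Matrix.cramer_eq_adjugate_mulVec, ← Matrix.adjugate_transpose]
  rfl

end Jacobi

/-! ### The divergence in coordinates -/

section CoordDivergence

variable {E : Type*} [NormedAddCommGroup E] [NormedSpace ℝ E] [FiniteDimensional ℝ E]

/-- The contraction `g^{rs} C_{rs}`. -/
def metricTrace (B C : E →L[ℝ] E →L[ℝ] ℝ) : ℝ :=
  let b := Module.finBasis ℝ E
  ∑ j, ∑ l, inverseGram B b j l * C (b j) (b l)

theorem metricTrace_of_eq {B C : E →L[ℝ] E →L[ℝ] ℝ} (hB : IsMetricForm B) (L L' : E →ₗ[ℝ] E)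
    (hC : ∀ u v, C u v = B (L u) v + B (L' v) u) :
    metricTrace B C = LinearMap.trace ℝ E L + LinearMap.trace ℝ E L' := by
  rw [← hB.sum_inverseGram_eq_trace (Module.finBasis ℝ E) L,
    ← hB.sum_inverseGram_eq_trace (Module.finBasis ℝ E) L', Finset.sum_comm (f := fun j l ↦
      inverseGram B (Module.finBasis ℝ E) j l * B (L' (Module.finBasis ℝ E j)) _),
    ← Finset.sum_add_distrib]
  refine Finset.sum_congr rfl fun j _ ↦ ?_
  rw [← Finset.sum_add_distrib]
  refine Finset.sum_congr rfl fun l _ ↦ ?_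
  rw [hC, hB.inverseGram_comm _ l j, mul_add]

/-- `tr (∂w) + ½ g^{rs} ∂_w g_{rs}`. -/
def coordDivergence (g : E → E →L[ℝ] E →L[ℝ] ℝ) (w : E → E) (z : E) : ℝ :=
  LinearMap.trace ℝ E (fderiv ℝ w z).toLinearMap +
    (1 / 2 : ℝ) * metricTrace (g z) (fderiv ℝ g z (w z))

omit [FiniteDimensional ℝ E] in
theorem fderiv_clm_apply_const₂ {g : E → E →L[ℝ] E →L[ℝ] ℝ} {z : E} (hg : DifferentiableAt ℝ g z)
    (a u v : E) : fderiv ℝ (fun y ↦ g y u v) z a = fderiv ℝ g z a u v := by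
  have h1 : HasFDerivAt (fun y ↦ g y u v) (((fderiv ℝ g z).flip u).flip v) z := by
    have h2 : HasFDerivAt (fun y ↦ g y u) ((fderiv ℝ g z).flip u) z := by
      simpa using hg.hasFDerivAt.clm_apply (hasFDerivAt_const u z)
    simpa using h2.clm_apply (hasFDerivAt_const v z)
  rw [h1.fderiv]; rfl

set_option synthInstance.maxHeartbeats 200000 in
theorem coordDivergence_pullback {g g' : E → E →L[ℝ] E →L[ℝ] ℝ} {w w' φ : E → E} {z : E}
    (hφ : ContDiffAt ℝ 2 φ z) (ψ : E →L[ℝ] E) (hψ : ψ ∘L fderiv ℝ φ z = .id ℝ E)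
    (hψ' : fderiv ℝ φ z ∘L ψ = .id ℝ E)
    (hg' : DifferentiableAt ℝ g' (φ z)) (hw : DifferentiableAt ℝ w z)
    (hw' : DifferentiableAt ℝ w' (φ z)) (hmet' : IsMetricForm (g' (φ z)))
    (hmet : IsMetricForm (g z)) (hgd : DifferentiableAt ℝ g z)
    (hgg' : ∀ᶠ y in nhds z, ∀ u v, g y u v = g' (φ y) (fderiv ℝ φ y u) (fderiv ℝ φ y v))
    (hww' : ∀ᶠ y in nhds z, w' (φ y) = fderiv ℝ φ y (w y)) :
    coordDivergence g' w' (φ z) = coordDivergence g w z := by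
  have hφ1 : DifferentiableAt ℝ φ z := hφ.differentiableAt (by norm_num)
  have hφ2 : DifferentiableAt ℝ (fderiv ℝ φ) z :=
    (hφ.fderiv_right (m := 1) (by norm_num)).differentiableAt (by norm_num)
  have hsymm : IsSymmSndFDerivAt ℝ φ z := hφ.isSymmSndFDerivAt (by simp)
  set D := fderiv ℝ φ z with hD
  set D2 := fderiv ℝ (fderiv ℝ φ) z with hD2
  have hψD (u : E) : ψ (D u) = u := DFunLike.congr_fun hψ u
  have hDψ (u : E) : D (ψ u) = u := DFunLike.congr_fun hψ' u
  have hwz : w' (φ z) = D (w z) := hww'.self_of_nhds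
  have hgz (u v : E) : g z u v = g' (φ z) (D u) (D v) := hgg'.self_of_nhds u v
  -- the derivative of the field
  have e1 : (fderiv ℝ w' (φ z)).comp D = D.comp (fderiv ℝ w z) + D2.flip (w z) := by
    have h1 : HasFDerivAt (fun y ↦ w' (φ y)) ((fderiv ℝ w' (φ z)).comp D) z :=
      hw'.hasFDerivAt.comp z hφ1.hasFDerivAt
    have h2 : HasFDerivAt (fun y ↦ fderiv ℝ φ y (w y)) (D.comp (fderiv ℝ w z) + D2.flip (w z)) z :=
      hφ2.hasFDerivAt.clm_apply hw.hasFDerivAt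
    exact h1.unique (h2.congr_of_eventuallyEq hww')
  let Q : E →ₗ[ℝ] E := (ψ.comp (D2 (w z))).toLinearMap
  have tr1 : LinearMap.trace ℝ E (fderiv ℝ w' (φ z)).toLinearMap =
      LinearMap.trace ℝ E (fderiv ℝ w z).toLinearMap + LinearMap.trace ℝ E Q := by
    have h1 : (fderiv ℝ w' (φ z)).toLinearMap =
        ((D.comp (fderiv ℝ w z) + D2.flip (w z)).toLinearMap).comp ψ.toLinearMap := by
      ext u
      change _ = (D.comp (fderiv ℝ w z) + D2.flip (w z)) (ψ u)
      rw [← e1]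
      simp [hDψ]
    rw [h1, LinearMap.trace_comp_comm', ← map_add]
    congr 1
    ext u
    have h3 : D2 u (w z) = D2 (w z) u := hsymm u (w z)
    simp [Q, hψD, h3]
  obtain ⟨L', hL'⟩ := hmet'.exists_endomorphism (Module.finBasis ℝ E)
    (fderiv ℝ g' (φ z) (D (w z)))
  -- the derivative of the metric
  have e2 (u v : E) : fderiv ℝ g z (w z) u v =
      g z ((ψ.toLinearMap.comp (L'.comp D.toLinearMap) + Q) u) v + g z (Q v) u := by
    have h1 : HasFDerivAt (fun y ↦ g' (φ y)) ((fderiv ℝ g' (φ z)).comp D) z :=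
      HasFDerivAt.comp (G := E →L[ℝ] E →L[ℝ] ℝ) (g := g') z hg'.hasFDerivAt hφ1.hasFDerivAt
    have hu (t : E) : HasFDerivAt (fun y ↦ fderiv ℝ φ y t) (D2.flip t) z := by
      simpa using hφ2.hasFDerivAt.clm_apply (hasFDerivAt_const t z)
    have h2 := (h1.clm_apply (hu u)).clm_apply (hu v)
    have h3 : HasFDerivAt (fun y ↦ g y u v) _ z :=
      h2.congr_of_eventuallyEq (hgg'.mono fun y hy ↦ hy u v)
    rw [← fderiv_clm_apply_const₂ hgd, h3.fderiv]
    simp only [hgz, add_apply, ContinuousLinearMap.comp_apply, ContinuousLinearMap.flip_apply,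
      LinearMap.add_apply, LinearMap.comp_apply, ContinuousLinearMap.coe_coe, Q, map_add, hDψ,
      hL']
    rw [← hD, hmet'.symm (D2 (w z) v)]
    ring
  rw [coordDivergence, coordDivergence, hwz, tr1, metricTrace_of_eq hmet _ _ e2,
    metricTrace_of_eq hmet' L' 0 (by simpa using hL'), map_add]
  have : LinearMap.trace ℝ E (ψ.toLinearMap.comp (L'.comp D.toLinearMap)) =
      LinearMap.trace ℝ E L' := by
    rw [LinearMap.trace_comp_comm', LinearMap.comp_assoc]
    congr 1
    ext u
    simp [hDψ]
  rw [this, map_zero]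
  ring

/-- The contraction in the divergence is the logarithmic derivative of the Gram determinant. -/
theorem hasFDerivAt_det_gramMatrix {F : Type*} [NormedAddCommGroup F] [NormedSpace ℝ F]
    {g : F → E →L[ℝ] E →L[ℝ] ℝ} {z : F} (hg : DifferentiableAt ℝ g z)
    (hmet : IsMetricForm (g z)) {ι : Type*} [Fintype ι] [DecidableEq ι] (b : Module.Basis ι ℝ E) :
    ∃ D : F →L[ℝ] ℝ, HasFDerivAt (fun y ↦ (gramMatrix (g y) b).det) D z ∧
      ∀ a, D a = (gramMatrix (g z) b).det * metricTrace (g z) (fderiv ℝ g z a) := by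
  have h (i j : ι) : HasFDerivAt (fun y ↦ gramMatrix (g y) b i j)
      (((fderiv ℝ g z).flip (b i)).flip (b j)) z := by
    have h2 : HasFDerivAt (fun y ↦ g y (b i)) ((fderiv ℝ g z).flip (b i)) z := by
      simpa using hg.hasFDerivAt.clm_apply (hasFDerivAt_const (b i) z)
    simpa using! h2.clm_apply (hasFDerivAt_const (b j) z)
  refine ⟨_, hasFDerivAt_det h, fun a ↦ ?_⟩
  rw [metricTrace, hmet.contraction_eq (Module.finBasis ℝ E) b]
  simp only [sum_apply, smul_apply, smul_eq_mul, ContinuousLinearMap.flip_apply, Finset.mul_sum]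
  refine Finset.sum_congr rfl fun i _ ↦ Finset.sum_congr rfl fun j _ ↦ ?_
  rw [hmet.inverseGram_comm, inverseGram_eq, Matrix.inv_def, Ring.inverse_eq_inv',
    Matrix.smul_apply, smul_eq_mul, ← mul_assoc, ← mul_assoc,
    mul_inv_cancel₀ (hmet.det_gramMatrix_ne_zero b), one_mul]

end CoordDivergence

/-! ### Tensor fields in charts -/

section Charts

variable {E : Type*} [NormedAddCommGroup E] [NormedSpace ℝ E]
  {H : Type*} [TopologicalSpace H] (I : ModelWithCorners ℝ E H)
  {N : Type*} [TopologicalSpace N] [ChartedSpace H N] [IsManifold I ∞ N]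

/-- The tangent vector at `q` with given components in the chart around `p`. -/
def chartLift (p q : N) : E →L[ℝ] TangentSpace I q :=
  (trivializationAt E (TangentSpace I : N → Type _) p).symmL ℝ q

/-- The components of a tangent vector at `q` in the chart around `p`. -/
def chartCoord (p q : N) : TangentSpace I q →L[ℝ] E :=
  (trivializationAt E (TangentSpace I : N → Type _) p).continuousLinearMapAt ℝ q

variable {I} {p p' q : N}

theorem chartCoord_chartLift (hq : q ∈ (extChartAt I p).source) (v : E) :
    chartCoord I p q (chartLift I p q v) = v := by
  rw [extChartAt_source] at hq
  exact (trivializationAt E (TangentSpace I : N → Type _) p).continuousLinearMapAt_symmL hq v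

theorem chartLift_chartCoord (hq : q ∈ (extChartAt I p).source) (v : TangentSpace I q) :
    chartLift I p q (chartCoord I p q v) = v := by
  rw [extChartAt_source] at hq
  exact (trivializationAt E (TangentSpace I : N → Type _) p).symmL_continuousLinearMapAt hq v

theorem chartLift_eq_tangentCoordChange (hq : q ∈ (extChartAt I p).source) :
    chartLift I p q = tangentCoordChange I p q q := by
  rw [extChartAt_source] at hq
  exact TangentBundle.symmL_trivializationAt_eq_core hq

theorem chartCoord_eq_tangentCoordChange (hq : q ∈ (extChartAt I p).source) (v : E) :
    chartCoord I p q v = (tangentCoordChange I q p q : E →L[ℝ] E) v := by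
  rw [extChartAt_source] at hq
  exact DFunLike.congr_fun (TangentBundle.continuousLinearMapAt_trivializationAt_eq_core hq) v

variable (p) in
theorem chartLift_self (v : E) : (chartLift I p p v : E) = v := by
  rw [chartLift_eq_tangentCoordChange (mem_extChartAt_source p)]
  exact tangentCoordChange_self (E := E) (I := I) (mem_extChartAt_source p)

variable (p) in
theorem chartCoord_self (v : E) : chartCoord I p p v = v := by
  rw [chartCoord_eq_tangentCoordChange (mem_extChartAt_source p)]
  exact tangentCoordChange_self (mem_extChartAt_source p)

theorem chartCoord_comp_chartLift [I.Boundaryless] (hq : q ∈ (extChartAt I p).source)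
    (hq' : q ∈ (extChartAt I p').source) (v : E) :
    chartCoord I p' q (chartLift I p q v) =
      fderiv ℝ (extChartAt I p' ∘ (extChartAt I p).symm) (extChartAt I p q) v := by
  rw [chartLift_eq_tangentCoordChange hq]
  refine (chartCoord_eq_tangentCoordChange hq' _).trans ?_
  refine (tangentCoordChange_comp ⟨⟨hq, mem_extChartAt_source q⟩, hq'⟩).trans ?_
  rw [tangentCoordChange_def, I.range_eq_univ, fderivWithin_univ]

theorem contDiffAt_transition [I.Boundaryless] (hq : q ∈ (extChartAt I p).source)
    (hq' : q ∈ (extChartAt I p').source) :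
    ContDiffAt ℝ ∞ (extChartAt I p' ∘ (extChartAt I p).symm) (extChartAt I p q) := by
  have := contDiffWithinAt_ext_coord_change (I := I) (n := ∞) p' p (y := extChartAt I p q) (by
    rw [PartialEquiv.trans_source'', PartialEquiv.symm_symm, PartialEquiv.symm_target]
    exact Set.mem_image_of_mem _ ⟨hq, hq'⟩)
  rwa [I.range_eq_univ, contDiffWithinAt_univ] at this

/-- A function on the manifold that is smooth at `q` is smooth in every chart around `q`. -/
theorem ContMDiffAt.contDiffAt_comp_extChartAt_symm [I.Boundaryless] {F : Type*}
    [NormedAddCommGroup F] [NormedSpace ℝ F] {f : N → F} (hq : q ∈ (extChartAt I p).source)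
    (hf : ContMDiffAt I 𝓘(ℝ, F) ∞ f q) :
    ContDiffAt ℝ ∞ (fun z ↦ f ((extChartAt I p).symm z)) (extChartAt I p q) := by
  rw [← contMDiffAt_iff_contDiffAt]
  have h1 : ContMDiffAt 𝓘(ℝ, E) I ∞ (extChartAt I p).symm (extChartAt I p q) :=
    (contMDiffOn_extChartAt_symm p).contMDiffAt
      ((isOpen_extChartAt_target p).mem_nhds ((extChartAt I p).map_source hq))
  refine ContMDiffAt.comp (g := f) (extChartAt I p q) ?_ h1
  rwa [(extChartAt I p).left_inv hq]

/-- Smoothness of a vector field at a point. -/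
abbrev SmoothVectorFieldAt (W : (p : N) → TangentSpace I p) (q : N) : Prop :=
  ContMDiffAt I (I.prod 𝓘(ℝ, E)) ∞ (fun p ↦ TotalSpace.mk' E p (W p)) q

theorem smoothVectorFieldAt_iff (W : (p : N) → TangentSpace I p)
    (hq : q ∈ (extChartAt I p).source) :
    SmoothVectorFieldAt W q ↔ ContMDiffAt I 𝓘(ℝ, E) ∞ (fun y ↦ chartCoord I p y (W y)) q := by
  have hq' := hq
  rw [extChartAt_source] at hq
  rw [SmoothVectorFieldAt, Bundle.Trivialization.contMDiffAt_section_iff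
    (trivializationAt E (TangentSpace I : N → Type _) p) hq]
  refine Filter.EventuallyEq.contMDiffAt_iff ?_
  filter_upwards [(chartAt H p).open_source.mem_nhds hq] with y hy
  exact (Bundle.Trivialization.continuousLinearMapAt_apply_of_mem (R := ℝ)
    (e := trivializationAt E (TangentSpace I : N → Type _) p) hy (W y)).symm

theorem smoothVectorFieldOn_univ_iff (W : (p : N) → TangentSpace I p) :
    SmoothVectorFieldOn I W Set.univ ↔ ∀ q, SmoothVectorFieldAt W q := by
  simp only [SmoothVectorFieldOn, contMDiffOn_univ]
  rfl

theorem contDiffAt_chartField [I.Boundaryless] {W : (p : N) → TangentSpace I p}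
    (hq : q ∈ (extChartAt I p).source) (hW : SmoothVectorFieldAt W q) :
    ContDiffAt ℝ ∞ (chartField W p) (extChartAt I p q) :=
  ((smoothVectorFieldAt_iff W hq).1 hW).contDiffAt_comp_extChartAt_symm hq

theorem smoothVectorFieldAt_of_chartField [I.Boundaryless] {W : (p : N) → TangentSpace I p}
    (hq : q ∈ (extChartAt I p).source)
    (hW : ContDiffAt ℝ ∞ (chartField W p) (extChartAt I p q)) : SmoothVectorFieldAt W q := by
  rw [smoothVectorFieldAt_iff W hq]
  have h1 : ContMDiffAt I 𝓘(ℝ, E) ∞ (extChartAt I p) q := by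
    rw [extChartAt_source] at hq; exact contMDiffAt_extChartAt' hq
  refine (ContMDiffAt.comp (g := chartField W p) q hW.contMDiffAt h1).congr_of_eventuallyEq ?_
  filter_upwards [(isOpen_extChartAt_source p).mem_nhds hq] with y hy
  change _ = chartCoord I p _ _
  rw [(extChartAt I p).left_inv hy]

theorem chartField_extChartAt {W : (p : N) → TangentSpace I p}
    (hq : q ∈ (extChartAt I p).source) :
    chartField W p (extChartAt I p q) = chartCoord I p q (W q) := by
  change chartCoord I p _ _ = _
  rw [(extChartAt I p).left_inv hq]

variable (p) in
/-- The metric in the chart around `p`, as a bilinear form on the model space. -/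
def chartForm (g : (q : N) → TangentSpace I q →L[ℝ] TangentSpace I q →L[ℝ] ℝ) (z : E) :
    E →L[ℝ] E →L[ℝ] ℝ :=
  pullbackForm (g ((extChartAt I p).symm z)) (chartLift I p ((extChartAt I p).symm z))

theorem chartForm_extChartAt (g : (q : N) → TangentSpace I q →L[ℝ] TangentSpace I q →L[ℝ] ℝ)
    (hq : q ∈ (extChartAt I p).source) (u v : E) :
    chartForm p g (extChartAt I p q) u v = g q (chartLift I p q u) (chartLift I p q v) := by
  change g _ (chartLift I p _ u) (chartLift I p _ v) = _
  rw [(extChartAt I p).left_inv hq]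

variable (p) in
theorem chartForm_self (g : (q : N) → TangentSpace I q →L[ℝ] TangentSpace I q →L[ℝ] ℝ) (u v : E) :
    chartForm p g (extChartAt I p p) u v = g p u v := by
  rw [chartForm_extChartAt g (mem_extChartAt_source p), chartLift_self, chartLift_self]

namespace PseudoRiemannianMetric

theorem isMetricForm (g : PseudoRiemannianMetric I N) (p : N) : IsMetricForm (g.inner p) :=
  ⟨g.symm p, g.nondegenerate p⟩

theorem isMetricForm_chartForm (g : PseudoRiemannianMetric I N)
    (hq : q ∈ (extChartAt I p).source) :
    IsMetricForm (chartForm p g.inner (extChartAt I p q)) where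
  symm v w := by simp only [chartForm_extChartAt g.inner hq, g.symm]
  nondegenerate v hv := by
    simp only [chartForm_extChartAt g.inner hq] at hv
    have : chartLift I p q v = 0 := g.nondegenerate q _ fun w ↦ by
      rw [← chartLift_chartCoord hq w]; exact hv _
    rw [← chartCoord_chartLift hq v, this, map_zero]

theorem contMDiffAt_inner (g : PseudoRiemannianMetric I N) {V W : (p : N) → TangentSpace I p}
    (hV : SmoothVectorFieldAt V q) (hW : SmoothVectorFieldAt W q) :
    ContMDiffAt I 𝓘(ℝ, ℝ) ∞ (fun y ↦ g.inner y (V y) (W y)) q := by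
  have : ContMDiffAt I (I.prod 𝓘(ℝ)) ∞
      (fun y ↦ TotalSpace.mk' ℝ (E := Bundle.Trivial N ℝ) y (g.inner y (V y) (W y))) q :=
    ContMDiffAt.clm_bundle_apply₂ (F₁ := E) (F₂ := E) (b := fun y : N ↦ y) g.contMDiff.contMDiffAt hV hW
  rw [contMDiffAt_totalSpace] at this
  exact this.2

variable (q) in
theorem smoothVectorFieldAt_chartLift (hq : q ∈ (extChartAt I p).source) (v : E) :
    SmoothVectorFieldAt (fun y ↦ chartLift I p y v) q := by
  rw [smoothVectorFieldAt_iff _ hq]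
  refine contMDiffAt_const (c := v) |>.congr_of_eventuallyEq ?_
  filter_upwards [(isOpen_extChartAt_source p).mem_nhds hq] with y hy
  exact chartCoord_chartLift hy v

theorem contDiffOn_chartForm [FiniteDimensional ℝ E] [I.Boundaryless]
    (g : PseudoRiemannianMetric I N) (p : N) :
    ContDiffOn ℝ ∞ (chartForm p g.inner) (extChartAt I p).target := by
  have key (u v : E) : ContDiffOn ℝ ∞ (fun z ↦ chartForm p g.inner z u v)
      (extChartAt I p).target := fun z hz ↦ by
    have h := (g.contMDiffAt_inner (smoothVectorFieldAt_chartLift _ ((extChartAt I p).map_target hz) u)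
      (smoothVectorFieldAt_chartLift _ ((extChartAt I p).map_target hz) v)
        ).contDiffAt_comp_extChartAt_symm ((extChartAt I p).map_target hz)
    rw [(extChartAt I p).right_inv hz] at h
    exact h.contDiffWithinAt
  exact contDiffOn_clm_apply.2 fun u ↦ contDiffOn_clm_apply.2 (key u)

theorem contDiffAt_chartForm [FiniteDimensional ℝ E] [I.Boundaryless]
    (g : PseudoRiemannianMetric I N) (hq : q ∈ (extChartAt I p).source) :
    ContDiffAt ℝ ∞ (chartForm p g.inner) (extChartAt I p q) :=
  (g.contDiffOn_chartForm p).contDiffAt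
    ((isOpen_extChartAt_target p).mem_nhds ((extChartAt I p).map_source hq))

end PseudoRiemannianMetric

/-! ### The divergence in charts -/

namespace PseudoRiemannianMetric

variable (g : PseudoRiemannianMetric I N)

/-- The metric at `p` as a form on the model space. -/
def form (p : N) : E →L[ℝ] E →L[ℝ] ℝ := g.inner p

theorem isMetricForm_form (p : N) : IsMetricForm (g.form p) := g.isMetricForm p

theorem chartForm_self_eq (p : N) : chartForm p g.inner (extChartAt I p p) = g.form p := by
  ext u v; exact chartForm_self p g.inner u v

variable [FiniteDimensional ℝ E] [I.Boundaryless]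

theorem differentiableAt_chartForm_self (p : N) :
    DifferentiableAt ℝ (chartForm p g.inner) (extChartAt I p p) :=
  (g.contDiffAt_chartForm (mem_extChartAt_source p)).differentiableAt (by simp)

omit [I.Boundaryless] in
/-- The Christoffel term, as a vector of the model space. -/
def christoffelVector (p : N) (v w : E) : E := christoffel g.inner p v w

theorem form_christoffelVector (p : N) (v w t : E) :
    g.form p (g.christoffelVector p v w) t = (1 / 2 : ℝ) *
      (fderiv ℝ (chartForm p g.inner) (extChartAt I p p) v w t +
        fderiv ℝ (chartForm p g.inner) (extChartAt I p p) w v t -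
        fderiv ℝ (chartForm p g.inner) (extChartAt I p p) t v w) := by
  have hd := g.differentiableAt_chartForm_self p
  set D := fderiv ℝ (chartForm p g.inner) (extChartAt I p p) with hD
  have hD' (a c d : E) :
      fderiv ℝ (fun z ↦ chartMetric g.inner p z c d) (extChartAt I p p) a = D a c d :=
    fderiv_clm_apply_const₂ hd a c d
  let c : E →L[ℝ] ℝ := (1 / 2 : ℝ) • (D v w + D w v - (D.flip v).flip w)
  have hc : g.christoffelVector p v w = ∑ j, ∑ l,
      (inverseGram (g.form p) (Module.finBasis ℝ E) j l *
        c.toLinearMap (Module.finBasis ℝ E j)) • (Module.finBasis ℝ E l : E) := by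
    let b := Module.finBasis ℝ E
    let D' (a c d : E) : ℝ :=
      fderiv ℝ (fun z ↦ chartMetric g.inner p z c d) (extChartAt I p p) a
    change ∑ j, ∑ l, (inverseGram (g.form p) b j l *
      ((1 / 2 : ℝ) * (D' v w (b j) + D' w v (b j) - D' (b j) v w))) • b l = _
    simp only [D', hD']
    rfl
  rw [hc]
  exact (g.isMetricForm_form p).inner_sum_inverseGram (Module.finBasis ℝ E) c.toLinearMap t

theorem christoffelVector_add_left (p : N) (v v' w : E) :
    g.christoffelVector p (v + v') w = g.christoffelVector p v w + g.christoffelVector p v' w := by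
  rw [← sub_eq_zero]
  refine (g.isMetricForm_form p).nondegenerate _ fun t ↦ ?_
  rw [map_sub, map_add, sub_apply, add_apply]
  simp only [form_christoffelVector]
  rw [ContinuousLinearMap.map_add, ContinuousLinearMap.map_add, ContinuousLinearMap.map_add,
    add_apply, add_apply, add_apply, add_apply]
  ring

theorem christoffelVector_smul_left (p : N) (r : ℝ) (v w : E) :
    g.christoffelVector p (r • v) w = r • g.christoffelVector p v w := by
  rw [← sub_eq_zero]
  refine (g.isMetricForm_form p).nondegenerate _ fun t ↦ ?_
  rw [map_sub, map_smul, sub_apply, smul_apply]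
  simp only [form_christoffelVector]
  rw [ContinuousLinearMap.map_smul, ContinuousLinearMap.map_smul, ContinuousLinearMap.map_smul,
    smul_apply, smul_apply, smul_apply, smul_apply]
  simp only [smul_eq_mul]
  ring

theorem christoffelVector_add_right (p : N) (v w w' : E) :
    g.christoffelVector p v (w + w') = g.christoffelVector p v w + g.christoffelVector p v w' := by
  rw [← sub_eq_zero]
  refine (g.isMetricForm_form p).nondegenerate _ fun t ↦ ?_
  rw [map_sub, map_add, sub_apply, add_apply]
  simp only [form_christoffelVector]
  rw [ContinuousLinearMap.map_add, ContinuousLinearMap.map_add, ContinuousLinearMap.map_add,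
    add_apply, add_apply, add_apply]
  ring

theorem christoffelVector_smul_right (p : N) (r : ℝ) (v w : E) :
    g.christoffelVector p v (r • w) = r • g.christoffelVector p v w := by
  rw [← sub_eq_zero]
  refine (g.isMetricForm_form p).nondegenerate _ fun t ↦ ?_
  rw [map_sub, map_smul, sub_apply, smul_apply]
  simp only [form_christoffelVector]
  rw [ContinuousLinearMap.map_smul, ContinuousLinearMap.map_smul, ContinuousLinearMap.map_smul,
    smul_apply, smul_apply, smul_apply]
  simp only [smul_eq_mul]
  ring

/-- The Christoffel term as a linear map of its first argument. -/
def christoffelLinear (p : N) (w : E) : E →ₗ[ℝ] E where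
  toFun v := g.christoffelVector p v w
  map_add' u v := g.christoffelVector_add_left p u v w
  map_smul' r v := g.christoffelVector_smul_left p r v w

/-- The covariant derivative `v ↦ ∇_v W` as a linear map. -/
def covDerivLinear (W : (q : N) → TangentSpace I q) (p : N) : E →ₗ[ℝ] E :=
  (fderiv ℝ (chartField W p) (extChartAt I p p)).toLinearMap + g.christoffelLinear p (W p)

theorem divergence_eq_trace (W : (q : N) → TangentSpace I q) (p : N) :
    divergence g.inner W p = LinearMap.trace ℝ E (g.covDerivLinear W p) :=
  (g.isMetricForm_form p).sum_inverseGram_eq_trace (Module.finBasis ℝ E) (g.covDerivLinear W p)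

theorem fderiv_chartForm_symm (p : N) (a u v : E) :
    fderiv ℝ (chartForm p g.inner) (extChartAt I p p) a u v =
      fderiv ℝ (chartForm p g.inner) (extChartAt I p p) a v u := by
  have hd := g.differentiableAt_chartForm_self p
  rw [← fderiv_clm_apply_const₂ hd, ← fderiv_clm_apply_const₂ hd]
  congr 2
  ext z
  exact g.symm _ _ _

theorem divergence_eq_coordDivergence_self (W : (q : N) → TangentSpace I q) (p : N) :
    divergence g.inner W p =
      coordDivergence (chartForm p g.inner) (chartField W p) (extChartAt I p p) := by
  have hB := g.isMetricForm_form p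
  let b := Module.finBasis ℝ E
  have hw : chartField W p (extChartAt I p p) = W p := by
    rw [chartField_extChartAt (mem_extChartAt_source p)]
    exact chartCoord_self p _
  rw [g.divergence_eq_trace, coordDivergence, g.chartForm_self_eq, hw]
  set D := fderiv ℝ (chartForm p g.inner) (extChartAt I p p) with hD
  let w : E := W p
  set G := inverseGram (g.form p) b with hG
  have e1 : LinearMap.trace ℝ E (g.covDerivLinear W p) = ∑ r, ∑ s, (G r s *
      g.form p ((fderiv ℝ (chartField W p) (extChartAt I p p)).toLinearMap (b r)) (b s) +
      (1 / 2 : ℝ) * (G r s * D (b r) w (b s)) + (1 / 2 : ℝ) * (G r s * D w (b r) (b s)) -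
      (1 / 2 : ℝ) * (G r s * D (b s) (b r) w)) := by
    rw [← hB.sum_inverseGram_eq_trace b]
    refine Finset.sum_congr rfl fun r _ ↦ Finset.sum_congr rfl fun s _ ↦ ?_
    have h2 : g.covDerivLinear W p (b r) =
        fderiv ℝ (chartField W p) (extChartAt I p p) (b r) + g.christoffelVector p (b r) w := rfl
    rw [h2, map_add, add_apply, form_christoffelVector, ContinuousLinearMap.coe_coe]
    ring
  have e2 : ∑ r, ∑ s, G r s * D (b s) (b r) w = ∑ r, ∑ s, G r s * D (b r) w (b s) := by
    rw [Finset.sum_comm]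
    refine Finset.sum_congr rfl fun r _ ↦ Finset.sum_congr rfl fun s _ ↦ ?_
    rw [hG, hB.inverseGram_comm, g.fderiv_chartForm_symm]
  rw [e1]
  simp only [Finset.sum_sub_distrib, Finset.sum_add_distrib, ← Finset.mul_sum, e2]
  rw [hB.sum_inverseGram_eq_trace b, metricTrace]
  change _ = _ + 1 / 2 * ∑ r, ∑ s, G r s * D w (b r) (b s)
  ring

/-- The divergence is given by the coordinate expression in every chart. -/
theorem divergence_eq_coordDivergence {W : (q : N) → TangentSpace I q} {p q : N}
    (hq : q ∈ (extChartAt I p).source) (hW : SmoothVectorFieldAt W q) :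
    divergence g.inner W q =
      coordDivergence (chartForm p g.inner) (chartField W p) (extChartAt I p q) := by
  rw [g.divergence_eq_coordDivergence_self]
  set φ := extChartAt I q ∘ (extChartAt I p).symm with hφ
  have hq' := mem_extChartAt_source (I := I) q
  have hφy {y : N} (hy : y ∈ (extChartAt I p).source) : φ (extChartAt I p y) = extChartAt I q y :=
    congrArg (extChartAt I q) ((extChartAt I p).left_inv hy)
  have hφz := hφy hq
  have hφs : ContDiffAt ℝ ∞ φ (extChartAt I p q) := contDiffAt_transition hq hq'
  have hev : ∀ᶠ z in nhds (extChartAt I p q), ∃ y, y ∈ (extChartAt I p).source ∧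
      y ∈ (extChartAt I q).source ∧ z = extChartAt I p y := by
    have h1 : (extChartAt I q).source ∈ nhds ((extChartAt I p).symm (extChartAt I p q)) := by
      rw [(extChartAt I p).left_inv hq]; exact extChartAt_source_mem_nhds q
    filter_upwards [(isOpen_extChartAt_target p).mem_nhds ((extChartAt I p).map_source hq),
      (continuousAt_extChartAt_symm' hq).preimage_mem_nhds h1] with z hz hz'
    exact ⟨_, (extChartAt I p).map_target hz, hz', ((extChartAt I p).right_inv hz).symm⟩
  rw [← hφz]
  refine coordDivergence_pullback (hφs.of_le (by norm_cast))
    ((chartCoord I p q).comp (chartLift I q q)) ?_ ?_ ?_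
    ((contDiffAt_chartField hq hW).differentiableAt (by simp)) ?_ ?_
    (g.isMetricForm_chartForm hq) ((g.contDiffAt_chartForm hq).differentiableAt (by simp)) ?_ ?_
  · ext v
    simp only [ContinuousLinearMap.comp_apply, ContinuousLinearMap.id_apply]
    rw [← chartCoord_comp_chartLift hq hq', chartLift_chartCoord hq', chartCoord_chartLift hq]
  · ext v
    simp only [ContinuousLinearMap.comp_apply, ContinuousLinearMap.id_apply]
    rw [← chartCoord_comp_chartLift hq hq', chartLift_chartCoord hq, chartCoord_chartLift hq']
  · rw [hφz]; exact (g.contDiffAt_chartForm hq').differentiableAt (by simp)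
  · rw [hφz]; exact (contDiffAt_chartField hq' hW).differentiableAt (by simp)
  · rw [hφz]; exact g.isMetricForm_chartForm hq'
  · filter_upwards [hev]
    rintro z ⟨y, hyp, hyq, rfl⟩ u v
    rw [hφy hyp, chartForm_extChartAt _ hyp, chartForm_extChartAt _ hyq,
      ← chartCoord_comp_chartLift hyp hyq, ← chartCoord_comp_chartLift hyp hyq,
      chartLift_chartCoord hyq, chartLift_chartCoord hyq]
  · filter_upwards [hev]
    rintro z ⟨y, hyp, hyq, rfl⟩
    rw [hφy hyp, chartField_extChartAt hyp, chartField_extChartAt hyq,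
      ← chartCoord_comp_chartLift hyp hyq, chartLift_chartCoord hyp]

end PseudoRiemannianMetric
end Charts

section CovariantDerivative

variable {E : Type*} [NormedAddCommGroup E] [NormedSpace ℝ E]
  {H : Type*} [TopologicalSpace H] {I : ModelWithCorners ℝ E H}
  {N : Type*} [TopologicalSpace N] [ChartedSpace H N] [IsManifold I ∞ N]

theorem chartField_eventuallyEq [I.Boundaryless] {W W' : (q : N) → TangentSpace I q} {p q : N}
    (hq : q ∈ (extChartAt I p).source) (h : ∀ᶠ y in nhds q, W y = W' y) :
    chartField W p =ᶠ[nhds (extChartAt I p q)] chartField W' p := by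
  have h1 : {y | W y = W' y} ∈ nhds ((extChartAt I p).symm (extChartAt I p q)) := by
    rwa [(extChartAt I p).left_inv hq]
  filter_upwards [(continuousAt_extChartAt_symm' hq).preimage_mem_nhds h1] with z hz
  exact congrArg (chartCoord I p _) hz

namespace SmoothVectorFieldAt

variable {V W : (q : N) → TangentSpace I q} {p : N}

theorem differentiableAt_chartField [I.Boundaryless] (hW : SmoothVectorFieldAt W p) :
    DifferentiableAt ℝ (chartField W p) (extChartAt I p p) :=
  (contDiffAt_chartField (mem_extChartAt_source p) hW).differentiableAt (by simp)

theorem congr_of_eventuallyEq (hW : SmoothVectorFieldAt W p)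
    (h : ∀ᶠ y in nhds p, V y = W y) : SmoothVectorFieldAt V p :=
  ContMDiffAt.congr_of_eventuallyEq hW (h.mono fun y hy ↦ by simp only [hy])

theorem smul {f : N → ℝ} (hf : ContMDiffAt I 𝓘(ℝ) ∞ f p) (hW : SmoothVectorFieldAt W p) :
    SmoothVectorFieldAt (fun q ↦ f q • W q) p := ContMDiffAt.smul_section hf hW

theorem sum {ι : Type*} {s : Finset ι} {V : ι → (q : N) → TangentSpace I q}
    (hV : ∀ i ∈ s, SmoothVectorFieldAt (V i) p) :
    SmoothVectorFieldAt (fun q ↦ ∑ i ∈ s, V i q) p := ContMDiffAt.sum_section hV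

end SmoothVectorFieldAt

/-- A tangent vector as a vector of the model space. -/
def modelVector {p : N} (v : TangentSpace I p) : E := v

/-- The differential of a function, computed in the chart around `p`. -/
def chartDeriv {F : Type*} [NormedAddCommGroup F] [NormedSpace ℝ F] (f : N → F) (p : N) :
    E →L[ℝ] F :=
  fderiv ℝ (fun z ↦ f ((extChartAt I p).symm z)) (extChartAt I p p)

omit [IsManifold I ∞ N] in
theorem mfderiv_eq_chartDeriv [I.Boundaryless] {F : Type*} [NormedAddCommGroup F] [NormedSpace ℝ F]
    {f : N → F} {p : N} (hf : ContMDiffAt I 𝓘(ℝ, F) ∞ f p) (v : E) :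
    (mfderiv I 𝓘(ℝ, F) f p v : F) = chartDeriv (I := I) f p v := by
  rw [(hf.mdifferentiableAt (by simp)).mfderiv, I.range_eq_univ, fderivWithin_univ]
  rfl

namespace PseudoRiemannianMetric

variable [FiniteDimensional ℝ E] [I.Boundaryless] (g : PseudoRiemannianMetric I N)
  {V W : (q : N) → TangentSpace I q} {p : N}

omit [I.Boundaryless] in
theorem covDerivLinear_apply (W : (q : N) → TangentSpace I q) (p : N) [I.Boundaryless] (v : E) :
    g.covDerivLinear W p v =
      fderiv ℝ (chartField W p) (extChartAt I p p) v + g.christoffelVector p v (W p) := rfl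

theorem covDerivLinear_congr (h : ∀ᶠ y in nhds p, V y = W y) :
    g.covDerivLinear V p = g.covDerivLinear W p := by
  rw [covDerivLinear, covDerivLinear, h.self_of_nhds,
    (chartField_eventuallyEq (mem_extChartAt_source p) h).fderiv_eq]

theorem divergence_congr (h : ∀ᶠ y in nhds p, V y = W y) :
    divergence g.inner V p = divergence g.inner W p := by
  rw [g.divergence_eq_trace, g.divergence_eq_trace, g.covDerivLinear_congr h]

theorem covDerivLinear_add (hV : SmoothVectorFieldAt V p) (hW : SmoothVectorFieldAt W p) :
    g.covDerivLinear (fun q ↦ V q + W q) p = g.covDerivLinear V p + g.covDerivLinear W p := by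
  ext v
  have h1 : chartField (fun q ↦ V q + W q) p = fun z ↦ chartField V p z + chartField W p z := by
    ext z; exact map_add (chartCoord I p _) _ _
  rw [LinearMap.add_apply, covDerivLinear_apply, covDerivLinear_apply, covDerivLinear_apply, h1,
    fderiv_fun_add hV.differentiableAt_chartField hW.differentiableAt_chartField, add_apply,
    add_add_add_comm]
  congr 1
  exact g.christoffelVector_add_right p v (V p) (W p)

theorem covDerivLinear_smul {f : N → ℝ} (hf : ContMDiffAt I 𝓘(ℝ) ∞ f p)
    (hW : SmoothVectorFieldAt W p) (v : E) :
    g.covDerivLinear (fun q ↦ f q • W q) p v =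
      chartDeriv (I := I) f p v • modelVector (W p) + f p • g.covDerivLinear W p v := by
  have h1 : chartField (fun q ↦ f q • W q) p =
      fun z ↦ f ((extChartAt I p).symm z) • chartField W p z := by
    ext z; exact map_smul (chartCoord I p _) _ _
  have h2 : DifferentiableAt ℝ (fun z ↦ f ((extChartAt I p).symm z)) (extChartAt I p p) :=
    (hf.contDiffAt_comp_extChartAt_symm (mem_extChartAt_source p)).differentiableAt (by simp)
  have h3 : chartField W p (extChartAt I p p) = modelVector (W p) := by
    rw [chartField_extChartAt (mem_extChartAt_source p)]
    exact chartCoord_self p _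
  rw [covDerivLinear_apply, covDerivLinear_apply, h1,
    fderiv_fun_smul h2 hW.differentiableAt_chartField, add_apply, smul_apply,
    ContinuousLinearMap.smulRight_apply, h3, extChartAt_to_inv]
  refine (congrArg₂ (· + ·) rfl (g.christoffelVector_smul_right p (f p) v (W p))).trans ?_
  rw [smul_add, chartDeriv]
  change _ + f p • g.christoffelVector p v (modelVector (W p)) =
    _ + (_ + f p • g.christoffelVector p v (modelVector (W p)))
  abel

theorem divergence_add (hV : SmoothVectorFieldAt V p) (hW : SmoothVectorFieldAt W p) :
    divergence g.inner (fun q ↦ V q + W q) p =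
      divergence g.inner V p + divergence g.inner W p := by
  rw [g.divergence_eq_trace, g.divergence_eq_trace, g.divergence_eq_trace,
    g.covDerivLinear_add hV hW, map_add]

theorem divergence_zero : divergence g.inner (fun _ ↦ 0) p = 0 := by
  have h0 : SmoothVectorFieldAt (fun q : N ↦ (0 : TangentSpace I q)) p :=
    (smoothVectorFieldAt_iff _ (mem_extChartAt_source p)).2 (by simpa using contMDiffAt_const)
  have := g.divergence_add h0 h0
  simpa using this

theorem divergence_sum {ι : Type*} (s : Finset ι) {V : ι → (q : N) → TangentSpace I q}
    (hV : ∀ i ∈ s, SmoothVectorFieldAt (V i) p) :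
    divergence g.inner (fun q ↦ ∑ i ∈ s, V i q) p = ∑ i ∈ s, divergence g.inner (V i) p := by
  classical
  induction s using Finset.induction_on with
  | empty => simpa using g.divergence_zero
  | insert a s ha ih =>
    simp only [Finset.sum_insert ha]
    rw [g.divergence_add (hV a (Finset.mem_insert_self _ _))
      (SmoothVectorFieldAt.sum fun i hi ↦ hV i (Finset.mem_insert_of_mem hi)),
      ih fun i hi ↦ hV i (Finset.mem_insert_of_mem hi)]

/-- The Leibniz rule for the divergence. -/
theorem divergence_smul {f : N → ℝ} (hf : ContMDiffAt I 𝓘(ℝ) ∞ f p)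
    (hW : SmoothVectorFieldAt W p) :
    divergence g.inner (fun q ↦ f q • W q) p =
      chartDeriv (I := I) f p (W p) + f p * divergence g.inner W p := by
  have h : g.covDerivLinear (fun q ↦ f q • W q) p =
      (chartDeriv (I := I) f p).toLinearMap.smulRight (modelVector (W p)) + f p • g.covDerivLinear W p := by
    ext v; exact g.covDerivLinear_smul hf hW v
  rw [g.divergence_eq_trace, g.divergence_eq_trace, h, map_add, map_smul, smul_eq_mul,
    LinearMap.trace_smulRight]
  rfl

/-- The covariant derivative is compatible with the metric. -/
theorem chartDeriv_inner (hV : SmoothVectorFieldAt V p) (hW : SmoothVectorFieldAt W p) (a : E) :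
    chartDeriv (I := I) (fun q ↦ g.inner q (V q) (W q)) p a =
      g.form p (g.covDerivLinear V p a) (W p) + g.form p (V p) (g.covDerivLinear W p a) := by
  have hd := g.differentiableAt_chartForm_self p
  have hself (U : (q : N) → TangentSpace I q) : chartField U p (extChartAt I p p) = U p := by
    rw [chartField_extChartAt (mem_extChartAt_source p)]
    exact chartCoord_self p _
  have h1 : (fun z ↦ g.inner ((extChartAt I p).symm z) (V ((extChartAt I p).symm z))
      (W ((extChartAt I p).symm z))) =ᶠ[nhds (extChartAt I p p)]
      fun z ↦ chartForm p g.inner z (chartField V p z) (chartField W p z) := by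
    filter_upwards [(isOpen_extChartAt_target p).mem_nhds (mem_extChartAt_target p)] with z hz
    have hz' := (extChartAt I p).map_target hz
    change _ = g.inner _ (chartLift I p _ (chartCoord I p _ _))
      (chartLift I p _ (chartCoord I p _ _))
    rw [chartLift_chartCoord hz', chartLift_chartCoord hz']
  have h2 := (hd.hasFDerivAt.clm_apply hV.differentiableAt_chartField.hasFDerivAt).clm_apply
    hW.differentiableAt_chartField.hasFDerivAt
  rw [chartDeriv, h1.fderiv_eq, h2.fderiv]
  let v : E := V p
  let w : E := W p
  have hv : chartField V p (extChartAt I p p) = v := hself V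
  have hw : chartField W p (extChartAt I p p) = w := hself W
  change _ = g.form p (fderiv ℝ (chartField V p) (extChartAt I p p) a +
    g.christoffelVector p a v) w + g.form p v (fderiv ℝ (chartField W p) (extChartAt I p p) a +
    g.christoffelVector p a w)
  rw [hv, hw, g.chartForm_self_eq]
  have hs : g.form p v (g.christoffelVector p a w) = g.form p (g.christoffelVector p a w) v :=
    (g.isMetricForm_form p).symm _ _
  rw [ContinuousLinearMap.map_add, ContinuousLinearMap.map_add, add_apply (g.form p _), hs, form_christoffelVector, form_christoffelVector]
  rw [g.fderiv_chartForm_symm p w a v, g.fderiv_chartForm_symm p v a w,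
    g.fderiv_chartForm_symm p a w v]
  simp only [add_apply, ContinuousLinearMap.comp_apply,
    ContinuousLinearMap.flip_apply]
  ring

end PseudoRiemannianMetric
end CovariantDerivative

/-! ### The Riemannian volume measure in charts -/

theorem ContinuousOn.measurableSet_inter_preimage {X Y : Type*} [TopologicalSpace X]
    [MeasurableSpace X] [OpensMeasurableSpace X] [TopologicalSpace Y] [MeasurableSpace Y]
    [BorelSpace Y] {f : X → Y} {s : Set X} (hf : ContinuousOn f s) (hs : MeasurableSet s)
    {A : Set Y} (hA : MeasurableSet A) : MeasurableSet (f ⁻¹' A ∩ s) := by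
  have h := (continuousOn_iff_continuous_domRestrict.1 hf).measurable hA
  have h' := hs.subtype_image h
  convert h' using 1
  ext x
  simp [and_comm]

theorem gramMatrix_pullbackForm {E F ι : Type*} [NormedAddCommGroup E] [NormedSpace ℝ E]
    [NormedAddCommGroup F] [NormedSpace ℝ F]
    [Fintype ι] [DecidableEq ι] (B : E →L[ℝ] E →L[ℝ] ℝ) (b : Module.Basis ι ℝ E)
    (b' : Module.Basis ι ℝ F) (T : F →L[ℝ] E) :
    gramMatrix (pullbackForm B T) b' =
      (LinearMap.toMatrix b' b T.toLinearMap).transpose * gramMatrix B b *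
        LinearMap.toMatrix b' b T.toLinearMap := by
  ext i j
  have h (v : F) : T v = ∑ l, b.repr (T v) l • b l := (b.sum_repr (T v)).symm
  change B (T (b' i)) (T (b' j)) = _
  nth_rewrite 1 [h (b' i)]
  nth_rewrite 1 [h (b' j)]
  simp only [map_sum, map_smul, sum_apply, smul_apply, smul_eq_mul, Matrix.mul_apply,
    Matrix.transpose_apply, LinearMap.toMatrix_apply, ContinuousLinearMap.coe_coe, gramMatrix,
    Matrix.of_apply, Finset.sum_mul, Finset.mul_sum]
  exact Finset.sum_congr rfl fun l _ ↦ Finset.sum_congr rfl fun r _ ↦ by ring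

section Volume

variable {k : ℕ} {K : Type*} [TopologicalSpace K] [ChartedSpace (EuclideanSpace ℝ (Fin k)) K]
  [IsManifold (𝓡 k) ∞ K]

/-- The density of the volume measure in the chart around `y`. -/
def chartDensity (g : (y : K) → TangentSpace (𝓡 k) y →L[ℝ] TangentSpace (𝓡 k) y →L[ℝ] ℝ) (y : K)
    (z : EuclideanSpace ℝ (Fin k)) : ℝ :=
  √|(gramMatrix (chartForm y g z) (EuclideanSpace.basisFun (Fin k) ℝ).toBasis).det|

theorem chartDensity_nonneg
    (g : (y : K) → TangentSpace (𝓡 k) y →L[ℝ] TangentSpace (𝓡 k) y →L[ℝ] ℝ) (y : K)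
    (z : EuclideanSpace ℝ (Fin k)) : 0 ≤ chartDensity g y z := Real.sqrt_nonneg _

theorem continuousOn_chartDensity (g : PseudoRiemannianMetric (𝓡 k) K) (y : K) :
    ContinuousOn (chartDensity g.inner y) (extChartAt (𝓡 k) y).target := by
  have h : Continuous fun B : EuclideanSpace ℝ (Fin k) →L[ℝ] EuclideanSpace ℝ (Fin k) →L[ℝ] ℝ ↦
      √|(gramMatrix B (EuclideanSpace.basisFun (Fin k) ℝ).toBasis).det| := by
    refine (continuous_abs.comp (Continuous.matrix_det (continuous_matrix fun i j ↦ ?_))).sqrt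
    change Continuous fun B : EuclideanSpace ℝ (Fin k) →L[ℝ] EuclideanSpace ℝ (Fin k) →L[ℝ] ℝ ↦
      B _ _
    fun_prop
  exact h.comp_continuousOn (g.contDiffOn_chartForm y).continuousOn

/-- The densities in two charts are related by the Jacobian of the transition map. -/
theorem chartDensity_transition (g : PseudoRiemannianMetric (𝓡 k) K) {y y' q : K}
    (hq : q ∈ (extChartAt (𝓡 k) y).source) (hq' : q ∈ (extChartAt (𝓡 k) y').source) :
    chartDensity g.inner y (extChartAt (𝓡 k) y q) =
      |(fderiv ℝ (extChartAt (𝓡 k) y' ∘ (extChartAt (𝓡 k) y).symm) (extChartAt (𝓡 k) y q)).det| *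
        chartDensity g.inner y' (extChartAt (𝓡 k) y' q) := by
  set T := fderiv ℝ (extChartAt (𝓡 k) y' ∘ (extChartAt (𝓡 k) y).symm) (extChartAt (𝓡 k) y q)
    with hT
  let b := (EuclideanSpace.basisFun (Fin k) ℝ).toBasis
  have h : chartForm y g.inner (extChartAt (𝓡 k) y q) =
      pullbackForm (chartForm y' g.inner (extChartAt (𝓡 k) y' q)) T := by
    ext u v
    change _ = chartForm y' g.inner (extChartAt (𝓡 k) y' q) (T u) (T v)
    rw [chartForm_extChartAt _ hq, chartForm_extChartAt _ hq', hT,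
      ← chartCoord_comp_chartLift hq hq', ← chartCoord_comp_chartLift hq hq',
      chartLift_chartCoord hq', chartLift_chartCoord hq']
  rw [chartDensity, chartDensity, h, gramMatrix_pullbackForm _ b b, Matrix.det_mul, Matrix.det_mul,
    Matrix.det_transpose, LinearMap.det_toMatrix]
  change √|T.det * _ * T.det| = |T.det| * _
  rw [mul_right_comm, abs_mul, abs_mul_self, Real.sqrt_mul (mul_self_nonneg _),
    Real.sqrt_mul_self_eq_abs]

variable [MeasurableSpace K] [BorelSpace K]

omit [BorelSpace K] in
theorem chartVolume_eq (g : (y : K) → TangentSpace (𝓡 k) y →L[ℝ] TangentSpace (𝓡 k) y →L[ℝ] ℝ)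
    (y : K) : chartVolume g y = Measure.map (extChartAt (𝓡 k) y).symm
      ((volume.restrict (extChartAt (𝓡 k) y).target).withDensity fun z ↦
        ENNReal.ofReal (chartDensity g y z)) := rfl

omit [IsManifold (𝓡 k) ∞ K] in
theorem aemeasurable_extChartAt_symm (y : K) : AEMeasurable (extChartAt (𝓡 k) y).symm
    (volume.restrict (extChartAt (𝓡 k) y).target) :=
  (continuousOn_extChartAt_symm y).aemeasurable (isOpen_extChartAt_target y).measurableSet

theorem chartVolume_apply (g : (y : K) → TangentSpace (𝓡 k) y →L[ℝ] TangentSpace (𝓡 k) y →L[ℝ] ℝ)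
    (y : K) {A : Set K} (hA : MeasurableSet A) :
    chartVolume g y A = ∫⁻ z in (extChartAt (𝓡 k) y).symm ⁻¹' A ∩ (extChartAt (𝓡 k) y).target,
      ENNReal.ofReal (chartDensity g y z) := by
  rw [chartVolume_eq, Measure.map_apply_of_aemeasurable ((aemeasurable_extChartAt_symm y).mono_ac
    (withDensity_absolutelyContinuous _ _)) hA, withDensity_apply',
    Measure.restrict_restrict' (isOpen_extChartAt_target y).measurableSet]

theorem chartVolume_inter_source
    (g : (y : K) → TangentSpace (𝓡 k) y →L[ℝ] TangentSpace (𝓡 k) y →L[ℝ] ℝ)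
    (y : K) {A : Set K} (hA : MeasurableSet A) :
    chartVolume g y (A ∩ (extChartAt (𝓡 k) y).source) = chartVolume g y A := by
  rw [chartVolume_apply _ _ hA,
    chartVolume_apply _ _ (hA.inter (isOpen_extChartAt_source y).measurableSet)]
  congr 2
  ext z
  simp only [Set.mem_inter_iff, Set.mem_preimage, and_congr_left_iff, and_iff_left_iff_imp]
  exact fun hz _ ↦ (extChartAt (𝓡 k) y).map_target hz

theorem chartVolume_eq_of_subset (g : PseudoRiemannianMetric (𝓡 k) K) {y y' : K} {A : Set K}
    (hA : MeasurableSet A) (h : A ⊆ (extChartAt (𝓡 k) y).source)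
    (h' : A ⊆ (extChartAt (𝓡 k) y').source) :
    chartVolume g.inner y A = chartVolume g.inner y' A := by
  rw [chartVolume_apply _ _ hA, chartVolume_apply _ _ hA]
  set S := (extChartAt (𝓡 k) y).symm ⁻¹' A ∩ (extChartAt (𝓡 k) y).target with hS
  set τ := extChartAt (𝓡 k) y' ∘ (extChartAt (𝓡 k) y).symm with hτ
  have hSA {z} (hz : z ∈ S) : ∃ q ∈ A, z = extChartAt (𝓡 k) y q ∧ τ z = extChartAt (𝓡 k) y' q :=
    ⟨_, hz.1, ((extChartAt (𝓡 k) y).right_inv hz.2).symm, rfl⟩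
  have himg : (extChartAt (𝓡 k) y').symm ⁻¹' A ∩ (extChartAt (𝓡 k) y').target = τ '' S := by
    ext z
    constructor
    · rintro ⟨hzA, hz⟩
      refine ⟨extChartAt (𝓡 k) y ((extChartAt (𝓡 k) y').symm z), ⟨?_, ?_⟩, ?_⟩
      · simp only [Set.mem_preimage]; rwa [(extChartAt (𝓡 k) y).left_inv (h hzA)]
      · exact (extChartAt (𝓡 k) y).map_source (h hzA)
      · simp only [τ, Function.comp_apply]
        rw [(extChartAt (𝓡 k) y).left_inv (h hzA), (extChartAt (𝓡 k) y').right_inv hz]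
    · rintro ⟨w, hw, rfl⟩
      obtain ⟨q, hqA, -, hq⟩ := hSA hw
      rw [hq]
      refine ⟨?_, (extChartAt (𝓡 k) y').map_source (h' hqA)⟩
      simp only [Set.mem_preimage]
      rwa [(extChartAt (𝓡 k) y').left_inv (h' hqA)]
  have hSm : MeasurableSet S := (continuousOn_extChartAt_symm y).measurableSet_inter_preimage
    (isOpen_extChartAt_target y).measurableSet hA
  have hinj : Set.InjOn τ S := by
    intro z hz w hw hzw
    obtain ⟨q, hqA, rfl, hq⟩ := hSA hz
    obtain ⟨r, hrA, rfl, hr⟩ := hSA hw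
    rw [hq, hr] at hzw
    rw [(extChartAt (𝓡 k) y').injOn (h' hqA) (h' hrA) hzw]
  have hder : ∀ z ∈ S, HasFDerivWithinAt τ (fderiv ℝ τ z) S z := by
    intro z hz
    obtain ⟨q, hqA, rfl, hq⟩ := hSA hz
    exact ((contDiffAt_transition (h hqA) (h' hqA)).differentiableAt
      (by simp)).hasFDerivAt.hasFDerivWithinAt
  rw [himg, lintegral_image_eq_lintegral_abs_det_fderiv_mul _ hSm hder hinj]
  refine setLIntegral_congr_fun hSm fun z hz ↦ ?_
  obtain ⟨q, hqA, rfl, hq⟩ := hSA hz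
  rw [hq, chartDensity_transition g (h hqA) (h' hqA), ENNReal.ofReal_mul (abs_nonneg _)]

/-- On the domain of a chart, the Riemannian volume is given by the density in this chart. -/
theorem riemannianVolume_restrict_source [SecondCountableTopology K]
    (g : PseudoRiemannianMetric (𝓡 k) K) (y : K) :
    (riemannianVolume g.inner).restrict (extChartAt (𝓡 k) y).source = chartVolume g.inner y := by
  let U (y : K) : Set K := (extChartAt (𝓡 k) y).source
  have hU (y : K) : MeasurableSet (U y) := (isOpen_extChartAt_source y).measurableSet
  obtain ⟨s, hs, hcov⟩ := TopologicalSpace.countable_cover_nhds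
    (f := U) (fun y ↦ extChartAt_source_mem_nhds (I := 𝓡 k) y)
  have hsne : s.Nonempty := by
    by_contra hne
    rw [Set.not_nonempty_iff_eq_empty] at hne
    have : y ∈ ⋃ x ∈ s, U x := hcov ▸ Set.mem_univ y
    simp [hne] at this
  obtain ⟨c, rfl⟩ := hs.exists_eq_range hsne
  let D : ℕ → Set K := disjointed fun n ↦ U (c n)
  have hD (n : ℕ) : MeasurableSet (D n) := MeasurableSet.disjointed (fun n ↦ hU (c n)) n
  have hDU : ⋃ n, D n = Set.univ := by
    rw [iUnion_disjointed, ← hcov, Set.biUnion_range]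
  let ν : Measure K := Measure.sum fun n ↦ (chartVolume g.inner (c n)).restrict (D n)
  have hν {y : K} {A : Set K} (hA : MeasurableSet A) (hAy : A ⊆ U y) :
      ν A = chartVolume g.inner y A := by
    have e (n : ℕ) : (chartVolume g.inner (c n)).restrict (D n) A =
        chartVolume g.inner y (A ∩ D n) := by
      rw [Measure.restrict_apply hA]
      exact chartVolume_eq_of_subset g (hA.inter (hD n))
        (Set.inter_subset_right.trans (disjointed_subset _ n)) (Set.inter_subset_left.trans hAy)
    rw [Measure.sum_apply _ hA]
    simp only [e]
    rw [← measure_iUnion (fun i j hij ↦ ((disjoint_disjointed (fun n ↦ U (c n)) hij).mono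
      Set.inter_subset_right Set.inter_subset_right)) fun n ↦ hA.inter (hD n), ← Set.inter_iUnion,
      hDU, Set.inter_univ]
  have hle : riemannianVolume g.inner ≤ ν := by
    refine iSup_le fun y ↦ Measure.le_iff.2 fun A hA ↦ ?_
    rw [← chartVolume_inter_source _ _ hA, ← hν (hA.inter (hU y)) Set.inter_subset_right]
    exact measure_mono Set.inter_subset_left
  have hge (y : K) : chartVolume g.inner y ≤ riemannianVolume g.inner :=
    le_iSup (chartVolume g.inner) y
  ext A hA
  rw [Measure.restrict_apply hA, ← chartVolume_inter_source _ _ hA]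
  refine le_antisymm ((hle _).trans_eq (hν (hA.inter (hU y)) Set.inter_subset_right)) (hge y _)

variable {F : Type*} [NormedAddCommGroup F] [NormedSpace ℝ F] [SecondCountableTopology K]
  {f : K → F} {y : K} (g : PseudoRiemannianMetric (𝓡 k) K)

omit [SecondCountableTopology K] [NormedSpace ℝ F] in
theorem aestronglyMeasurable_chartVolume [SecondCountableTopology F]
    (hf : ContinuousOn f (extChartAt (𝓡 k) y).source) :
    AEStronglyMeasurable f (chartVolume g.inner y) := by
  have h : (chartVolume g.inner y).restrict (extChartAt (𝓡 k) y).source =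
      chartVolume g.inner y := by
    ext A hA
    rw [Measure.restrict_apply hA, chartVolume_inter_source _ _ hA]
  rw [← h]
  exact hf.aestronglyMeasurable (isOpen_extChartAt_source y).measurableSet

/-- Integration of a function supported in a chart domain. -/
theorem integral_riemannianVolume_of_support [SecondCountableTopology F]
    (hf : ContinuousOn f (extChartAt (𝓡 k) y).source)
    (h0 : ∀ q ∉ (extChartAt (𝓡 k) y).source, f q = 0) :
    ∫ q, f q ∂(riemannianVolume g.inner) = ∫ z in (extChartAt (𝓡 k) y).target,
      chartDensity g.inner y z • f ((extChartAt (𝓡 k) y).symm z) := by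
  have hm := aestronglyMeasurable_chartVolume g hf
  rw [← setIntegral_eq_integral_of_forall_compl_eq_zero h0, riemannianVolume_restrict_source]
  rw [chartVolume_eq] at hm ⊢
  rw [integral_map ((aemeasurable_extChartAt_symm y).mono_ac
    (withDensity_absolutelyContinuous _ _)) hm, integral_withDensity_eq_integral_toReal_smul₀]
  · simp only [ENNReal.toReal_ofReal (chartDensity_nonneg _ _ _)]
  · exact ((continuousOn_chartDensity g y).aemeasurable
      (isOpen_extChartAt_target y).measurableSet).ennreal_ofReal
  · exact Filter.Eventually.of_forall fun _ ↦ ENNReal.ofReal_lt_top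

theorem integrable_riemannianVolume_of_support [SecondCountableTopology F] {Q : Set K}
    (hf : ContinuousOn f (extChartAt (𝓡 k) y).source) (hQ : IsCompact Q)
    (hQs : Q ⊆ (extChartAt (𝓡 k) y).source) (h0 : ∀ q ∉ Q, f q = 0) :
    Integrable f (riemannianVolume g.inner) := by
  have hm := aestronglyMeasurable_chartVolume g hf
  have h1 : IntegrableOn f (extChartAt (𝓡 k) y).source (riemannianVolume g.inner) := by
    rw [IntegrableOn, riemannianVolume_restrict_source]
    rw [chartVolume_eq] at hm ⊢
    rw [integrable_map_measure hm ((aemeasurable_extChartAt_symm y).mono_ac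
      (withDensity_absolutelyContinuous _ _)), integrable_withDensity_iff_integrable_smul₀']
    · simp only [ENNReal.toReal_ofReal (chartDensity_nonneg _ _ _), Function.comp_apply]
      have hc : ContinuousOn (fun z ↦ chartDensity g.inner y z • f ((extChartAt (𝓡 k) y).symm z))
          (extChartAt (𝓡 k) y).target :=
        (continuousOn_chartDensity g y).smul
          (hf.comp (continuousOn_extChartAt_symm y) (extChartAt (𝓡 k) y).symm.mapsTo)
      have hQ' : IsCompact (extChartAt (𝓡 k) y '' Q) :=
        hQ.image_of_continuousOn ((continuousOn_extChartAt y).mono hQs)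
      have hQt : extChartAt (𝓡 k) y '' Q ⊆ (extChartAt (𝓡 k) y).target := by
        rintro _ ⟨q, hq, rfl⟩
        exact (extChartAt (𝓡 k) y).map_source (hQs hq)
      have h3 := (hc.mono hQt).integrableOn_compact (μ := volume) hQ'
      refine h3.of_forall_sdiff_eq_zero (isOpen_extChartAt_target y).measurableSet ?_
      rintro z ⟨hz, hzQ⟩
      rw [h0, smul_zero]
      exact fun hq ↦ hzQ ⟨_, hq, (extChartAt (𝓡 k) y).right_inv hz⟩
    · exact ((continuousOn_chartDensity g y).aemeasurable
        (isOpen_extChartAt_target y).measurableSet).ennreal_ofReal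
    · exact Filter.Eventually.of_forall fun _ ↦ ENNReal.ofReal_lt_top
  exact h1.integrable_of_forall_notMem_eq_zero fun q hq ↦ h0 q fun h ↦ hq (hQs h)

end Volume

/-! ### Integrals depending on a parameter -/

section Parametric

variable {X Z F : Type*} [NormedAddCommGroup X] [NormedSpace ℝ X]
  [NormedAddCommGroup Z] [NormedSpace ℝ Z] [FiniteDimensional ℝ Z] [MeasureSpace Z] [BorelSpace Z]
  [(volume : Measure Z).IsAddHaarMeasure]
  [NormedAddCommGroup F] [NormedSpace ℝ F]
  {a : X × Z → F} {V : Set X} {Q : Set Z}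

theorem convolution_one_eq (f : Z → F) :
    convolution (fun _ : Z ↦ (1 : ℝ)) f (ContinuousLinearMap.lsmul ℝ ℝ) volume 0 = ∫ z, f z := by
  rw [convolution_def]
  simp only [ContinuousLinearMap.lsmul_apply, one_smul, zero_sub]
  exact integral_neg_eq_self f volume

theorem contDiffOn_integral_of_compact_support (hV : IsOpen V) (hQ : IsCompact Q)
    (ha0 : ∀ ξ ∈ V, ∀ z ∉ Q, a (ξ, z) = 0) (ha : ContDiffOn ℝ ∞ a (V ×ˢ Set.univ)) :
    ContDiffOn ℝ ∞ (fun ξ ↦ ∫ z, a (ξ, z)) V := by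
  have h := contDiffOn_convolution_right_with_param_comp (n := ⊤) (μ := (volume : Measure Z))
    (ContinuousLinearMap.lsmul ℝ ℝ)
    (f := fun _ : Z ↦ (1 : ℝ)) (v := fun _ : X ↦ (0 : Z)) contDiffOn_const hV hQ
    (g := fun ξ z ↦ a (ξ, z)) (fun ξ z hξ hz ↦ ha0 ξ hξ z hz) (locallyIntegrable_const _) ha
  exact h.congr fun ξ _ ↦ (convolution_one_eq _).symm

omit [FiniteDimensional ℝ Z] [MeasureSpace Z] [BorelSpace Z]
  [(volume : Measure Z).IsAddHaarMeasure] in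
theorem fderiv_eq_zero_of_compact_support (hV : IsOpen V) (hQ : IsCompact Q)
    (ha0 : ∀ ξ ∈ V, ∀ z ∉ Q, a (ξ, z) = 0) {ξ : X} (hξ : ξ ∈ V) {z : Z} (hz : z ∉ Q) :
    fderiv ℝ a (ξ, z) = 0 := by
  refine (hasFDerivAt_zero_of_eventually_const 0 ?_).fderiv
  filter_upwards [(hV.prod hQ.isClosed.isOpen_compl).mem_nhds ⟨hξ, hz⟩]
  rintro ⟨ξ', z'⟩ h
  exact ha0 ξ' h.1 z' h.2

omit [FiniteDimensional ℝ Z] [MeasureSpace Z] [BorelSpace Z]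
  [(volume : Measure Z).IsAddHaarMeasure] in
theorem continuous_fderiv_slice (hV : IsOpen V) (ha : ContDiffOn ℝ ∞ a (V ×ˢ Set.univ))
    {ξ : X} (hξ : ξ ∈ V) : Continuous fun z : Z ↦ fderiv ℝ a (ξ, z) := by
  have h := ha.continuousOn_fderiv_of_isOpen (hV.prod isOpen_univ) (by simp)
  exact h.comp_continuous (by fun_prop) fun z ↦ ⟨hξ, trivial⟩

omit [NormedSpace ℝ Z] [FiniteDimensional ℝ Z] [NormedSpace ℝ F] in
theorem integrable_of_continuous_of_support {f : Z → F} (hf : Continuous f) (hQ : IsCompact Q)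
    (h0 : ∀ z ∉ Q, f z = 0) : Integrable f :=
  hf.integrable_of_hasCompactSupport (HasCompactSupport.intro hQ h0)

theorem hasFDerivAt_integral_of_compact_support [CompleteSpace F] (hV : IsOpen V) (hQ : IsCompact Q)
    (ha0 : ∀ ξ ∈ V, ∀ z ∉ Q, a (ξ, z) = 0) (ha : ContDiffOn ℝ ∞ a (V ×ˢ Set.univ))
    {ξ : X} (hξ : ξ ∈ V) :
    HasFDerivAt (fun ξ ↦ ∫ z, a (ξ, z))
      (∫ z, (fderiv ℝ a (ξ, z)).comp (ContinuousLinearMap.inl ℝ X Z)) ξ := by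
  have h := hasFDerivAt_convolution_right_with_param (μ := (volume : Measure Z))
    (ContinuousLinearMap.lsmul ℝ ℝ)
    (f := fun _ : Z ↦ (1 : ℝ)) hV hQ
    (g := fun ξ z ↦ a (ξ, z)) (fun ξ z hξ hz ↦ ha0 ξ hξ z hz) (locallyIntegrable_const _)
    (ha.of_le (by simp)) (ξ, 0) hξ
  have h2 : HasFDerivAt (fun ξ : X ↦ (ξ, (0 : Z))) (ContinuousLinearMap.inl ℝ X Z) ξ :=
    (ContinuousLinearMap.inl ℝ X Z).hasFDerivAt
  have h3 := HasFDerivAt.comp ξ (g := fun q : X × Z ↦ convolution (fun _ : Z ↦ (1 : ℝ))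
    (fun z ↦ a (q.1, z)) (ContinuousLinearMap.lsmul ℝ ℝ) volume q.2) h h2
  have e1 : (fun ξ ↦ ∫ z, a (ξ, z)) = (fun q : X × Z ↦ convolution (fun _ : Z ↦ (1 : ℝ))
      (fun z ↦ a (q.1, z)) (ContinuousLinearMap.lsmul ℝ ℝ) volume q.2) ∘
        fun ξ : X ↦ (ξ, (0 : Z)) := by
    ext ξ; exact (convolution_one_eq _).symm
  rw [e1]
  refine h3.congr_fderiv ?_
  have hint : Integrable fun z : Z ↦ fderiv ℝ a (ξ, z) :=
    integrable_of_continuous_of_support (continuous_fderiv_slice hV ha hξ) hQ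
      fun z hz ↦ fderiv_eq_zero_of_compact_support hV hQ ha0 hξ hz
  have e2 : convolution (fun _ : Z ↦ (1 : ℝ)) (fun z ↦ fderiv ℝ a (ξ, z))
      ((ContinuousLinearMap.lsmul ℝ ℝ).precompR (X × Z)) volume 0 = ∫ z, fderiv ℝ a (ξ, z) := by
    rw [convolution_def]
    simp only [zero_sub]
    rw [← integral_neg_eq_self (fun z ↦ fderiv ℝ a (ξ, z)) volume]
    congr 1
    refine funext fun z ↦ ContinuousLinearMap.ext fun v ↦ ?_
    rw [ContinuousLinearMap.precompR_apply]
    simp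
  refine (congrArg (fun T : X × Z →L[ℝ] F ↦ T.comp (ContinuousLinearMap.inl ℝ X Z)) e2).trans ?_
  exact (((ContinuousLinearMap.compL ℝ X (X × Z) F).flip
    (ContinuousLinearMap.inl ℝ X Z)).integral_comp_comm hint).symm

theorem integral_fderiv_eq_zero {f : Z → ℝ} (hf : ContDiff ℝ 1 f) (hQ : IsCompact Q)
    (h0 : ∀ z ∉ Q, f z = 0) (v : Z) : ∫ z, fderiv ℝ f z v = 0 := by
  have hs : HasCompactSupport f := HasCompactSupport.intro hQ h0
  have hc : Continuous fun z ↦ fderiv ℝ f z v := (hf.continuous_fderiv (by simp)).clm_apply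
    continuous_const
  have h := integral_mul_fderiv_eq_neg_fderiv_mul_of_integrable (μ := (volume : Measure Z))
    (f := fun _ ↦ (1 : ℝ)) (g := f) (v := v) (by simp)
    (by simpa using hc.integrable_of_hasCompactSupport (hs.fderiv_apply (𝕜 := ℝ) v))
    (by simpa using hf.continuous.integrable_of_hasCompactSupport hs)
    (fun _ _ ↦ differentiableAt_const _) (fun z _ ↦ hf.differentiable (by simp) z)
  simpa using h

/-- The divergence theorem for compactly supported vector fields. -/
theorem integral_trace_fderiv_eq_zero {f : Z → Z} (hf : ContDiff ℝ 1 f) (hQ : IsCompact Q)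
    (h0 : ∀ z ∉ Q, f z = 0) : ∫ z, LinearMap.trace ℝ Z (fderiv ℝ f z).toLinearMap = 0 := by
  let b := Module.finBasis ℝ Z
  let c (i : Fin (Module.finrank ℝ Z)) : Z →L[ℝ] ℝ := LinearMap.toContinuousLinearMap (b.coord i)
  have e (z : Z) : LinearMap.trace ℝ Z (fderiv ℝ f z).toLinearMap =
      ∑ i, fderiv ℝ (fun z ↦ c i (f z)) z (b i) := by
    rw [LinearMap.trace_eq_matrix_trace ℝ b, Matrix.trace]
    refine Finset.sum_congr rfl fun i _ ↦ ?_
    have := ((c i).hasFDerivAt.comp z (hf.differentiable (by simp) z).hasFDerivAt).fderiv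
    change fderiv ℝ (fun z ↦ c i (f z)) z = _ at this
    rw [this, Matrix.diag_apply, LinearMap.toMatrix_apply]
    rfl
  have hci (i) : ContDiff ℝ 1 fun z ↦ c i (f z) := (c i).contDiff.comp hf
  have h0i (i) : ∀ z ∉ Q, c i (f z) = 0 := fun z hz ↦ by rw [h0 z hz, map_zero]
  simp only [e]
  rw [integral_finsetSum _ fun i _ ↦ ?_]
  · exact Finset.sum_eq_zero fun i _ ↦ integral_fderiv_eq_zero (hci i) hQ (h0i i) _
  · exact (((hci i).continuous_fderiv (by simp)).clm_apply
      continuous_const).integrable_of_hasCompactSupport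
        ((HasCompactSupport.intro hQ (h0i i)).fderiv_apply (𝕜 := ℝ) _)

end Parametric

theorem LinearMap.trace_prod_eq {V W : Type*} [AddCommGroup V] [Module ℝ V] [AddCommGroup W]
    [Module ℝ W] [FiniteDimensional ℝ V] [FiniteDimensional ℝ W] (L : V × W →ₗ[ℝ] V × W) :
    LinearMap.trace ℝ (V × W) L =
      LinearMap.trace ℝ V (LinearMap.fst ℝ V W ∘ₗ L ∘ₗ LinearMap.inl ℝ V W) +
      LinearMap.trace ℝ W (LinearMap.snd ℝ V W ∘ₗ L ∘ₗ LinearMap.inr ℝ V W) := by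
  let b := Module.finBasis ℝ V
  let b' := Module.finBasis ℝ W
  rw [LinearMap.trace_eq_matrix_trace ℝ (b.prod b'), LinearMap.trace_eq_matrix_trace ℝ b,
    LinearMap.trace_eq_matrix_trace ℝ b', Matrix.trace, Fintype.sum_sum_type]
  congr 1
  · refine Finset.sum_congr rfl fun i _ ↦ ?_
    simp [LinearMap.toMatrix_apply]
  · refine Finset.sum_congr rfl fun i _ ↦ ?_
    simp [LinearMap.toMatrix_apply]

theorem HasFDerivAt.sqrt_abs {E : Type*} [NormedAddCommGroup E] [NormedSpace ℝ E] {δ : E → ℝ}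
    {D : E →L[ℝ] ℝ} {z : E} (h : HasFDerivAt δ D z) (h0 : δ z ≠ 0) :
    HasFDerivAt (fun y ↦ √|δ y|) ((√|δ z| / (2 * δ z)) • D) z := by
  have h1 := (Real.hasDerivAt_sqrt (abs_ne_zero.2 h0)).comp (δ z) (hasDerivAt_abs h0)
  refine (h1.comp_hasFDerivAt z h).congr_fderiv ?_
  congr 1
  rcases lt_or_gt_of_ne h0 with hn | hp
  · rw [_root_.abs_of_neg hn]
    have := Real.mul_self_sqrt (neg_pos.2 hn).le
    have h2 : √(-δ z) ≠ 0 := (Real.sqrt_pos.2 (neg_pos.2 hn)).ne'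
    simp only [sign_neg hn, SignType.coe_neg_one]
    field_simp
    nlinarith
  · rw [_root_.abs_of_pos hp]
    have := Real.mul_self_sqrt hp.le
    have h2 : √(δ z) ≠ 0 := (Real.sqrt_pos.2 hp).ne'
    simp only [sign_pos hp, SignType.coe_one]
    field_simp
    nlinarith

theorem ContDiffAt.sqrt_abs {E : Type*} [NormedAddCommGroup E] [NormedSpace ℝ E] {δ : E → ℝ}
    {z : E} (h : ContDiffAt ℝ ∞ δ z) (h0 : δ z ≠ 0) : ContDiffAt ℝ ∞ (fun y ↦ √|δ y|) z :=
  ((contDiffAt_abs h0).comp z h).sqrt (abs_ne_zero.2 h0)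

/-! ### Submersive metrics in product charts -/

section ProductCharts

variable {m k : ℕ}
  {M : Type*} [TopologicalSpace M] [ChartedSpace (EuclideanSpace ℝ (Fin m)) M]
  [IsManifold (𝓡 m) ∞ M]
  {K : Type*} [TopologicalSpace K] [ChartedSpace (EuclideanSpace ℝ (Fin k)) K]
  [IsManifold (𝓡 k) ∞ K]

omit [IsManifold (𝓡 m) ∞ M] [IsManifold (𝓡 k) ∞ K] in
theorem mem_extChartAt_source_prod {x₀ x : M} {i y : K} (hx : x ∈ (extChartAt (𝓡 m) x₀).source)
    (hy : y ∈ (extChartAt (𝓡 k) i).source) :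
    (x, y) ∈ (extChartAt ((𝓡 m).prod (𝓡 k)) (x₀, i)).source := by
  rw [extChartAt_prod]; exact ⟨hx, hy⟩

omit [IsManifold (𝓡 m) ∞ M] [IsManifold (𝓡 k) ∞ K] in
theorem extChartAt_prod_mk (x₀ x : M) (i y : K) :
    extChartAt ((𝓡 m).prod (𝓡 k)) (x₀, i) (x, y) =
      (extChartAt (𝓡 m) x₀ x, extChartAt (𝓡 k) i y) := by
  rw [extChartAt_prod]; rfl

theorem chartCoord_prod {x₀ x : M} {i y : K} (hx : x ∈ (extChartAt (𝓡 m) x₀).source)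
    (hy : y ∈ (extChartAt (𝓡 k) i).source)
    (u : EuclideanSpace ℝ (Fin m)) (v : EuclideanSpace ℝ (Fin k)) :
    chartCoord ((𝓡 m).prod (𝓡 k)) (x₀, i) (x, y)
      ((u, v) : EuclideanSpace ℝ (Fin m) × EuclideanSpace ℝ (Fin k)) =
      (chartCoord (𝓡 m) x₀ x u, chartCoord (𝓡 k) i y v) := by
  have hxx := mem_extChartAt_source (I := 𝓡 m) x
  have hyy := mem_extChartAt_source (I := 𝓡 k) y
  refine (chartCoord_eq_tangentCoordChange (mem_extChartAt_source_prod hx hy) (u, v)).trans ?_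
  rw [chartCoord_eq_tangentCoordChange hx, chartCoord_eq_tangentCoordChange hy,
    tangentCoordChange_def, tangentCoordChange_def, tangentCoordChange_def,
    ModelWithCorners.range_eq_univ, ModelWithCorners.range_eq_univ,
    ModelWithCorners.range_eq_univ, fderivWithin_univ, fderivWithin_univ, fderivWithin_univ,
    extChartAt_prod_mk]
  have h1 := (contDiffAt_transition hxx hx).differentiableAt (by simp)
  have h2 := (contDiffAt_transition hyy hy).differentiableAt (by simp)
  have h3 := h1.hasFDerivAt.prodMap (extChartAt (𝓡 m) x x, extChartAt (𝓡 k) y y) h2.hasFDerivAt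
  have e : (extChartAt ((𝓡 m).prod (𝓡 k)) (x₀, i) ∘ (extChartAt ((𝓡 m).prod (𝓡 k)) (x, y)).symm) =
      Prod.map (extChartAt (𝓡 m) x₀ ∘ (extChartAt (𝓡 m) x).symm)
        (extChartAt (𝓡 k) i ∘ (extChartAt (𝓡 k) y).symm) := by
    rw [extChartAt_prod, extChartAt_prod]; rfl
  rw [e, h3.fderiv]
  rfl

theorem chartLift_prod {x₀ x : M} {i y : K} (hx : x ∈ (extChartAt (𝓡 m) x₀).source)
    (hy : y ∈ (extChartAt (𝓡 k) i).source)
    (u : EuclideanSpace ℝ (Fin m)) (v : EuclideanSpace ℝ (Fin k)) :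
    chartLift ((𝓡 m).prod (𝓡 k)) (x₀, i) (x, y) (u, v) =
      ((chartLift (𝓡 m) x₀ x u, chartLift (𝓡 k) i y v) :
        TangentSpace (𝓡 m) x × TangentSpace (𝓡 k) y) := by
  have h := chartCoord_prod hx hy (chartLift (𝓡 m) x₀ x u) (chartLift (𝓡 k) i y v)
  rw [chartCoord_chartLift hx, chartCoord_chartLift hy] at h
  rw [← h]
  exact chartLift_chartCoord (mem_extChartAt_source_prod hx hy) _

namespace SubmersiveMetric

variable (G : SubmersiveMetric m k M K)

/-- The metric on the fibre over `x`. -/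
def fibreMetric (x : M) : PseudoRiemannianMetric (𝓡 k) K where
  inner := (G.gK x).inner
  symm := (G.gK x).symm
  nondegenerate y v hv := by
    by_contra h
    exact ((G.gK x).pos y v h).ne' (hv v)
  contMDiff := (G.gK x).contMDiff

theorem det_gramMatrix_prod {V W ι κ : Type*} [NormedAddCommGroup V] [NormedSpace ℝ V]
    [NormedAddCommGroup W] [NormedSpace ℝ W] [Fintype ι] [DecidableEq ι] [Fintype κ]
    [DecidableEq κ] (b : Module.Basis ι ℝ V) (b' : Module.Basis κ ℝ W)
    (B : V →L[ℝ] V →L[ℝ] ℝ) (C : W →L[ℝ] W →L[ℝ] ℝ) (A : V →L[ℝ] W)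
    (P : V × W →L[ℝ] V × W →L[ℝ] ℝ)
    (hP : ∀ u v : V × W, P u v = B u.1 v.1 + C (u.2 - A u.1) (v.2 - A v.1)) :
    (gramMatrix P (b.prod b')).det = (gramMatrix B b).det * (gramMatrix C b').det := by
  let T : V × W →L[ℝ] V × W := (ContinuousLinearMap.fst ℝ V W).prod
    (ContinuousLinearMap.snd ℝ V W - A.comp (ContinuousLinearMap.fst ℝ V W))
  let P₀ : V × W →L[ℝ] V × W →L[ℝ] ℝ :=
    pullbackForm B (ContinuousLinearMap.fst ℝ V W) + pullbackForm C (ContinuousLinearMap.snd ℝ V W)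
  have hPT : P = pullbackForm P₀ T := by
    refine ContinuousLinearMap.ext fun u ↦ ContinuousLinearMap.ext fun v ↦ ?_
    rw [hP]; rfl
  have hG : gramMatrix P₀ (b.prod b') = Matrix.fromBlocks (gramMatrix B b) 0 0 (gramMatrix C b') := by
    ext i j
    change B (b.prod b' i).1 (b.prod b' j).1 + C (b.prod b' i).2 (b.prod b' j).2 = _
    rcases i with i | i <;> rcases j with j | j <;> simp [gramMatrix]
  have hT : LinearMap.toMatrix (b.prod b') (b.prod b') T.toLinearMap =
      Matrix.fromBlocks 1 0 (-LinearMap.toMatrix b b' A.toLinearMap) 1 := by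
    ext i j
    rw [LinearMap.toMatrix_apply]
    rcases i with i | i <;> rcases j with j | j <;>
      simp [T, LinearMap.toMatrix_apply, Matrix.one_apply, Finsupp.single_apply, eq_comm]
  rw [hPT, gramMatrix_pullbackForm _ (b.prod b') (b.prod b'), Matrix.det_mul, Matrix.det_mul,
    Matrix.det_transpose, hG, hT, Matrix.det_fromBlocks_zero₁₂, Matrix.det_fromBlocks_zero₁₂]
  simp

/-- In a product chart the Gram determinant of `g_P` is the product of those of `g_M` and `g_K`. -/
theorem det_gramMatrix_chartForm {x₀ : M} {i : K} {ι κ : Type*} [Fintype ι] [DecidableEq ι]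
    [Fintype κ] [DecidableEq κ] (b : Module.Basis ι ℝ (EuclideanSpace ℝ (Fin m)))
    (b' : Module.Basis κ ℝ (EuclideanSpace ℝ (Fin k)))
    {x : M} {y : K} (hx : x ∈ (extChartAt (𝓡 m) x₀).source)
    (hy : y ∈ (extChartAt (𝓡 k) i).source) :
    (gramMatrix (chartForm (x₀, i) G.gP.inner (extChartAt (𝓡 m) x₀ x, extChartAt (𝓡 k) i y))
      (b.prod b')).det =
    (gramMatrix (chartForm x₀ G.gM.inner (extChartAt (𝓡 m) x₀ x)) b).det *
      (gramMatrix (chartForm i (G.fibreMetric x).inner (extChartAt (𝓡 k) i y)) b').det := by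
  let A : EuclideanSpace ℝ (Fin m) →L[ℝ] EuclideanSpace ℝ (Fin k) :=
    (chartCoord (𝓡 k) i y).comp ((G.A (x, y)).comp (chartLift (𝓡 m) x₀ x))
  refine det_gramMatrix_prod b b' _ _ A _ ?_
  rintro ⟨u₁, u₂⟩ ⟨v₁, v₂⟩
  rw [← extChartAt_prod_mk, chartForm_extChartAt _ (mem_extChartAt_source_prod hx hy),
    chartLift_prod hx hy, chartLift_prod hx hy, chartForm_extChartAt _ hx,
    chartForm_extChartAt _ hy]
  have hA (v : EuclideanSpace ℝ (Fin k)) (u : EuclideanSpace ℝ (Fin m)) :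
      chartLift (𝓡 k) i y (v - A u) =
        chartLift (𝓡 k) i y v - G.A (x, y) (chartLift (𝓡 m) x₀ x u) := by
    rw [map_sub]
    exact congrArg _ (chartLift_chartCoord hy _)
  rw [hA, hA]
  rfl

end SubmersiveMetric
end ProductCharts

/-! ### Fibre integration of the divergence in coordinates -/

section CoordinateFibreIntegral

/-- The contraction with a fixed metric as a linear form. -/
def metricTraceLinear {E : Type*} [NormedAddCommGroup E] [NormedSpace ℝ E] [FiniteDimensional ℝ E]
    (B : E →L[ℝ] E →L[ℝ] ℝ) : (E →L[ℝ] E →L[ℝ] ℝ) →ₗ[ℝ] ℝ where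
  toFun := metricTrace B
  map_add' C D := by
    simp only [metricTrace, add_apply, mul_add, Finset.sum_add_distrib]
  map_smul' c C := by
    simp only [metricTrace, smul_apply, smul_eq_mul, RingHom.id_apply, Finset.mul_sum,
      mul_left_comm]

theorem contDiffAt_det_gramMatrix {E F : Type*} [NormedAddCommGroup E] [NormedSpace ℝ E]
    [NormedAddCommGroup F] [NormedSpace ℝ F] {g : F → E →L[ℝ] E →L[ℝ] ℝ} {z : F}
    (hg : ContDiffAt ℝ ∞ g z) {ι : Type*} [Fintype ι] [DecidableEq ι] (b : Module.Basis ι ℝ E) :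
    ContDiffAt ℝ ∞ (fun y ↦ (gramMatrix (g y) b).det) z := by
  simp only [Matrix.det_apply]
  refine ContDiffAt.sum fun σ _ ↦ (contDiffAt_prod fun i _ ↦ ?_).const_smul _
  exact (hg.clm_apply contDiffAt_const).clm_apply contDiffAt_const

variable {X Z : Type*} [NormedAddCommGroup X] [NormedSpace ℝ X] [FiniteDimensional ℝ X]
  [NormedAddCommGroup Z] [NormedSpace ℝ Z] [FiniteDimensional ℝ Z]
  {ι κ : Type*} [Fintype ι] [DecidableEq ι] [Fintype κ] [DecidableEq κ]

/-- Coordinate data of a submersive metric `gP` over `gM` on `V × R` with fibre density `dens`, and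
of a vector field `w` whose support is contained in `V × Q`. -/
structure FibreDensity (b : Module.Basis ι ℝ X) (b' : Module.Basis κ ℝ Z)
    (V : Set X) (R Q : Set Z) (gP : X × Z → X × Z →L[ℝ] X × Z →L[ℝ] ℝ)
    (gM : X → X →L[ℝ] X →L[ℝ] ℝ) (dens : X × Z → ℝ) (w : X × Z → X × Z) : Prop where
  isOpen_base : IsOpen V
  isOpen_fibre : IsOpen R
  isCompact_support : IsCompact Q
  support_subset : Q ⊆ R
  contDiffOn_gP : ContDiffOn ℝ ∞ gP (V ×ˢ R)
  contDiffOn_gM : ContDiffOn ℝ ∞ gM V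
  metric_gP : ∀ p ∈ V ×ˢ R, IsMetricForm (gP p)
  metric_gM : ∀ ξ ∈ V, IsMetricForm (gM ξ)
  density : ∀ p ∈ V ×ˢ R,
    √|(gramMatrix (gP p) (b.prod b')).det| = √|(gramMatrix (gM p.1) b).det| * dens p
  contDiffOn_field : ContDiffOn ℝ ∞ w (V ×ˢ R)
  eq_zero : ∀ ξ ∈ V, ∀ z ∈ R, z ∉ Q → w (ξ, z) = 0

namespace FibreDensity

variable {b : Module.Basis ι ℝ X} {b' : Module.Basis κ ℝ Z}
  {V : Set X} {R Q : Set Z} {gP : X × Z → X × Z →L[ℝ] X × Z →L[ℝ] ℝ}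
  {gM : X → X →L[ℝ] X →L[ℝ] ℝ} {dens : X × Z → ℝ} {w : X × Z → X × Z}

omit [FiniteDimensional ℝ X] [FiniteDimensional ℝ Z] in
theorem isOpen_prod (h : FibreDensity b b' V R Q gP gM dens w) : IsOpen (V ×ˢ R) :=
  h.isOpen_base.prod h.isOpen_fibre

omit [FiniteDimensional ℝ X] [FiniteDimensional ℝ Z] in
theorem contDiffAt_density (h : FibreDensity b b' V R Q gP gM dens w) {p : X × Z}
    (hp : p ∈ V ×ˢ R) : ContDiffAt ℝ ∞ dens p := by
  have hPs := h.contDiffOn_gP.contDiffAt (h.isOpen_prod.mem_nhds hp)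
  have hMs := h.contDiffOn_gM.contDiffAt (h.isOpen_base.mem_nhds hp.1)
  have hP0 := (h.metric_gP p hp).det_gramMatrix_ne_zero (b.prod b')
  have hM0 := (h.metric_gM p.1 hp.1).det_gramMatrix_ne_zero b
  have hsP := (contDiffAt_det_gramMatrix hPs (b.prod b')).sqrt_abs hP0
  have hsM := ((contDiffAt_det_gramMatrix hMs b).sqrt_abs hM0).comp p contDiffAt_fst
  refine (hsP.div hsM (Real.sqrt_pos.2 (abs_pos.2 hM0)).ne').congr_of_eventuallyEq ?_
  filter_upwards [h.isOpen_prod.mem_nhds hp] with p' hp'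
  have h0 : √|(gramMatrix (gM p'.1) b).det| ≠ 0 := (Real.sqrt_pos.2 (abs_pos.2
    ((h.metric_gM p'.1 hp'.1).det_gramMatrix_ne_zero b))).ne'
  rw [Pi.div_apply, h.density p' hp']
  exact (mul_div_cancel_left₀ _ h0).symm

/-- The logarithmic derivative of the density is the difference of the contractions of the two
metrics. -/
theorem fderiv_density (h : FibreDensity b b' V R Q gP gM dens w) {p : X × Z}
    (hp : p ∈ V ×ˢ R) (v : X × Z) : fderiv ℝ dens p v = (1 / 2 : ℝ) * dens p *
      (metricTrace (gP p) (fderiv ℝ gP p v) - metricTrace (gM p.1) (fderiv ℝ gM p.1 v.1)) := by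
  have hPs := h.contDiffOn_gP.contDiffAt (h.isOpen_prod.mem_nhds hp)
  have hMs := h.contDiffOn_gM.contDiffAt (h.isOpen_base.mem_nhds hp.1)
  have hP0 := (h.metric_gP p hp).det_gramMatrix_ne_zero (b.prod b')
  have hM0 := (h.metric_gM p.1 hp.1).det_gramMatrix_ne_zero b
  obtain ⟨DP, hDP, hDP'⟩ := hasFDerivAt_det_gramMatrix (hPs.differentiableAt (by simp))
    (h.metric_gP p hp) (b.prod b')
  obtain ⟨DM, hDM, hDM'⟩ := hasFDerivAt_det_gramMatrix (hMs.differentiableAt (by simp))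
    (h.metric_gM p.1 hp.1) b
  have hsP := hDP.sqrt_abs hP0
  have hsM := (hDM.sqrt_abs hM0).comp p (hasFDerivAt_fst (𝕜 := ℝ) (E := X) (F := Z) (p := p))
  have hprod := hsM.mul ((h.contDiffAt_density hp).differentiableAt (by simp)).hasFDerivAt
  have hev : (fun p' ↦ √|(gramMatrix (gP p') (b.prod b')).det|) =ᶠ[nhds p]
      fun p' ↦ ((fun ξ ↦ √|(gramMatrix (gM ξ) b).det|) ∘ Prod.fst) p' * dens p' := by
    filter_upwards [h.isOpen_prod.mem_nhds hp] with p' hp'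
    exact h.density p' hp'
  have key := DFunLike.congr_fun (hsP.unique (hprod.congr_of_eventuallyEq hev)) v
  have hsP1 := h.density p hp
  have hsM0 : 0 < √|(gramMatrix (gM p.1) b).det| := Real.sqrt_pos.2 (abs_pos.2 hM0)
  simp only [add_apply, smul_apply, smul_eq_mul, ContinuousLinearMap.comp_apply, hDP', hDM',
    Function.comp_apply, ContinuousLinearMap.coe_fst'] at key
  rw [hsP1] at key
  have e1 : √|(gramMatrix (gM p.1) b).det| * fderiv ℝ dens p v =
      √|(gramMatrix (gM p.1) b).det| * ((1 / 2 : ℝ) * dens p *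
      (metricTrace (gP p) (fderiv ℝ gP p v) - metricTrace (gM p.1) (fderiv ℝ gM p.1 v.1))) := by
    have e2 (s d t : ℝ) (hd : d ≠ 0) : s / (2 * d) * (d * t) = s * t / 2 := by field_simp
    rw [e2 _ _ _ hP0, e2 _ _ _ hM0] at key
    linarith
  exact mul_left_cancel₀ hsM0.ne' e1

open Classical in
/-- The field `dens • w`, extended by zero. -/
def weighted (R : Set Z) (dens : X × Z → ℝ) (w : X × Z → X × Z) (p : X × Z) : X × Z :=
  if p.2 ∈ R then dens p • w p else 0

omit [FiniteDimensional ℝ X] [FiniteDimensional ℝ Z] in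
theorem weighted_eq_zero (h : FibreDensity b b' V R Q gP gM dens w) :
    ∀ ξ ∈ V, ∀ z ∉ Q, weighted R dens w (ξ, z) = 0 := by
  intro ξ hξ z hz
  rw [weighted]
  split_ifs with hR
  · rw [h.eq_zero ξ hξ z hR hz, smul_zero]
  · rfl

omit [FiniteDimensional ℝ X] [FiniteDimensional ℝ Z] in
theorem weighted_eventuallyEq (h : FibreDensity b b' V R Q gP gM dens w) {p : X × Z}
    (hp : p ∈ V ×ˢ R) : weighted R dens w =ᶠ[nhds p] fun p ↦ dens p • w p := by
  filter_upwards [h.isOpen_prod.mem_nhds hp] with p' hp'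
  exact if_pos hp'.2

omit [FiniteDimensional ℝ X] [FiniteDimensional ℝ Z] in
theorem contDiffAt_field (h : FibreDensity b b' V R Q gP gM dens w) {p : X × Z}
    (hp : p ∈ V ×ˢ R) : ContDiffAt ℝ ∞ w p :=
  h.contDiffOn_field.contDiffAt (h.isOpen_prod.mem_nhds hp)

omit [FiniteDimensional ℝ X] [FiniteDimensional ℝ Z] in
theorem contDiffOn_weighted (h : FibreDensity b b' V R Q gP gM dens w) :
    ContDiffOn ℝ ∞ (weighted R dens w) (V ×ˢ Set.univ) := by
  rintro ⟨ξ, z⟩ ⟨hξ, -⟩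
  refine ContDiffAt.contDiffWithinAt ?_
  by_cases hz : z ∈ R
  · exact ((h.contDiffAt_density ⟨hξ, hz⟩).smul
      (h.contDiffAt_field ⟨hξ, hz⟩)).congr_of_eventuallyEq (h.weighted_eventuallyEq ⟨hξ, hz⟩)
  · refine (contDiffAt_const (c := (0 : X × Z))).congr_of_eventuallyEq ?_
    filter_upwards [(h.isOpen_base.prod h.isCompact_support.isClosed.isOpen_compl).mem_nhds
      (show (ξ, z) ∈ V ×ˢ Qᶜ from ⟨hξ, fun hQ ↦ hz (h.support_subset hQ)⟩)]
    rintro ⟨ξ', z'⟩ h'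
    exact h.weighted_eq_zero ξ' h'.1 z' h'.2

theorem density_mul_coordDivergence (h : FibreDensity b b' V R Q gP gM dens w) {ξ : X} {z : Z}
    (hξ : ξ ∈ V) (hz : z ∈ R) :
    dens (ξ, z) * coordDivergence gP w (ξ, z) =
      LinearMap.trace ℝ (X × Z) (fderiv ℝ (weighted R dens w) (ξ, z)).toLinearMap +
      (1 / 2 : ℝ) * metricTrace (gM ξ) (fderiv ℝ gM ξ (weighted R dens w (ξ, z)).1) := by
  have hp : (ξ, z) ∈ V ×ˢ R := ⟨hξ, hz⟩
  have h1 := ((h.contDiffAt_density hp).differentiableAt (by simp)).hasFDerivAt.smul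
    ((h.contDiffAt_field hp).differentiableAt (by simp)).hasFDerivAt
  have h2 := (h1.congr_of_eventuallyEq (h.weighted_eventuallyEq hp)).fderiv
  have h3 : weighted R dens w (ξ, z) = dens (ξ, z) • w (ξ, z) := if_pos hz
  have h4 : LinearMap.trace ℝ (X × Z) (fderiv ℝ (weighted R dens w) (ξ, z)).toLinearMap =
      dens (ξ, z) * LinearMap.trace ℝ (X × Z) (fderiv ℝ w (ξ, z)).toLinearMap +
      fderiv ℝ dens (ξ, z) (w (ξ, z)) := by
    have : (fderiv ℝ (weighted R dens w) (ξ, z)).toLinearMap =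
        dens (ξ, z) • (fderiv ℝ w (ξ, z)).toLinearMap +
        LinearMap.smulRight (fderiv ℝ dens (ξ, z)).toLinearMap (w (ξ, z)) := by
      rw [h2]; rfl
    rw [this, map_add, map_smul, LinearMap.trace_smulRight, smul_eq_mul]
    rfl
  have h5 : metricTrace (gM ξ) (fderiv ℝ gM ξ (weighted R dens w (ξ, z)).1) =
      dens (ξ, z) * metricTrace (gM ξ) (fderiv ℝ gM ξ (w (ξ, z)).1) := by
    rw [h3, Prod.smul_fst, ContinuousLinearMap.map_smul]
    exact (metricTraceLinear (gM ξ)).map_smul _ _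
  rw [h4, h5, h.fderiv_density hp, coordDivergence]
  ring

/-- The base component of the weighted field, integrated along the fibre. -/
def average [MeasureSpace Z] (R : Set Z) (dens : X × Z → ℝ) (w : X × Z → X × Z) (ξ : X) : X :=
  ∫ z, (weighted R dens w (ξ, z)).1

theorem continuousOn_coordDivergence (h : FibreDensity b b' V R Q gP gM dens w) {ξ : X}
    (hξ : ξ ∈ V) : ContinuousOn (fun z ↦ dens (ξ, z) * coordDivergence gP w (ξ, z)) R := by
  refine ContinuousOn.congr (Continuous.continuousOn ?_)
    fun z hz ↦ h.density_mul_coordDivergence hξ hz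
  let T : (X × Z →L[ℝ] X × Z) →ₗ[ℝ] ℝ :=
    LinearMap.trace ℝ (X × Z) ∘ₗ ContinuousLinearMap.coeLM ℝ
  let L : X →ₗ[ℝ] ℝ := metricTraceLinear (gM ξ) ∘ₗ (fderiv ℝ gM ξ).toLinearMap
  have h1 : Continuous fun z ↦ T (fderiv ℝ (weighted R dens w) (ξ, z)) :=
    T.continuous_of_finiteDimensional.comp
      (continuous_fderiv_slice h.isOpen_base h.contDiffOn_weighted hξ)
  have h0 : Continuous fun z ↦ weighted R dens w (ξ, z) :=
    h.contDiffOn_weighted.continuousOn.comp_continuous (by fun_prop) fun z ↦ ⟨hξ, trivial⟩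
  have h2 : Continuous fun z ↦ L (weighted R dens w (ξ, z)).1 :=
    L.continuous_of_finiteDimensional.comp h0.fst
  exact h1.add (h2.const_mul _)

variable [MeasureSpace Z] [BorelSpace Z] [(volume : Measure Z).IsAddHaarMeasure]

omit [FiniteDimensional ℝ X] in
theorem contDiffOn_average (h : FibreDensity b b' V R Q gP gM dens w) :
    ContDiffOn ℝ ∞ (average R dens w) V :=
  contDiffOn_integral_of_compact_support h.isOpen_base h.isCompact_support
    (fun ξ hξ z hz ↦ congrArg Prod.fst (h.weighted_eq_zero ξ hξ z hz)) h.contDiffOn_weighted.fst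

theorem integral_coordDivergence (h : FibreDensity b b' V R Q gP gM dens w) {ξ : X} (hξ : ξ ∈ V) :
    ∫ z in R, dens (ξ, z) * coordDivergence gP w (ξ, z) =
      coordDivergence gM (average R dens w) ξ := by
  set a := weighted R dens w with ha
  have ha0 : ∀ ξ ∈ V, ∀ z ∉ Q, a (ξ, z) = 0 := h.weighted_eq_zero
  have hQ := h.isCompact_support
  have hV := h.isOpen_base
  have hsm := h.contDiffOn_weighted
  have hD := continuous_fderiv_slice hV hsm hξ
  have hD0 (z : Z) (hz : z ∉ Q) : fderiv ℝ a (ξ, z) = 0 :=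
    fderiv_eq_zero_of_compact_support hV hQ ha0 hξ hz
  have hac : Continuous fun z ↦ a (ξ, z) :=
    hsm.continuousOn.comp_continuous (by fun_prop) fun z ↦ ⟨hξ, trivial⟩
  have hdiff (z : Z) : HasFDerivAt a (fderiv ℝ a (ξ, z)) (ξ, z) :=
    ((hsm.contDiffAt ((hV.prod isOpen_univ).mem_nhds ⟨hξ, trivial⟩)).differentiableAt
      (by simp)).hasFDerivAt
  let T₁ : (X × Z →L[ℝ] X × Z) →ₗ[ℝ] ℝ := LinearMap.trace ℝ X ∘ₗ
    (LinearMap.lcomp ℝ X (LinearMap.inl ℝ X Z)) ∘ₗ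
    (LinearMap.llcomp ℝ (X × Z) (X × Z) X (LinearMap.fst ℝ X Z)) ∘ₗ ContinuousLinearMap.coeLM ℝ
  let T₂ : (X × Z →L[ℝ] X × Z) →ₗ[ℝ] ℝ := LinearMap.trace ℝ Z ∘ₗ
    (LinearMap.lcomp ℝ Z (LinearMap.inr ℝ X Z)) ∘ₗ
    (LinearMap.llcomp ℝ (X × Z) (X × Z) Z (LinearMap.snd ℝ X Z)) ∘ₗ ContinuousLinearMap.coeLM ℝ
  let L : X →ₗ[ℝ] ℝ := (1 / 2 : ℝ) • metricTraceLinear (gM ξ) ∘ₗ (fderiv ℝ gM ξ).toLinearMap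
  have hcD : Integrable fun z ↦ fderiv ℝ a (ξ, z) := integrable_of_continuous_of_support hD hQ hD0
  have hca : Integrable fun z ↦ (a (ξ, z)).1 := integrable_of_continuous_of_support hac.fst hQ
    fun z hz ↦ congrArg Prod.fst (ha0 ξ hξ z hz)
  have hT₁ := (LinearMap.toContinuousLinearMap T₁).integral_comp_comm hcD
  have hI₁ : Integrable fun z ↦ T₁ (fderiv ℝ a (ξ, z)) :=
    (LinearMap.toContinuousLinearMap T₁).integrable_comp hcD
  have hI₂ : Integrable fun z ↦ T₂ (fderiv ℝ a (ξ, z)) :=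
    (LinearMap.toContinuousLinearMap T₂).integrable_comp hcD
  have hL := (LinearMap.toContinuousLinearMap L).integral_comp_comm hca
  have hIL : Integrable fun z ↦ L (a (ξ, z)).1 :=
    (LinearMap.toContinuousLinearMap L).integrable_comp hca
  have hT₂ : ∫ z, T₂ (fderiv ℝ a (ξ, z)) = 0 := by
    rw [← integral_trace_fderiv_eq_zero (f := fun z ↦ (a (ξ, z)).2) (Q := Q) ?_ hQ
      fun z hz ↦ congrArg Prod.snd (ha0 ξ hξ z hz)]
    · refine integral_congr_ae (.of_forall fun z ↦ ?_)
      have h1 : HasFDerivAt (fun z : Z ↦ (ξ, z)) (ContinuousLinearMap.inr ℝ X Z) z := by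
        simpa using! (hasFDerivAt_const ξ z).prodMk (hasFDerivAt_id (𝕜 := ℝ) z)
      have h2 := (HasFDerivAt.comp z (hdiff z) h1).snd
      change _ = LinearMap.trace ℝ Z (fderiv ℝ (fun z ↦ ((a ∘ fun z ↦ (ξ, z)) z).2) z).toLinearMap
      rw [h2.fderiv]
      rfl
    · rw [contDiff_iff_contDiffAt]
      intro z
      have h1 := (hsm.contDiffAt ((hV.prod isOpen_univ).mem_nhds
        (show (ξ, z) ∈ V ×ˢ Set.univ from ⟨hξ, trivial⟩))).of_le (m := 1) (by simp)
      exact (h1.comp z (contDiffAt_const.prodMk contDiffAt_id)).snd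
  have hder := (hasFDerivAt_integral_of_compact_support (a := fun p ↦ (a p).1) hV hQ
    (fun ξ hξ z hz ↦ congrArg Prod.fst (ha0 ξ hξ z hz)) hsm.fst hξ).fderiv
  have hder1 : LinearMap.trace ℝ X (fderiv ℝ (average R dens w) ξ).toLinearMap =
      ∫ z, T₁ (fderiv ℝ a (ξ, z)) := by
    refine (congrArg (fun S : X →L[ℝ] X ↦ LinearMap.trace ℝ X S.toLinearMap) hder).trans ?_
    refine Eq.trans ?_ hT₁.symm
    change _ = LinearMap.trace ℝ X ((LinearMap.fst ℝ X Z) ∘ₗ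
      (∫ z, fderiv ℝ a (ξ, z)).toLinearMap ∘ₗ LinearMap.inl ℝ X Z)
    congr 1
    have h1 := (((ContinuousLinearMap.compL ℝ X (X × Z) X).flip
      (ContinuousLinearMap.inl ℝ X Z)).comp (ContinuousLinearMap.compL ℝ (X × Z) (X × Z) X
        (ContinuousLinearMap.fst ℝ X Z))).integral_comp_comm hcD
    refine (congrArg ContinuousLinearMap.toLinearMap (Eq.trans ?_ h1)).trans rfl
    refine integral_congr_ae (.of_forall fun z ↦ ?_)
    exact congrArg (fun S : X × Z →L[ℝ] X ↦ S.comp (ContinuousLinearMap.inl ℝ X Z))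
      (hdiff z).fst.fderiv
  have e1 : ∫ z in R, dens (ξ, z) * coordDivergence gP w (ξ, z) =
      ∫ z in R, (T₁ (fderiv ℝ a (ξ, z)) + T₂ (fderiv ℝ a (ξ, z)) + L (a (ξ, z)).1) := by
    refine setIntegral_congr_fun h.isOpen_fibre.measurableSet fun z hz ↦ ?_
    refine (h.density_mul_coordDivergence hξ hz).trans ?_
    rw [LinearMap.trace_prod_eq]
    rfl
  rw [e1, setIntegral_eq_integral_of_forall_compl_eq_zero]
  · refine (integral_add (hI₁.add hI₂) hIL).trans ?_
    refine congrArg₂ (· + ·) ((integral_add hI₁ hI₂).trans ?_) hL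
    rw [hT₂, add_zero, hder1]
  · intro z hz
    have hzQ : z ∉ Q := fun hQ ↦ hz (h.support_subset hQ)
    rw [hD0 z hzQ, ha0 ξ hξ z hzQ, map_zero, map_zero, Prod.fst_zero, map_zero, add_zero, add_zero]

end FibreDensity
end CoordinateFibreIntegral

/-! ### Fibre averages of fields supported in a product chart -/

section LocalAverage

variable {m k : ℕ}
  {M : Type*} [TopologicalSpace M] [ChartedSpace (EuclideanSpace ℝ (Fin m)) M]
  {K : Type*} [TopologicalSpace K] [ChartedSpace (EuclideanSpace ℝ (Fin k)) K]

/-- The component of `W` tangent to the base, as a vector of the model space. -/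
def baseComponent (W : (p : M × K) → TangentSpace ((𝓡 m).prod (𝓡 k)) p) (x : M) (y : K) :
    EuclideanSpace ℝ (Fin m) :=
  (show EuclideanSpace ℝ (Fin m) × EuclideanSpace ℝ (Fin k) from W (x, y)).1

variable [IsManifold (𝓡 m) ∞ M] [IsManifold (𝓡 k) ∞ K]
  {W : (p : M × K) → TangentSpace ((𝓡 m).prod (𝓡 k)) p}

theorem chartCoord_baseComponent (W : (p : M × K) → TangentSpace ((𝓡 m).prod (𝓡 k)) p)
    {x₀ x : M} {i y : K} (hx : x ∈ (extChartAt (𝓡 m) x₀).source)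
    (hy : y ∈ (extChartAt (𝓡 k) i).source) :
    chartCoord (𝓡 m) x₀ x (baseComponent W x y) =
      (chartField W (x₀, i) (extChartAt (𝓡 m) x₀ x, extChartAt (𝓡 k) i y)).1 := by
  have h1 := chartField_extChartAt (W := W) (mem_extChartAt_source_prod hx hy)
  rw [extChartAt_prod_mk] at h1
  exact (congrArg Prod.fst (h1.trans (chartCoord_prod hx hy _ _))).symm

theorem continuous_baseComponent {x : M} (hW : ∀ y, SmoothVectorFieldAt W (x, y)) :
    Continuous (baseComponent W x) := by
  rw [continuous_iff_continuousAt]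
  intro i
  have hx := mem_extChartAt_source (I := 𝓡 m) x
  have hi := mem_extChartAt_source (I := 𝓡 k) i
  have hs := contDiffAt_chartField (mem_extChartAt_source (I := (𝓡 m).prod (𝓡 k)) (x, i)) (hW i)
  have hc := hs.continuousAt
  rw [extChartAt_prod_mk] at hc
  have h1 : ContinuousAt (fun y ↦ (extChartAt (𝓡 m) x x, extChartAt (𝓡 k) i y)) i :=
    continuousAt_const.prodMk (continuousAt_extChartAt i)
  have h2 := (ContinuousAt.comp (g := chartField W (x, i))
    (f := fun y ↦ (extChartAt (𝓡 m) x x, extChartAt (𝓡 k) i y)) hc h1).fst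
  refine h2.congr ?_
  filter_upwards [(isOpen_extChartAt_source (I := 𝓡 k) i).mem_nhds hi] with y hy
  exact (chartCoord_baseComponent W hx hy).symm.trans (chartCoord_self x _)

namespace SubmersiveMetric

variable [MeasurableSpace K] (G : SubmersiveMetric m k M K)

/-- The base component of `W`, integrated along the fibre. -/
def fibreAverage (W : (p : M × K) → TangentSpace ((𝓡 m).prod (𝓡 k)) p) (x : M) :
    TangentSpace (𝓡 m) x :=
  (∫ y, baseComponent W x y ∂(G.fibreVolume x) : EuclideanSpace ℝ (Fin m))

/-- A field that is supported, over the open subset `U` of a chart domain, in a compact subset of a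
chart domain of the fibre. -/
structure SupportedInChart (W : (p : M × K) → TangentSpace ((𝓡 m).prod (𝓡 k)) p)
    (x₀ : M) (i : K) (U : Set M) (Q : Set K) : Prop where
  smooth : ∀ p, SmoothVectorFieldAt W p
  isOpen : IsOpen U
  subset_source : U ⊆ (extChartAt (𝓡 m) x₀).source
  isCompact : IsCompact Q
  support_subset : Q ⊆ (extChartAt (𝓡 k) i).source
  eq_zero : ∀ x ∈ U, ∀ y ∉ Q, W (x, y) = 0

/-- The fibre density in a product chart. -/
def productDensity (x₀ : M) (i : K) (p : EuclideanSpace ℝ (Fin m) × EuclideanSpace ℝ (Fin k)) :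
    ℝ :=
  chartDensity (G.fibreMetric ((extChartAt (𝓡 m) x₀).symm p.1)).inner i p.2

namespace SupportedInChart

variable {x₀ : M} {i : K} {U : Set M} {Q : Set K} {G}

omit [MeasurableSpace K] in
theorem fibreDensity (h : SupportedInChart W x₀ i U Q) :
    FibreDensity (EuclideanSpace.basisFun (Fin m) ℝ).toBasis
      (EuclideanSpace.basisFun (Fin k) ℝ).toBasis
      ((extChartAt (𝓡 m) x₀).target ∩ (extChartAt (𝓡 m) x₀).symm ⁻¹' U)
      (extChartAt (𝓡 k) i).target (extChartAt (𝓡 k) i '' Q)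
      (chartForm (x₀, i) G.gP.inner) (chartForm x₀ G.gM.inner) (G.productDensity x₀ i)
      (chartField W (x₀, i)) where
  isOpen_base := (continuousOn_extChartAt_symm x₀).isOpen_inter_preimage
    (isOpen_extChartAt_target x₀) h.isOpen
  isOpen_fibre := isOpen_extChartAt_target i
  isCompact_support := h.isCompact.image_of_continuousOn
    ((continuousOn_extChartAt i).mono h.support_subset)
  support_subset := by
    rintro _ ⟨y, hy, rfl⟩
    exact (extChartAt (𝓡 k) i).map_source (h.support_subset hy)
  contDiffOn_gP := (G.gP.contDiffOn_chartForm (x₀, i)).mono fun p hp ↦ by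
    rw [extChartAt_prod]; exact ⟨hp.1.1, hp.2⟩
  contDiffOn_gM := (G.gM.contDiffOn_chartForm x₀).mono Set.inter_subset_left
  metric_gP := by
    rintro ⟨ξ, z⟩ ⟨⟨hξ, -⟩, hz⟩
    have := G.gP.isMetricForm_chartForm (mem_extChartAt_source_prod
      ((extChartAt (𝓡 m) x₀).map_target hξ) ((extChartAt (𝓡 k) i).map_target hz))
    rwa [extChartAt_prod_mk, (extChartAt (𝓡 m) x₀).right_inv hξ,
      (extChartAt (𝓡 k) i).right_inv hz] at this
  metric_gM := by
    rintro ξ ⟨hξ, -⟩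
    have := G.gM.isMetricForm_chartForm ((extChartAt (𝓡 m) x₀).map_target hξ)
    rwa [(extChartAt (𝓡 m) x₀).right_inv hξ] at this
  density := by
    rintro ⟨ξ, z⟩ ⟨⟨hξ, -⟩, hz⟩
    have := G.det_gramMatrix_chartForm (EuclideanSpace.basisFun (Fin m) ℝ).toBasis
      (EuclideanSpace.basisFun (Fin k) ℝ).toBasis
      ((extChartAt (𝓡 m) x₀).map_target hξ) ((extChartAt (𝓡 k) i).map_target hz)
    rw [(extChartAt (𝓡 m) x₀).right_inv hξ, (extChartAt (𝓡 k) i).right_inv hz] at this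
    rw [this, abs_mul, Real.sqrt_mul (abs_nonneg _)]
    rfl
  contDiffOn_field := by
    rintro ⟨ξ, z⟩ ⟨⟨hξ, -⟩, hz⟩
    have := contDiffAt_chartField (W := W) (mem_extChartAt_source_prod
      ((extChartAt (𝓡 m) x₀).map_target hξ) ((extChartAt (𝓡 k) i).map_target hz)) (h.smooth _)
    rw [extChartAt_prod_mk, (extChartAt (𝓡 m) x₀).right_inv hξ,
      (extChartAt (𝓡 k) i).right_inv hz] at this
    exact this.contDiffWithinAt
  eq_zero := by
    rintro ξ ⟨hξ, hU⟩ z hz hzQ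
    have h1 := chartField_extChartAt (W := W) (mem_extChartAt_source_prod
      ((extChartAt (𝓡 m) x₀).map_target hξ) ((extChartAt (𝓡 k) i).map_target hz))
    rw [extChartAt_prod_mk, (extChartAt (𝓡 m) x₀).right_inv hξ,
      (extChartAt (𝓡 k) i).right_inv hz, h.eq_zero _ hU, map_zero] at h1
    · exact h1
    · exact fun hy ↦ hzQ ⟨_, hy, (extChartAt (𝓡 k) i).right_inv hz⟩

omit [MeasurableSpace K] in
theorem extChartAt_mem (h : SupportedInChart W x₀ i U Q) {x : M} (hx : x ∈ U) :
    extChartAt (𝓡 m) x₀ x ∈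
      (extChartAt (𝓡 m) x₀).target ∩ (extChartAt (𝓡 m) x₀).symm ⁻¹' U := by
  refine ⟨(extChartAt (𝓡 m) x₀).map_source (h.subset_source hx), ?_⟩
  rwa [Set.mem_preimage, (extChartAt (𝓡 m) x₀).left_inv (h.subset_source hx)]

omit [MeasurableSpace K] in
theorem baseComponent_eq_zero (h : SupportedInChart W x₀ i U Q) {x : M} (hx : x ∈ U) {y : K}
    (hy : y ∉ Q) : baseComponent W x y = 0 := by
  rw [baseComponent, h.eq_zero x hx y hy]; rfl

variable [BorelSpace K] [SecondCountableTopology K]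

variable (G) in
theorem integrable_baseComponent (h : SupportedInChart W x₀ i U Q) {x : M} (hx : x ∈ U) :
    Integrable (baseComponent W x) (G.fibreVolume x) :=
  integrable_riemannianVolume_of_support (G.fibreMetric x)
    (continuous_baseComponent fun y ↦ h.smooth (x, y)).continuousOn h.isCompact h.support_subset
    fun _ hy ↦ h.baseComponent_eq_zero hx hy

theorem chartField_fibreAverage (h : SupportedInChart W x₀ i U Q) {x : M} (hx : x ∈ U) :
    chartField (G.fibreAverage W) x₀ (extChartAt (𝓡 m) x₀ x) =
      FibreDensity.average (extChartAt (𝓡 k) i).target (G.productDensity x₀ i)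
        (chartField W (x₀, i)) (extChartAt (𝓡 m) x₀ x) := by
  have hxs := h.subset_source hx
  rw [chartField_extChartAt hxs]
  let L : EuclideanSpace ℝ (Fin m) →L[ℝ] EuclideanSpace ℝ (Fin m) := chartCoord (𝓡 m) x₀ x
  refine (L.integral_comp_comm (h.integrable_baseComponent G hx)).symm.trans ?_
  refine (integral_riemannianVolume_of_support (G.fibreMetric x) (y := i)
    (L.continuous.comp (continuous_baseComponent fun y ↦ h.smooth (x, y))).continuousOn
    fun y hy ↦ ?_).trans ?_
  · rw [Function.comp_apply, h.baseComponent_eq_zero hx fun hQ ↦ hy (h.support_subset hQ),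
      map_zero]
  · refine Eq.trans ?_ (setIntegral_eq_integral_of_forall_compl_eq_zero
      (s := (extChartAt (𝓡 k) i).target) ?_)
    · refine setIntegral_congr_fun (isOpen_extChartAt_target i).measurableSet fun z hz ↦ ?_
      have h1 := chartCoord_baseComponent W hxs ((extChartAt (𝓡 k) i).map_target hz)
      rw [(extChartAt (𝓡 k) i).right_inv hz] at h1
      have h2 : (FibreDensity.weighted (extChartAt (𝓡 k) i).target (G.productDensity x₀ i)
          (chartField W (x₀, i)) (extChartAt (𝓡 m) x₀ x, z)) =
          G.productDensity x₀ i (extChartAt (𝓡 m) x₀ x, z) •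
            chartField W (x₀, i) (extChartAt (𝓡 m) x₀ x, z) := if_pos hz
      rw [h2, Prod.smul_fst, ← h1, productDensity, (extChartAt (𝓡 m) x₀).left_inv hxs]
      rfl
    · intro z hz
      exact congrArg Prod.fst (if_neg hz)

theorem chartField_fibreAverage_eventuallyEq (h : SupportedInChart W x₀ i U Q) {x : M}
    (hx : x ∈ U) :
    chartField (G.fibreAverage W) x₀ =ᶠ[nhds (extChartAt (𝓡 m) x₀ x)]
      FibreDensity.average (extChartAt (𝓡 k) i).target (G.productDensity x₀ i)
        (chartField W (x₀, i)) := by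
  filter_upwards [(h.fibreDensity (G := G)).isOpen_base.mem_nhds (h.extChartAt_mem hx)] with ξ hξ
  have := h.chartField_fibreAverage (G := G) hξ.2
  rwa [(extChartAt (𝓡 m) x₀).right_inv hξ.1] at this

variable (G) in
theorem smooth_fibreAverage (h : SupportedInChart W x₀ i U Q) {x : M} (hx : x ∈ U) :
    SmoothVectorFieldAt (G.fibreAverage W) x :=
  smoothVectorFieldAt_of_chartField (h.subset_source hx)
    ((h.fibreDensity.contDiffOn_average.contDiffAt
      ((h.fibreDensity (G := G)).isOpen_base.mem_nhds
        (h.extChartAt_mem hx))).congr_of_eventuallyEq (h.chartField_fibreAverage_eventuallyEq hx))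

omit [MeasurableSpace K] [BorelSpace K] [SecondCountableTopology K] in
theorem divergence_eq_zero [T2Space K] (h : SupportedInChart W x₀ i U Q) {x : M} (hx : x ∈ U)
    {y : K} (hy : y ∉ Q) : divergence G.gP.inner W (x, y) = 0 := by
  rw [← G.gP.divergence_zero (p := (x, y))]
  refine G.gP.divergence_congr ?_
  filter_upwards [(h.isOpen.prod h.isCompact.isClosed.isOpen_compl).mem_nhds
    (show (x, y) ∈ U ×ˢ Qᶜ from ⟨hx, hy⟩)]
  rintro ⟨x', y'⟩ h'
  exact h.eq_zero x' h'.1 y' h'.2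

omit [MeasurableSpace K] [BorelSpace K] [SecondCountableTopology K] in
theorem productDensity_mul_divergence (h : SupportedInChart W x₀ i U Q) {x : M} (hx : x ∈ U)
    {z : EuclideanSpace ℝ (Fin k)} (hz : z ∈ (extChartAt (𝓡 k) i).target) :
    chartDensity (G.fibreMetric x).inner i z *
        divergence G.gP.inner W (x, (extChartAt (𝓡 k) i).symm z) =
      G.productDensity x₀ i (extChartAt (𝓡 m) x₀ x, z) *
        coordDivergence (chartForm (x₀, i) G.gP.inner) (chartField W (x₀, i))
          (extChartAt (𝓡 m) x₀ x, z) := by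
  have hxs := h.subset_source hx
  rw [G.gP.divergence_eq_coordDivergence (mem_extChartAt_source_prod hxs
    ((extChartAt (𝓡 k) i).map_target hz)) (h.smooth _), extChartAt_prod_mk,
    (extChartAt (𝓡 k) i).right_inv hz, productDensity, (extChartAt (𝓡 m) x₀).left_inv hxs]

omit [MeasurableSpace K] [BorelSpace K] [SecondCountableTopology K] in
theorem continuousOn_divergence (h : SupportedInChart W x₀ i U Q) {x : M} (hx : x ∈ U) :
    ContinuousOn (fun y ↦ divergence G.gP.inner W (x, y)) (extChartAt (𝓡 k) i).source := by
  have hd (z) (hz : z ∈ (extChartAt (𝓡 k) i).target) :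
      chartDensity (G.fibreMetric x).inner i z ≠ 0 := by
    have := (G.fibreMetric x).isMetricForm_chartForm ((extChartAt (𝓡 k) i).map_target hz)
    rw [(extChartAt (𝓡 k) i).right_inv hz] at this
    exact (Real.sqrt_pos.2 (abs_pos.2 (this.det_gramMatrix_ne_zero _))).ne'
  have h1 := (((h.fibreDensity (G := G)).continuousOn_coordDivergence
    (h.extChartAt_mem hx)).div (continuousOn_chartDensity (G.fibreMetric x) i) hd).comp
      (continuousOn_extChartAt i) (extChartAt (𝓡 k) i).mapsTo
  refine h1.congr fun y hy ↦ ?_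
  have hz := (extChartAt (𝓡 k) i).map_source hy
  have h2 := h.productDensity_mul_divergence (G := G) hx hz
  rw [(extChartAt (𝓡 k) i).left_inv hy] at h2
  exact (mul_div_cancel_left₀ _ (hd _ hz)).symm.trans (congrArg (· / _) h2)

variable [T2Space K]

variable (G) in
theorem integrable_divergence (h : SupportedInChart W x₀ i U Q) {x : M} (hx : x ∈ U) :
    Integrable (fun y ↦ divergence G.gP.inner W (x, y)) (G.fibreVolume x) :=
  integrable_riemannianVolume_of_support (G.fibreMetric x) (h.continuousOn_divergence hx)
    h.isCompact h.support_subset fun _ hy ↦ h.divergence_eq_zero hx hy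

variable (G) in
theorem integral_divergence (h : SupportedInChart W x₀ i U Q) {x : M} (hx : x ∈ U) :
    ∫ y, divergence G.gP.inner W (x, y) ∂(G.fibreVolume x) =
      divergence G.gM.inner (G.fibreAverage W) x := by
  have hξ := h.extChartAt_mem hx
  have hev := h.chartField_fibreAverage_eventuallyEq (G := G) hx
  refine (integral_riemannianVolume_of_support (G.fibreMetric x) (h.continuousOn_divergence hx)
    fun y hy ↦ h.divergence_eq_zero hx fun hQ ↦ hy (h.support_subset hQ)).trans ?_
  refine (setIntegral_congr_fun (isOpen_extChartAt_target i).measurableSet fun z hz ↦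
    h.productDensity_mul_divergence hx hz).trans ?_
  refine (h.fibreDensity.integral_coordDivergence hξ).trans ?_
  rw [G.gM.divergence_eq_coordDivergence (h.subset_source hx) (h.smooth_fibreAverage G hx),
    coordDivergence, coordDivergence, hev.fderiv_eq, hev.self_of_nhds]

end SupportedInChart
end SubmersiveMetric
end LocalAverage

/-! ### Fibre averages of fields with fibrewise compact support -/

section GlobalAverage

variable {m k : ℕ}
  {M : Type*} [TopologicalSpace M] [ChartedSpace (EuclideanSpace ℝ (Fin m)) M]
  {K : Type*} [TopologicalSpace K] [ChartedSpace (EuclideanSpace ℝ (Fin k)) K]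
  [IsManifold (𝓡 m) ∞ M] [IsManifold (𝓡 k) ∞ K]
  {W : (p : M × K) → TangentSpace ((𝓡 m).prod (𝓡 k)) p}

namespace SubmersiveMetric

theorem exists_sum_supportedInChart [T2Space K] [SecondCountableTopology K]
    (hW : ∀ p, SmoothVectorFieldAt W p)
    (hS : FibrewiseRelativelyCompact {p : M × K | W p ≠ 0}) (x₀ : M) :
    ∃ (U : Set M) (s : Finset K) (V : K → (p : M × K) → TangentSpace ((𝓡 m).prod (𝓡 k)) p)
      (Q : K → Set K), x₀ ∈ U ∧ IsOpen U ∧ (∀ i ∈ s, SupportedInChart (V i) x₀ i U (Q i)) ∧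
      ∀ x ∈ U, ∀ y, W (x, y) = ∑ i ∈ s, V i (x, y) := by
  have := Manifold.locallyCompact_of_finiteDimensional (M := M) (𝓡 m)
  have := Manifold.locallyCompact_of_finiteDimensional (M := K) (𝓡 k)
  obtain ⟨C, hCn, hCs, hC⟩ := local_compact_nhds
    ((isOpen_extChartAt_source (I := 𝓡 m) x₀).mem_nhds (mem_extChartAt_source x₀))
  obtain ⟨ρ, hρ⟩ := SmoothPartitionOfUnity.exists_isSubordinate_chartAt_source (𝓡 k) K
  set L : Set K := Prod.snd '' (closure {p : M × K | W p ≠ 0} ∩ Prod.fst ⁻¹' C) with hL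
  have hLc : IsCompact L := (hS C hC).image continuous_snd
  have hW0 {x : M} (hx : x ∈ C) {y : K} (hy : y ∉ L) : W (x, y) = 0 := by
    by_contra h0
    exact hy ⟨(x, y), ⟨subset_closure h0, hx⟩, rfl⟩
  have hfin := ρ.locallyFinite.finite_nonempty_inter_compact hLc
  refine ⟨interior C, hfin.toFinset, fun i p ↦ ρ i p.2 • W p, fun i ↦ tsupport (ρ i) ∩ L,
    mem_interior_iff_mem_nhds.2 hCn, isOpen_interior, fun i _ ↦ ⟨fun p ↦ ?_, isOpen_interior,
    interior_subset.trans hCs, hLc.inter_left (isClosed_tsupport _), ?_, ?_⟩, ?_⟩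
  · exact SmoothVectorFieldAt.smul (ContMDiffAt.comp (g := ρ i) p (ρ i).contMDiff.contMDiffAt
      contMDiffAt_snd) (hW p)
  · intro y hy
    rw [extChartAt_source]
    exact hρ i hy.1
  · intro x hx y hy
    by_cases hyL : y ∈ L
    · have : ρ i y = 0 := image_eq_zero_of_notMem_tsupport fun h ↦ hy ⟨h, hyL⟩
      simp only [this, zero_smul]
    · simp only [hW0 (interior_subset hx) hyL, smul_zero]
  · intro x hx y
    by_cases hyL : y ∈ L
    · have h1 := ρ.sum_eq_one (Set.mem_univ y)
      rw [finsum_eq_sum_of_support_subset (s := hfin.toFinset)] at h1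
      · rw [← Finset.sum_smul, h1, one_smul]
      · intro i hi
        simp only [Set.Finite.coe_toFinset, Set.mem_ofPred_eq]
        exact ⟨y, hi, hyL⟩
    · simp only [hW0 (interior_subset hx) hyL, smul_zero, Finset.sum_const_zero]

variable [MeasurableSpace K] [BorelSpace K] [T2Space K] [SecondCountableTopology K]
  (G : SubmersiveMetric m k M K)

/-- Fibre integration commutes with the divergence, for fields with fibrewise compact support. -/
theorem fibreAverage_spec (hW : ∀ p, SmoothVectorFieldAt W p)
    (hS : FibrewiseRelativelyCompact {p : M × K | W p ≠ 0}) (x₀ : M) :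
    Integrable (baseComponent W x₀) (G.fibreVolume x₀) ∧
    SmoothVectorFieldAt (G.fibreAverage W) x₀ ∧
    Integrable (fun y ↦ divergence G.gP.inner W (x₀, y)) (G.fibreVolume x₀) ∧
    ∫ y, divergence G.gP.inner W (x₀, y) ∂(G.fibreVolume x₀) =
      divergence G.gM.inner (G.fibreAverage W) x₀ := by
  obtain ⟨U, s, V, Q, hx₀, hU, hV, hsum⟩ := exists_sum_supportedInChart hW hS x₀
  have h1 (x : M) (hx : x ∈ U) (y : K) : baseComponent W x y = ∑ i ∈ s, baseComponent (V i) x y := by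
    refine (congrArg (fun v : EuclideanSpace ℝ (Fin m) × EuclideanSpace ℝ (Fin k) ↦ v.1)
      (hsum x hx y)).trans ?_
    exact map_sum (AddMonoidHom.fst (EuclideanSpace ℝ (Fin m)) (EuclideanSpace ℝ (Fin k)))
      (fun i ↦ V i (x, y)) s
  have h2 (x : M) (hx : x ∈ U) : G.fibreAverage W x = ∑ i ∈ s, G.fibreAverage (V i) x := by
    refine (integral_congr_ae (.of_forall (h1 x hx))).trans ?_
    exact integral_finsetSum s fun i hi ↦ (hV i hi).integrable_baseComponent G hx
  have h2' : ∀ᶠ x in nhds x₀, G.fibreAverage W x = ∑ i ∈ s, G.fibreAverage (V i) x :=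
    Filter.eventually_of_mem (hU.mem_nhds hx₀) h2
  have h3 (y : K) : divergence G.gP.inner W (x₀, y) =
      ∑ i ∈ s, divergence G.gP.inner (V i) (x₀, y) := by
    rw [← G.gP.divergence_sum s fun i hi ↦ (hV i hi).smooth (x₀, y)]
    refine G.gP.divergence_congr ?_
    filter_upwards [(hU.prod isOpen_univ).mem_nhds (show (x₀, y) ∈ U ×ˢ Set.univ from ⟨hx₀, trivial⟩)]
    rintro ⟨x', y'⟩ h'
    exact hsum x' h'.1 y'
  refine ⟨?_, ?_, ?_, ?_⟩
  · rw [funext (h1 x₀ hx₀)]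
    exact integrable_finsetSum _ fun i hi ↦ (hV i hi).integrable_baseComponent G hx₀
  · exact (SmoothVectorFieldAt.sum fun i hi ↦
      (hV i hi).smooth_fibreAverage G hx₀).congr_of_eventuallyEq h2'
  · rw [funext h3]
    exact integrable_finsetSum _ fun i hi ↦ (hV i hi).integrable_divergence G hx₀
  · rw [G.gM.divergence_congr h2', G.gM.divergence_sum s fun i hi ↦
      (hV i hi).smooth_fibreAverage G hx₀]
    simp only [h3]
    rw [integral_finsetSum _ fun i hi ↦ (hV i hi).integrable_divergence G hx₀]
    exact Finset.sum_congr rfl fun i hi ↦ (hV i hi).integral_divergence G hx₀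

omit [MeasurableSpace K] [BorelSpace K] [T2Space K] [SecondCountableTopology K] in
/-- The pairing with a basic lift only sees the base component. -/
theorem inner_horizontalLift (W : (p : M × K) → TangentSpace ((𝓡 m).prod (𝓡 k)) p) (x : M) (y : K)
    (X : TangentSpace (𝓡 m) x) : G.gP.inner (x, y) (W (x, y)) (G.horizontalLift (x, y) X) =
      G.gM.form x (baseComponent W x y) X := by
  refine (submersiveForm_apply (x, y) _ _ _ (W (x, y)) (G.horizontalLift (x, y) X)).trans ?_
  refine (congrArg₂ (· + ·) rfl
    ((congrArg _ (sub_self (G.A (x, y) X))).trans (map_zero _))).trans ?_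
  exact add_zero _

omit [T2Space K] [SecondCountableTopology K] [BorelSpace K] in
theorem integral_inner_horizontalLift {x : M}
    (hint : Integrable (baseComponent W x) (G.fibreVolume x)) (X : TangentSpace (𝓡 m) x) :
    ∫ y, G.gP.inner (x, y) (W (x, y)) (G.horizontalLift (x, y) X) ∂(G.fibreVolume x) =
      G.gM.inner x (G.fibreAverage W x) X := by
  simp only [G.inner_horizontalLift W x]
  exact ((G.gM.form x).flip X).integral_comp_comm hint

omit [T2Space K] [SecondCountableTopology K] [BorelSpace K] in
theorem integrable_inner_horizontalLift {x : M}
    (hint : Integrable (baseComponent W x) (G.fibreVolume x)) (X : TangentSpace (𝓡 m) x) :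
    Integrable (fun y ↦ G.gP.inner (x, y) (W (x, y)) (G.horizontalLift (x, y) X))
      (G.fibreVolume x) := by
  simp only [G.inner_horizontalLift W x]
  exact ((G.gM.form x).flip X).integrable_comp hint

omit [T2Space K] [SecondCountableTopology K] [BorelSpace K] in
theorem fibreProjectionIn_eq {x : M} (hint : Integrable (baseComponent W x) (G.fibreVolume x))
    {ι : Type*} [Fintype ι] [DecidableEq ι] (X : Module.Basis ι ℝ (TangentSpace (𝓡 m) x)) :
    G.fibreProjectionIn W x X = G.fibreAverage W x := by
  rw [fibreProjectionIn]
  simp only [G.integral_inner_horizontalLift hint]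
  exact (G.gM.isMetricForm x).sum_inverseGram_smul X _

theorem fibreProjection_eq (hW : ∀ p, SmoothVectorFieldAt W p)
    (hS : FibrewiseRelativelyCompact {p : M × K | W p ≠ 0}) :
    G.fibreProjection W = G.fibreAverage W :=
  funext fun x ↦ G.fibreProjectionIn_eq (G.fibreAverage_spec hW hS x).1 _

/-- Fibre integration of the divergence. -/
theorem fibreProjection_spec (hW : SmoothVectorFieldOn ((𝓡 m).prod (𝓡 k)) W Set.univ)
    (hS : FibrewiseRelativelyCompact {p : M × K | W p ≠ 0}) :
    SmoothVectorFieldOn (𝓡 m) (G.fibreProjection W) Set.univ ∧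
      ∀ x : M,
        (∀ X : Module.Basis (Fin m) ℝ (TangentSpace (𝓡 m) x),
          (∀ μ, Integrable (fun y ↦ G.gP.inner (x, y) (W (x, y)) (G.horizontalLift (x, y) (X μ)))
            (G.fibreVolume x)) ∧
          G.fibreProjection W x = G.fibreProjectionIn W x X) ∧
        Integrable (fun y ↦ divergence G.gP.inner W (x, y)) (G.fibreVolume x) ∧
        ∫ y, divergence G.gP.inner W (x, y) ∂(G.fibreVolume x) =
          divergence G.gM.inner (G.fibreProjection W) x := by
  rw [smoothVectorFieldOn_univ_iff] at hW
  have h := G.fibreAverage_spec hW hS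
  rw [G.fibreProjection_eq hW hS, smoothVectorFieldOn_univ_iff]
  refine ⟨fun x ↦ (h x).2.1, fun x ↦ ⟨fun X ↦ ⟨fun μ ↦ ?_, ?_⟩, (h x).2.2⟩⟩
  · exact G.integrable_inner_horizontalLift (h x).1 _
  · exact (G.fibreProjectionIn_eq (h x).1 X).symm

end SubmersiveMetric
end GlobalAverage

/-! ### Gamma matrices and the Dirac form -/

section CliffordCancellation

variable {V : Type*} [AddCommGroup V] [Module ℝ V] {n : ℕ} {η : Fin n → ℝ}
  {G : Fin n → V →ₗ[ℝ] V}

theorem clifford_commutator (hη : ∀ r, η r * η r = 1)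
    (hG : ∀ r s φ, G r (G s φ) + G s (G r φ) = if r = s then (-2 * η r) • φ else 0)
    {o : Fin n → Fin n → ℝ} (ho : ∀ a b, o a b = -o b a) (r : Fin n) (ψ : V) :
    G r (∑ a, ∑ b, (η a * η b * o a b) • G a (G b ψ)) -
      ∑ a, ∑ b, (η a * η b * o a b) • G a (G b (G r ψ)) =
      (-4 : ℝ) • ∑ b, (η b * o r b) • G b ψ := by
  have key (a b : Fin n) : G r (G a (G b ψ)) - G a (G b (G r ψ)) =
      (if r = a then (-2 * η r) • G b ψ else 0) - if r = b then (-2 * η r) • G a ψ else 0 := by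
    have h1 := hG r a (G b ψ)
    have h2 := congrArg (G a) (hG r b ψ)
    rw [map_add] at h2
    have h3 : G a (if r = b then (-2 * η r) • ψ else 0) =
        if r = b then (-2 * η r) • G a ψ else 0 := by split_ifs <;> simp
    rw [h3] at h2
    rw [← h1, ← h2]
    abel
  have e : G r (∑ a, ∑ b, (η a * η b * o a b) • G a (G b ψ)) -
      ∑ a, ∑ b, (η a * η b * o a b) • G a (G b (G r ψ)) =
      ∑ a, ∑ b, (η a * η b * o a b) • (G r (G a (G b ψ)) - G a (G b (G r ψ))) := by
    simp only [map_sum, map_smul, smul_sub, Finset.sum_sub_distrib]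
  rw [e]
  simp only [key, smul_sub, Finset.sum_sub_distrib, smul_ite, smul_zero]
  rw [Finset.sum_comm]
  simp only [Finset.sum_ite_eq, Finset.mem_univ, if_true, smul_smul, Finset.smul_sum]
  rw [← Finset.sum_sub_distrib]
  refine Finset.sum_congr rfl fun b _ ↦ ?_
  rw [← sub_smul, ho b r]
  congr 1
  linear_combination (-4 * η b * o r b) * hη r

/-- The spin connection terms cancel in the divergence of the current. -/
theorem clifford_cancellation (hη : ∀ r, η r * η r = 1)
    (hG : ∀ r s φ, G r (G s φ) + G s (G r φ) = if r = s then (-2 * η r) • φ else 0)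
    {B : V →ₗ[ℝ] V →ₗ[ℝ] ℂ} (hB : ∀ r φ ψ, B (G r φ) ψ = B φ (G r ψ))
    {o : Fin n → Fin n → Fin n → ℝ} (ho : ∀ r a b, o r a b = -o r b a)
    {φ ψ : V} {dφ dψ : Fin n → V}
    (hφ : ∑ r, η r • G r (dφ r + (1 / 4 : ℝ) •
      ∑ a, ∑ b, (η a * η b * o r a b) • G a (G b φ)) = 0)
    (hψ : ∑ r, η r • G r (dψ r + (1 / 4 : ℝ) •
      ∑ a, ∑ b, (η a * η b * o r a b) • G a (G b ψ)) = 0) :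
    ∑ r, η r • (B (dφ r) (G r ψ) + B φ (G r (dψ r)) + (∑ s, η s * o s r s) • B φ (G r ψ)) = 0 := by
  have h1 : ∑ r, η r • (B φ (G r (dψ r)) + (1 / 4 : ℝ) •
      B φ (G r (∑ a, ∑ b, (η a * η b * o r a b) • G a (G b ψ)))) = 0 := by
    simpa only [map_sum, map_smul, map_add, map_zero] using congrArg (B φ) hψ
  have h2 : ∑ r, η r • (B (dφ r) (G r ψ) - (1 / 4 : ℝ) •
      B φ (∑ a, ∑ b, (η a * η b * o r a b) • G a (G b (G r ψ)))) = 0 := by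
    have h := congrArg (fun x ↦ B x ψ) hφ
    simp only [map_sum, map_smul, map_zero, LinearMap.zero_apply, LinearMap.sum_apply,
      LinearMap.smul_apply, hB] at h
    rw [← h]
    refine Finset.sum_congr rfl fun r _ ↦ ?_
    rw [map_add, LinearMap.add_apply, sub_eq_add_neg, ← smul_neg, map_smul, LinearMap.smul_apply]
    congr 3
    simp only [map_sum, LinearMap.sum_apply, map_smul, LinearMap.smul_apply, hB]
    rw [Finset.sum_comm, ← Finset.sum_neg_distrib]
    refine Finset.sum_congr rfl fun a _ ↦ ?_
    rw [← Finset.sum_neg_distrib]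
    refine Finset.sum_congr rfl fun b _ ↦ ?_
    rw [← neg_smul, ho r b a]
    congr 1
    ring
  have h3 : ∑ r, η r • ((∑ s, η s * o s r s) • B φ (G r ψ)) =
      ∑ r, η r • (1 / 4 : ℝ) • B φ (G r (∑ a, ∑ b, (η a * η b * o r a b) • G a (G b ψ)) -
      ∑ a, ∑ b, (η a * η b * o r a b) • G a (G b (G r ψ))) := by
    simp only [clifford_commutator hη hG (ho _)]
    simp only [map_smul, map_sum, smul_smul, Finset.smul_sum,
      Finset.sum_smul]
    rw [Finset.sum_comm]
    refine Finset.sum_congr rfl fun s _ ↦ Finset.sum_congr rfl fun r _ ↦ ?_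
    rw [ho s r s]
    congr 1
    ring
  simp only [smul_add, smul_sub, map_sub, Finset.sum_add_distrib, Finset.sum_sub_distrib]
    at h1 h2 h3 ⊢
  rw [h3, ← add_zero (0 : ℂ)]
  nth_rewrite 1 [← h1]
  rw [← h2]
  abel

end CliffordCancellation

theorem minkowskiSign_mul_self {q : ℕ} (r : Fin (q + 1)) :
    minkowskiSign r * minkowskiSign r = 1 := by
  unfold minkowskiSign; split_ifs <;> norm_num

namespace GammaMatrices

variable {q : ℕ} (Γ : GammaMatrices q)

theorem conjTranspose_mul_zero (r : Fin (q + 1)) :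
    (Γ.mat r).conjTranspose * Γ.mat 0 = Γ.mat 0 * Γ.mat r := by
  by_cases h : r = 0
  · rw [h, Γ.conjTranspose_zero]
  · rw [Γ.conjTranspose_of_ne r h, Matrix.neg_mul, neg_eq_iff_add_eq_zero]
    exact Γ.anticomm r 0 h

theorem conjTranspose_slash_mul_zero (v : Fin (q + 1) → ℝ) :
    (Γ.slash v).conjTranspose * Γ.mat 0 = Γ.mat 0 * Γ.slash v := by
  simp only [slash, Fintype.linearCombination_apply, Matrix.conjTranspose_sum,
    Matrix.conjTranspose_smul, Finset.sum_mul, Finset.mul_sum, star_trivial, Matrix.smul_mul,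
    Matrix.mul_smul, conjTranspose_mul_zero]

theorem conjTranspose_rep_mul_zero (a : CliffordAlgebra (negMinkowski q)) :
    (Γ.rep a).conjTranspose * Γ.mat 0 = Γ.mat 0 * Γ.rep (CliffordAlgebra.reverse a) := by
  induction a using CliffordAlgebra.induction with
  | algebraMap r =>
    rw [CliffordAlgebra.reverse.commutes, AlgHom.commutes, Algebra.algebraMap_eq_smul_one,
      Matrix.conjTranspose_smul, Matrix.conjTranspose_one, star_trivial, Matrix.smul_mul,
      Matrix.mul_smul, Matrix.one_mul, Matrix.mul_one]
  | ι v =>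
    rw [CliffordAlgebra.reverse_ι, rep, CliffordAlgebra.lift_ι_apply]
    exact Γ.conjTranspose_slash_mul_zero v
  | mul a b ha hb =>
    rw [CliffordAlgebra.reverse.map_mul, map_mul, map_mul, Matrix.conjTranspose_mul,
      Matrix.mul_assoc, ha, ← Matrix.mul_assoc, hb, Matrix.mul_assoc]
  | add a b ha hb =>
    rw [map_add, map_add, map_add, Matrix.conjTranspose_add, Matrix.add_mul, Matrix.mul_add, ha, hb]

/-- The Dirac form is invariant under the spin group. -/
theorem conjTranspose_mul_zero_mul_of_mem_spinGroup {a : CliffordAlgebra (negMinkowski q)}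
    (ha : a ∈ spinGroup (negMinkowski q)) :
    (Γ.rep a).conjTranspose * Γ.mat 0 * Γ.rep a = Γ.mat 0 := by
  have h1 : star a * a = 1 := pinGroup.star_mul_self_of_mem (spinGroup.mem_pin ha)
  rw [CliffordAlgebra.star_def, spinGroup.involute_eq ha] at h1
  rw [conjTranspose_rep_mul_zero, Matrix.mul_assoc, ← map_mul, h1, map_one, Matrix.mul_one]

/-- The Dirac form `(φ, ψ) ↦ φ† Γ₀ ψ`. -/
def diracForm : (Fin (2 ^ ((q + 1) / 2)) → ℂ) →ₗ[ℝ] (Fin (2 ^ ((q + 1) / 2)) → ℂ) →ₗ[ℝ] ℂ :=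
  LinearMap.mk₂ ℝ (fun φ ψ ↦ star φ ⬝ᵥ (Γ.mat 0).mulVec ψ)
    (fun φ φ' ψ ↦ by rw [star_add, add_dotProduct])
    (fun c φ ψ ↦ by rw [star_smul, star_trivial, smul_dotProduct])
    (fun φ ψ ψ' ↦ by rw [Matrix.mulVec_add, dotProduct_add])
    (fun c φ ψ ↦ by rw [Matrix.mulVec_smul, dotProduct_smul])

theorem diracForm_apply (φ ψ : Fin (2 ^ ((q + 1) / 2)) → ℂ) :
    Γ.diracForm φ ψ = star φ ⬝ᵥ (Γ.mat 0).mulVec ψ := rfl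

theorem diracForm_mulVec_mulVec {A : Matrix (Fin (2 ^ ((q + 1) / 2))) (Fin (2 ^ ((q + 1) / 2))) ℂ}
    (φ ψ : Fin (2 ^ ((q + 1) / 2)) → ℂ) :
    Γ.diracForm (A.mulVec φ) ψ = star φ ⬝ᵥ (A.conjTranspose * Γ.mat 0).mulVec ψ := by
  rw [diracForm_apply, Matrix.star_mulVec, ← Matrix.dotProduct_mulVec, Matrix.mulVec_mulVec]

/-- Clifford multiplication by a frame vector. -/
def gammaMul (r : Fin (q + 1)) :
    (Fin (2 ^ ((q + 1) / 2)) → ℂ) →ₗ[ℝ] (Fin (2 ^ ((q + 1) / 2)) → ℂ) :=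
  (Γ.mat r).mulVecLin.restrictScalars ℝ

theorem gammaMul_apply (r : Fin (q + 1)) (ψ : Fin (2 ^ ((q + 1) / 2)) → ℂ) :
    Γ.gammaMul r ψ = (Γ.mat r).mulVec ψ := rfl

theorem diracForm_gammaMul (r : Fin (q + 1)) (φ ψ : Fin (2 ^ ((q + 1) / 2)) → ℂ) :
    Γ.diracForm (Γ.gammaMul r φ) ψ = Γ.diracForm φ (Γ.gammaMul r ψ) := by
  rw [gammaMul_apply, diracForm_mulVec_mulVec, conjTranspose_mul_zero, diracForm_apply,
    gammaMul_apply, Matrix.mulVec_mulVec]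

theorem gammaMul_anticomm (r s : Fin (q + 1)) (φ : Fin (2 ^ ((q + 1) / 2)) → ℂ) :
    Γ.gammaMul r (Γ.gammaMul s φ) + Γ.gammaMul s (Γ.gammaMul r φ) =
      if r = s then (-2 * minkowskiSign r) • φ else 0 := by
  simp only [gammaMul_apply, Matrix.mulVec_mulVec, ← Matrix.add_mulVec]
  split_ifs with h
  · subst h
    rw [Γ.sq, ← add_smul, Matrix.smul_mulVec, Matrix.one_mulVec]
    congr 1
    ring
  · rw [Γ.anticomm r s h, Matrix.zero_mulVec]

end GammaMatrices

/-! ### The current of two spinors -/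

section Current

variable {E : Type*} [NormedAddCommGroup E] [NormedSpace ℝ E]
  {H : Type*} [TopologicalSpace H] {I : ModelWithCorners ℝ E H}
  {N : Type*} [TopologicalSpace N] [ChartedSpace H N] [IsManifold I ∞ N]

/-- A real part of a complexified vector field, with respect to a linear form on `ℂ`. -/
def partField (ℓ : ℂ →ₗ[ℝ] ℝ) (J : (p : N) → ℂ ⊗[ℝ] TangentSpace I p) (p : N) :
    TangentSpace I p :=
  TensorProduct.lid ℝ (TangentSpace I p) (ℓ.rTensor (TangentSpace I p) (J p))

variable {q : ℕ} {Γ : GammaMatrices q} {g : PseudoRiemannianMetric I N} {ι : Type*}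

theorem GammaMatrices.slash_mulVec (Γ : GammaMatrices q) (c : Fin (q + 1) → ℝ)
    (ψ : Fin (2 ^ ((q + 1) / 2)) → ℂ) :
    (Γ.slash c).mulVec ψ = ∑ r, c r • Γ.gammaMul r ψ := by
  simp only [slash, Fintype.linearCombination_apply, Matrix.sum_mulVec, Matrix.smul_mulVec,
    gammaMul_apply]

namespace Spinor

variable {S : SpinStructure Γ g ι} (Φ Ψ : Spinor S)

/-- The component `⟨Φ, u_r · Ψ⟩` of the current in the frame `i`. -/
def frameCurrent (i : ι) (r : Fin (q + 1)) (p : N) : ℂ :=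
  Γ.diracForm (Φ.val i p) (Γ.gammaMul r (Ψ.val i p))

/-- Clifford pairings can be computed in any frame. -/
theorem cliffordPairing_eq_diracForm {i : ι} {p : N} (hp : p ∈ S.dom i) (v : TangentSpace I p) :
    Φ.cliffordPairing Ψ p v =
      Γ.diracForm (Φ.val i p) ((Γ.slash (frameComponents g (S.frame i) p v)).mulVec (Ψ.val i p)) := by
  have hj := S.mem_indexAt p
  set j := S.indexAt p with hjdef
  obtain ⟨a, ha, hT⟩ := S.trans_mem i j p hp hj
  have h1 : Φ.cliffordPairing Ψ p v = Γ.diracForm (Φ.val j p)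
      ((Γ.slash (frameComponents g (S.frame j) p v)).mulVec (Ψ.val j p)) := by
    rw [GammaMatrices.diracForm_apply, Matrix.dotProduct_mulVec, ← Γ.conjTranspose_zero,
      ← Matrix.star_mulVec]
    rfl
  rw [h1, Φ.compat i j p hp hj, Ψ.compat i j p hp hj, Matrix.mulVec_mulVec, S.covering i j p hp hj,
    GammaMatrices.diracForm_mulVec_mulVec, ← hT, ← Matrix.mulVec_mulVec (M := Γ.rep a),
    Matrix.mulVec_mulVec (M := _ * Γ.mat 0), Γ.conjTranspose_mul_zero_mul_of_mem_spinGroup ha,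
    GammaMatrices.diracForm_apply]

theorem cliffordPairing_eq {i : ι} {p : N} (hp : p ∈ S.dom i) (v : TangentSpace I p) :
    Φ.cliffordPairing Ψ p v =
      ∑ r, (minkowskiSign r * g.inner p v (S.frame i r p)) • Φ.frameCurrent Ψ i r p := by
  rw [cliffordPairing_eq_diracForm Φ Ψ hp, GammaMatrices.slash_mulVec, map_sum]
  simp only [map_smul]
  rfl

theorem cliffordPairing_frame {i : ι} {p : N} (hp : p ∈ S.dom i) (r : Fin (q + 1)) :
    Φ.cliffordPairing Ψ p (S.frame i r p) = Φ.frameCurrent Ψ i r p := by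
  rw [cliffordPairing_eq Φ Ψ hp]
  simp only [S.orthonormal i p hp, mul_ite, mul_zero, ite_smul, zero_smul, Finset.sum_ite_eq,
    Finset.mem_univ, if_true, minkowskiSign_mul_self, one_smul]

theorem inner_frameSum {i : ι} {p : N} (hp : p ∈ S.dom i) (ℓ : ℂ →ₗ[ℝ] ℝ) (v : TangentSpace I p) :
    g.inner p (∑ r, (minkowskiSign r * ℓ (Φ.frameCurrent Ψ i r p)) • S.frame i r p) v =
      ℓ (Φ.cliffordPairing Ψ p v) := by
  rw [cliffordPairing_eq Φ Ψ hp]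
  simp only [map_sum, map_smul, sum_apply, smul_apply, smul_eq_mul]
  refine Finset.sum_congr rfl fun r _ ↦ ?_
  rw [g.symm p v]
  ring

theorem partField_current_indexAt (ℓ : ℂ →ₗ[ℝ] ℝ) (p : N) :
    partField ℓ (Φ.current Ψ) p =
      ∑ r, (minkowskiSign r * ℓ (Φ.frameCurrent Ψ (S.indexAt p) r p)) •
        S.frame (S.indexAt p) r p := by
  have h (r : Fin (q + 1)) : (minkowskiSign r : ℂ) * Φ.frameCurrent Ψ (S.indexAt p) r p =
      minkowskiSign r • Φ.frameCurrent Ψ (S.indexAt p) r p := (Complex.real_smul).symm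
  simp only [partField, current, map_sum, LinearMap.rTensor_tmul, TensorProduct.lid_tmul,
    cliffordPairing_frame Φ Ψ (S.mem_indexAt p), h, map_smul, smul_eq_mul]

/-- The current is dual to the Clifford pairing. -/
theorem inner_partField_current (ℓ : ℂ →ₗ[ℝ] ℝ) (p : N) (v : TangentSpace I p) :
    g.inner p (partField ℓ (Φ.current Ψ) p) v = ℓ (Φ.cliffordPairing Ψ p v) := by
  rw [partField_current_indexAt]
  exact inner_frameSum Φ Ψ (S.mem_indexAt p) ℓ v

theorem partField_current_eq {i : ι} {p : N} (hp : p ∈ S.dom i) (ℓ : ℂ →ₗ[ℝ] ℝ) :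
    partField ℓ (Φ.current Ψ) p =
      ∑ r, (minkowskiSign r * ℓ (Φ.frameCurrent Ψ i r p)) • S.frame i r p := by
  rw [← sub_eq_zero]
  refine g.nondegenerate p _ fun v ↦ ?_
  rw [map_sub, sub_apply, inner_partField_current, inner_frameSum Φ Ψ hp, sub_self]

/-- The bilinear form `(φ, ψ) ↦ ⟨φ, u_r · ψ⟩` on spinors. -/
def pairingForm (Γ : GammaMatrices q) (r : Fin (q + 1)) :
    (Fin (2 ^ ((q + 1) / 2)) → ℂ) →L[ℝ] (Fin (2 ^ ((q + 1) / 2)) → ℂ) →L[ℝ] ℂ :=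
  (Γ.diracForm.compl₂ (Γ.gammaMul r)).toContinuousBilinearMap

theorem contMDiffAt_val (i : ι) {p : N} (hp : p ∈ S.dom i) :
    ContMDiffAt I 𝓘(ℝ, Fin (2 ^ ((q + 1) / 2)) → ℂ) ∞ (Φ.val i) p :=
  (Φ.smooth i).contMDiffAt ((S.isOpen_dom i).mem_nhds hp)

theorem contMDiffAt_frameCurrent {i : ι} {p : N} (hp : p ∈ S.dom i) (r : Fin (q + 1)) :
    ContMDiffAt I 𝓘(ℝ, ℂ) ∞ (Φ.frameCurrent Ψ i r) p :=
  ContMDiffAt.clm_apply (((pairingForm Γ r).contDiff.contMDiff.contMDiffAt).comp p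
    (Φ.contMDiffAt_val i hp)) (Ψ.contMDiffAt_val i hp)

theorem smoothVectorFieldAt_frame (S : SpinStructure Γ g ι) {i : ι} {p : N} (hp : p ∈ S.dom i)
    (r : Fin (q + 1)) : SmoothVectorFieldAt (S.frame i r) p :=
  ContMDiffOn.contMDiffAt (S.smooth_frame i r) ((S.isOpen_dom i).mem_nhds hp)

theorem contMDiffAt_coefficient {i : ι} {p : N} (hp : p ∈ S.dom i) (ℓ : ℂ →ₗ[ℝ] ℝ)
    (r : Fin (q + 1)) :
    ContMDiffAt I 𝓘(ℝ) ∞ (fun p ↦ minkowskiSign r * ℓ (Φ.frameCurrent Ψ i r p)) p :=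
  contMDiffAt_const.mul ((LinearMap.toContinuousLinearMap ℓ).contDiff.contMDiff.contMDiffAt.comp p
    (contMDiffAt_frameCurrent Φ Ψ hp r))

theorem partField_current_eventuallyEq {i : ι} {p : N} (hp : p ∈ S.dom i) (ℓ : ℂ →ₗ[ℝ] ℝ) :
    ∀ᶠ y in nhds p, partField ℓ (Φ.current Ψ) y =
      ∑ r, (minkowskiSign r * ℓ (Φ.frameCurrent Ψ i r y)) • S.frame i r y := by
  filter_upwards [(S.isOpen_dom i).mem_nhds hp] with y hy
  exact partField_current_eq Φ Ψ hy ℓ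

theorem smooth_partField_current (ℓ : ℂ →ₗ[ℝ] ℝ) (p : N) :
    SmoothVectorFieldAt (partField ℓ (Φ.current Ψ)) p := by
  have hp := S.mem_indexAt p
  exact (SmoothVectorFieldAt.sum fun r _ ↦ (contMDiffAt_coefficient Φ Ψ hp ℓ r).smul_section
    (smoothVectorFieldAt_frame S hp r)).congr_of_eventuallyEq
      (partField_current_eventuallyEq Φ Ψ hp ℓ)

end Spinor

/-! ### Conservation of the current -/

section Conservation

variable [FiniteDimensional ℝ E] [I.Boundaryless]

omit [IsManifold I ∞ N] [FiniteDimensional ℝ E] [I.Boundaryless] in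
theorem chartDeriv_congr {F : Type*} [NormedAddCommGroup F] [NormedSpace ℝ F] {f f' : N → F} {p : N}
    (h : ∀ᶠ y in nhds p, f y = f' y) :
    chartDeriv (I := I) f p = chartDeriv (I := I) f' p := by
  refine Filter.EventuallyEq.fderiv_eq ?_
  have h1 : {y | f y = f' y} ∈ nhds ((extChartAt I p).symm (extChartAt I p p)) := by
    rwa [extChartAt_to_inv]
  exact (continuousAt_extChartAt_symm p).preimage_mem_nhds h1

namespace SpinStructure

variable (S : SpinStructure Γ g ι) {i : ι} {p : N}

/-- The connection coefficient `g(∇_{u_r} u_a, u_b)`. -/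
def connectionCoeff (i : ι) (p : N) (r a b : Fin (q + 1)) : ℝ :=
  g.inner p (leviCivita g.inner (S.frame i a) p (S.frame i r p)) (S.frame i b p)

theorem connectionCoeff_antisymm (hp : p ∈ S.dom i) (r a b : Fin (q + 1)) :
    S.connectionCoeff i p r a b = -S.connectionCoeff i p r b a := by
  have h := g.chartDeriv_inner (Spinor.smoothVectorFieldAt_frame S hp a)
    (Spinor.smoothVectorFieldAt_frame S hp b) (S.frame i r p)
  have h0 : chartDeriv (I := I) (fun q ↦ g.inner q (S.frame i a q) (S.frame i b q)) p = 0 := by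
    rw [chartDeriv_congr (f' := fun _ ↦ if a = b then minkowskiSign a else 0)]
    · exact fderiv_const_apply _
    · filter_upwards [(S.isOpen_dom i).mem_nhds hp] with y hy
      exact S.orthonormal i y hy a b
  have h1 := (DFunLike.congr_fun h0 (S.frame i r p)).symm.trans h
  have h2 : S.connectionCoeff i p r b a =
      g.form p (S.frame i a p) (g.covDerivLinear (S.frame i b) p (S.frame i r p)) :=
    g.symm p _ _
  rw [h2]
  exact eq_neg_of_add_eq_zero_left h1.symm

omit [FiniteDimensional ℝ E] [I.Boundaryless] in
/-- Traces can be computed in orthonormal frames. -/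
theorem trace_eq (hdim : Module.finrank ℝ E = q + 1) (hp : p ∈ S.dom i) (L : E →ₗ[ℝ] E) :
    LinearMap.trace ℝ E L =
      ∑ s, minkowskiSign s * g.form p (L (S.frame i s p)) (S.frame i s p) := by
  let u (r : Fin (q + 1)) : E := S.frame i r p
  have hu (r s : Fin (q + 1)) : g.form p (u r) (u s) = if r = s then minkowskiSign r else 0 :=
    S.orthonormal i p hp r s
  have hc (c : Fin (q + 1) → ℝ) (s : Fin (q + 1)) :
      minkowskiSign s * g.form p (∑ r, c r • u r) (u s) = c s := by
    simp only [map_sum, map_smul, sum_apply, smul_apply, hu, smul_eq_mul, mul_ite, mul_zero,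
      Finset.sum_ite_eq', Finset.mem_univ, if_true]
    linear_combination c s * minkowskiSign_mul_self s
  have hli : LinearIndependent ℝ u := by
    rw [Fintype.linearIndependent_iff]
    intro c h0 s
    rw [← hc c s, h0, map_zero, zero_apply, mul_zero]
  let b := basisOfLinearIndependentOfCardEqFinrank hli (by simp [hdim])
  have hb (r) : b r = u r := by simp [b]
  rw [LinearMap.trace_eq_matrix_trace ℝ b, Matrix.trace]
  refine Finset.sum_congr rfl fun s _ ↦ ?_
  rw [Matrix.diag_apply, LinearMap.toMatrix_apply, ← hc (b.repr (L (b s))) s]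
  simp only [← hb]
  rw [b.sum_repr, hb]

theorem divergence_frame (hdim : Module.finrank ℝ E = q + 1) (hp : p ∈ S.dom i)
    (r : Fin (q + 1)) :
    divergence g.inner (S.frame i r) p = ∑ s, minkowskiSign s * S.connectionCoeff i p s r s := by
  rw [g.divergence_eq_trace, S.trace_eq hdim hp]
  rfl

end SpinStructure

namespace Spinor

variable {S : SpinStructure Γ g ι} (Φ Ψ : Spinor S) {i : ι} {p : N}

omit [FiniteDimensional ℝ E] in
theorem chartDeriv_frameCurrent (hp : p ∈ S.dom i) (r : Fin (q + 1)) (v : E) :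
    chartDeriv (I := I) (Φ.frameCurrent Ψ i r) p v =
      Γ.diracForm (chartDeriv (I := I) (Φ.val i) p v) (Γ.gammaMul r (Ψ.val i p)) +
      Γ.diracForm (Φ.val i p) (Γ.gammaMul r (chartDeriv (I := I) (Ψ.val i) p v)) := by
  have hd (Θ : Spinor S) := (((Θ.contMDiffAt_val i hp).contDiffAt_comp_extChartAt_symm
    (mem_extChartAt_source (I := I) p)).differentiableAt (by simp)).hasFDerivAt
  have h := ((pairingForm Γ r).hasFDerivAt_of_bilinear (hd Φ) (hd Ψ)).fderiv
  refine (DFunLike.congr_fun h v).trans ?_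
  rw [add_comm]
  simp only [extChartAt_to_inv]
  rfl

theorem dirac_eq (hp : p ∈ S.dom i) : Ψ.dirac i p =
    ∑ r, minkowskiSign r • Γ.gammaMul r (chartDeriv (I := I) (Ψ.val i) p (S.frame i r p) +
      (1 / 4 : ℝ) • ∑ a, ∑ b, (minkowskiSign a * minkowskiSign b * S.connectionCoeff i p r a b) •
        Γ.gammaMul a (Γ.gammaMul b (Ψ.val i p))) := by
  refine Finset.sum_congr rfl fun r _ ↦ ?_
  rw [GammaMatrices.gammaMul_apply]
  congr 2
  rw [covDeriv]
  refine congrArg₂ (· + ·) (mfderiv_eq_chartDeriv (Ψ.contMDiffAt_val i hp) _) ?_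
  simp only [GammaMatrices.gammaMul_apply, Matrix.mulVec_mulVec]
  rfl

/-- The current of two harmonic spinors is conserved. -/
theorem divergence_partField_current (hdim : Module.finrank ℝ E = q + 1) (hΦ : Φ.InKerDirac)
    (hΨ : Ψ.InKerDirac) (ℓ : ℂ →ₗ[ℝ] ℝ) (p : N) :
    divergence g.inner (partField ℓ (Φ.current Ψ)) p = 0 := by
  have hp := S.mem_indexAt p
  set i := S.indexAt p
  have hc := fun r ↦ contMDiffAt_coefficient Φ Ψ hp ℓ r
  have hu := fun r ↦ smoothVectorFieldAt_frame S hp r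
  rw [g.divergence_congr (partField_current_eventuallyEq Φ Ψ hp ℓ),
    g.divergence_sum Finset.univ fun r _ ↦ (hu r).smul (hc r)]
  have key := clifford_cancellation (o := S.connectionCoeff i p) minkowskiSign_mul_self
    Γ.gammaMul_anticomm Γ.diracForm_gammaMul (S.connectionCoeff_antisymm hp)
    ((Φ.dirac_eq hp).symm.trans (hΦ i p hp)) ((Ψ.dirac_eq hp).symm.trans (hΨ i p hp))
  rw [← map_zero ℓ, ← key, map_sum]
  refine Finset.sum_congr rfl fun r _ ↦ ?_
  rw [g.divergence_smul (hc r) (hu r), S.divergence_frame hdim hp]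
  have hd : chartDeriv (I := I) (fun p ↦ minkowskiSign r * ℓ (Φ.frameCurrent Ψ i r p)) p
      (S.frame i r p) = minkowskiSign r *
        ℓ (Γ.diracForm (chartDeriv (I := I) (Φ.val i) p (S.frame i r p))
            (Γ.gammaMul r (Ψ.val i p)) + Γ.diracForm (Φ.val i p)
            (Γ.gammaMul r (chartDeriv (I := I) (Ψ.val i) p (S.frame i r p)))) := by
    have h1 := (((contMDiffAt_frameCurrent Φ Ψ hp r).contDiffAt_comp_extChartAt_symm
      (mem_extChartAt_source (I := I) p)).differentiableAt (by simp)).hasFDerivAt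
    have h2 := (((LinearMap.toContinuousLinearMap ℓ).hasFDerivAt.comp _ h1).const_mul
      (minkowskiSign r)).fderiv
    exact (DFunLike.congr_fun h2 _).trans (congrArg (fun t ↦ minkowskiSign r * ℓ t)
      (chartDeriv_frameCurrent Φ Ψ hp r _))
  rw [hd]
  simp only [map_smul, map_add, smul_eq_mul]
  change _ + minkowskiSign r * ℓ (Γ.diracForm (Φ.val i p) (Γ.gammaMul r (Ψ.val i p))) * _ = _
  ring

end Spinor
end Conservation
end Current

/-! ### The base current -/

section BaseCurrentDivergence

theorem complex_tmul_ext {T : Type*} [AddCommGroup T] [Module ℝ T] {J J' : ℂ ⊗[ℝ] T}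
    (hre : TensorProduct.lid ℝ T (Complex.reLm.rTensor T J) =
      TensorProduct.lid ℝ T (Complex.reLm.rTensor T J'))
    (him : TensorProduct.lid ℝ T (Complex.imLm.rTensor T J) =
      TensorProduct.lid ℝ T (Complex.imLm.rTensor T J')) : J = J' := by
  have h (J : ℂ ⊗[ℝ] T) : J = (1 : ℂ) ⊗ₜ[ℝ] TensorProduct.lid ℝ T (Complex.reLm.rTensor T J) +
      Complex.I ⊗ₜ[ℝ] TensorProduct.lid ℝ T (Complex.imLm.rTensor T J) := by
    induction J using TensorProduct.induction_on with
    | zero => simp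
    | tmul c v =>
      simp only [LinearMap.rTensor_tmul, TensorProduct.lid_tmul, Complex.reLm_coe, Complex.imLm_coe]
      rw [← TensorProduct.smul_tmul, ← TensorProduct.smul_tmul, ← TensorProduct.add_tmul]
      congr 1
      apply Complex.ext <;> simp
    | add x y hx hy =>
      nth_rewrite 1 [hx, hy]
      simp only [map_add, TensorProduct.tmul_add]
      abel
  rw [h J, h J', hre, him]

theorem FibrewiseRelativelyCompact.mono {M K : Type*} [TopologicalSpace M] [TopologicalSpace K]
    {S S' : Set (M × K)} (h : FibrewiseRelativelyCompact S) (hS : S' ⊆ S) :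
    FibrewiseRelativelyCompact S' := by
  intro C hC
  have h1 := (h C hC).inter_left (isClosed_closure (s := S'))
  rwa [← Set.inter_assoc, Set.inter_eq_left.2 (closure_mono hS)] at h1

variable {m k : ℕ}
  {M : Type*} [TopologicalSpace M] [ChartedSpace (EuclideanSpace ℝ (Fin m)) M]
  [IsManifold (𝓡 m) ∞ M]
  {K : Type*} [TopologicalSpace K] [ChartedSpace (EuclideanSpace ℝ (Fin k)) K]
  [IsManifold (𝓡 k) ∞ K] [T2Space K] [SecondCountableTopology K] [MeasurableSpace K] [BorelSpace K]
  {q : ℕ} {Γ : GammaMatrices q} {ι : Type*}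

namespace SubmersiveMetric

variable {G : SubmersiveMetric m k M K} {S : SpinStructure Γ G.gP ι} {Φ Ψ : Spinor S}

omit [T2Space K] [SecondCountableTopology K] [MeasurableSpace K] [BorelSpace K] in
theorem fibrewiseRelativelyCompact_partField
    (h : FibrewiseRelativelyCompact {p : M × K | Φ.current Ψ p ≠ 0}) (ℓ : ℂ →ₗ[ℝ] ℝ) :
    FibrewiseRelativelyCompact {p : M × K | partField ℓ (Φ.current Ψ) p ≠ 0} := by
  refine h.mono fun p hp h0 ↦ hp ?_
  rw [partField, h0, map_zero, map_zero]

theorem partField_spec (h : FibrewiseRelativelyCompact {p : M × K | Φ.current Ψ p ≠ 0})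
    (ℓ : ℂ →ₗ[ℝ] ℝ) (x : M) :
    Integrable (baseComponent (partField ℓ (Φ.current Ψ)) x) (G.fibreVolume x) ∧
    SmoothVectorFieldAt (G.fibreAverage (partField ℓ (Φ.current Ψ))) x ∧
    Integrable (fun y ↦ divergence G.gP.inner (partField ℓ (Φ.current Ψ)) (x, y))
      (G.fibreVolume x) ∧
    ∫ y, divergence G.gP.inner (partField ℓ (Φ.current Ψ)) (x, y) ∂(G.fibreVolume x) =
      divergence G.gM.inner (G.fibreAverage (partField ℓ (Φ.current Ψ))) x :=
  G.fibreAverage_spec (Φ.smooth_partField_current Ψ ℓ) (fibrewiseRelativelyCompact_partField h ℓ) x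

theorem integrable_cliffordPairing
    (h : FibrewiseRelativelyCompact {p : M × K | Φ.current Ψ p ≠ 0}) (x : M)
    (X : TangentSpace (𝓡 m) x) :
    Integrable (fun y ↦ Φ.cliffordPairing Ψ (x, y) (G.horizontalLift (x, y) X))
      (G.fibreVolume x) := by
  have hℓ (ℓ : ℂ →ₗ[ℝ] ℝ) :
      Integrable (fun y ↦ ℓ (Φ.cliffordPairing Ψ (x, y) (G.horizontalLift (x, y) X)))
        (G.fibreVolume x) := by
    have h1 := G.integrable_inner_horizontalLift (partField_spec h ℓ x).1 X
    simpa only [Spinor.inner_partField_current Φ Ψ] using h1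
  have h2 := (hℓ Complex.reLm).ofReal (𝕜 := ℂ) |>.add
    (((hℓ Complex.imLm).ofReal (𝕜 := ℂ)).mul_const Complex.I)
  refine h2.congr (.of_forall fun y ↦ ?_)
  exact Complex.re_add_im _

/-- The real parts of the base current are the fibre averages of those of the current. -/
theorem lid_rTensor_baseCurrentIn
    (h : FibrewiseRelativelyCompact {p : M × K | Φ.current Ψ p ≠ 0}) (ℓ : ℂ →ₗ[ℝ] ℝ) (x : M)
    {κ : Type*} [Fintype κ] [DecidableEq κ] (X : Module.Basis κ ℝ (TangentSpace (𝓡 m) x)) :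
    TensorProduct.lid ℝ (TangentSpace (𝓡 m) x)
      (ℓ.rTensor (TangentSpace (𝓡 m) x) (G.baseCurrentIn Φ Ψ x X)) =
      G.fibreAverage (partField ℓ (Φ.current Ψ)) x := by
  rw [← G.fibreProjectionIn_eq (partField_spec h ℓ x).1 X, fibreProjectionIn, baseCurrentIn]
  simp only [map_sum, LinearMap.rTensor_tmul, TensorProduct.lid_tmul]
  refine Finset.sum_congr rfl fun μ _ ↦ Finset.sum_congr rfl fun ν _ ↦ ?_
  congr 1
  rw [← Complex.real_smul, map_smul, smul_eq_mul]
  congr 1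
  refine ((LinearMap.toContinuousLinearMap ℓ).integral_comp_comm
    (integrable_cliffordPairing h x (X μ))).symm.trans ?_
  refine integral_congr_ae (.of_forall fun y ↦ ?_)
  exact (Spinor.inner_partField_current Φ Ψ ℓ (x, y) _).symm

theorem partField_baseCurrent
    (h : FibrewiseRelativelyCompact {p : M × K | Φ.current Ψ p ≠ 0}) (ℓ : ℂ →ₗ[ℝ] ℝ) :
    partField ℓ (G.baseCurrent Φ Ψ) = G.fibreAverage (partField ℓ (Φ.current Ψ)) :=
  funext fun x ↦ lid_rTensor_baseCurrentIn h ℓ x _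

theorem reField_baseCurrent (h : FibrewiseRelativelyCompact {p : M × K | Φ.current Ψ p ≠ 0}) :
    reField (G.baseCurrent Φ Ψ) = G.fibreAverage (partField Complex.reLm (Φ.current Ψ)) :=
  partField_baseCurrent h Complex.reLm

theorem imField_baseCurrent (h : FibrewiseRelativelyCompact {p : M × K | Φ.current Ψ p ≠ 0}) :
    imField (G.baseCurrent Φ Ψ) = G.fibreAverage (partField Complex.imLm (Φ.current Ψ)) :=
  partField_baseCurrent h Complex.imLm

theorem baseCurrent_eq (h : FibrewiseRelativelyCompact {p : M × K | Φ.current Ψ p ≠ 0}) (x : M)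
    {κ : Type*} [Fintype κ] [DecidableEq κ] (X : Module.Basis κ ℝ (TangentSpace (𝓡 m) x)) :
    G.baseCurrent Φ Ψ x = G.baseCurrentIn Φ Ψ x X :=
  complex_tmul_ext
    ((lid_rTensor_baseCurrentIn h Complex.reLm x _).trans
      (lid_rTensor_baseCurrentIn h Complex.reLm x X).symm)
    ((lid_rTensor_baseCurrentIn h Complex.imLm x _).trans
      (lid_rTensor_baseCurrentIn h Complex.imLm x X).symm)

theorem integrable_complexDivergence
    (h : FibrewiseRelativelyCompact {p : M × K | Φ.current Ψ p ≠ 0}) (x : M) :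
    Integrable (fun y ↦ complexDivergence G.gP.inner (Φ.current Ψ) (x, y)) (G.fibreVolume x) :=
  ((partField_spec h Complex.reLm x).2.2.1.ofReal (𝕜 := ℂ)).add
    (((partField_spec h Complex.imLm x).2.2.1.ofReal (𝕜 := ℂ)).const_mul Complex.I)

/-- Fibre integration of the divergence of the current. -/
theorem complexDivergence_baseCurrent
    (h : FibrewiseRelativelyCompact {p : M × K | Φ.current Ψ p ≠ 0}) (x : M) :
    complexDivergence G.gM.inner (G.baseCurrent Φ Ψ) x =
      ∫ y, complexDivergence G.gP.inner (Φ.current Ψ) (x, y) ∂(G.fibreVolume x) := by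
  have hre := partField_spec h Complex.reLm x
  have him := partField_spec h Complex.imLm x
  have h1 := integral_add (hre.2.2.1.ofReal (𝕜 := ℂ))
    ((him.2.2.1.ofReal (𝕜 := ℂ)).const_mul Complex.I)
  refine Eq.trans ?_ h1.symm
  rw [integral_const_mul, integral_ofReal, integral_ofReal, hre.2.2.2, him.2.2.2, complexDivergence,
    reField_baseCurrent h, imField_baseCurrent h]
  rfl

end SubmersiveMetric
end BaseCurrentDivergence

end

/-- Divergence of fibre-averaged vector fields for a submersive metric, and of the base current of
two spinors. -/
theorem mainTheorem9 {m k : ℕ}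
    {M : Type*} [TopologicalSpace M] [T2Space M] [SecondCountableTopology M]
    [ChartedSpace (EuclideanSpace ℝ (Fin m)) M] [IsManifold (𝓡 m) ∞ M]
    {K : Type*} [TopologicalSpace K] [T2Space K] [SecondCountableTopology K]
    [ChartedSpace (EuclideanSpace ℝ (Fin k)) K] [IsManifold (𝓡 k) ∞ K]
    [MeasurableSpace K] [BorelSpace K]
    (G : SubmersiveMetric m k M K) :
    (∀ W : (p : M × K) → TangentSpace ((𝓡 m).prod (𝓡 k)) p,
      SmoothVectorFieldOn ((𝓡 m).prod (𝓡 k)) W Set.univ →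
      FibrewiseRelativelyCompact {p : M × K | W p ≠ 0} →
      SmoothVectorFieldOn (𝓡 m) (G.fibreProjection W) Set.univ ∧
      ∀ x : M,
        (∀ X : Module.Basis (Fin m) ℝ (TangentSpace (𝓡 m) x),
          (∀ μ, Integrable (fun y ↦ G.gP.inner (x, y) (W (x, y)) (G.horizontalLift (x, y) (X μ)))
            (G.fibreVolume x)) ∧
          G.fibreProjection W x = G.fibreProjectionIn W x X) ∧
        Integrable (fun y ↦ divergence G.gP.inner W (x, y)) (G.fibreVolume x) ∧
        ∫ y, divergence G.gP.inner W (x, y) ∂(G.fibreVolume x) =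
          divergence G.gM.inner (G.fibreProjection W) x) ∧
    (∀ {q : ℕ} (_ : q + 1 = m + k) (Γ : GammaMatrices q) {ι : Type*}
      (S : SpinStructure Γ G.gP ι) (Φ Ψ : Spinor S),
      FibrewiseRelativelyCompact {p : M × K | Φ.current Ψ p ≠ 0} →
      (SmoothVectorFieldOn (𝓡 m) (reField (G.baseCurrent Φ Ψ)) Set.univ ∧
        SmoothVectorFieldOn (𝓡 m) (imField (G.baseCurrent Φ Ψ)) Set.univ) ∧
      (∀ x : M,
        (∀ X : Module.Basis (Fin m) ℝ (TangentSpace (𝓡 m) x),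
          (∀ μ, Integrable
            (fun y ↦ Φ.cliffordPairing Ψ (x, y) (G.horizontalLift (x, y) (X μ)))
            (G.fibreVolume x)) ∧
          G.baseCurrent Φ Ψ x = G.baseCurrentIn Φ Ψ x X) ∧
        Integrable (fun y ↦ complexDivergence G.gP.inner (Φ.current Ψ) (x, y))
          (G.fibreVolume x) ∧
        complexDivergence G.gM.inner (G.baseCurrent Φ Ψ) x =
          ∫ y, complexDivergence G.gP.inner (Φ.current Ψ) (x, y) ∂(G.fibreVolume x)) ∧
      (Φ.InKerDirac → Ψ.InKerDirac →
        ∀ x : M, complexDivergence G.gM.inner (G.baseCurrent Φ Ψ) x = 0)) := by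
  refine ⟨fun W hW hS ↦ G.fibreProjection_spec hW hS, ?_⟩
  intro q hq Γ ι S Φ Ψ h
  refine ⟨⟨?_, ?_⟩, fun x ↦ ⟨fun X ↦ ⟨fun μ ↦ SubmersiveMetric.integrable_cliffordPairing h x (X μ),
    SubmersiveMetric.baseCurrent_eq h x X⟩, SubmersiveMetric.integrable_complexDivergence h x,
    SubmersiveMetric.complexDivergence_baseCurrent h x⟩, fun hΦ hΨ x ↦ ?_⟩
  · rw [smoothVectorFieldOn_univ_iff, SubmersiveMetric.reField_baseCurrent h]
    exact fun x ↦ (SubmersiveMetric.partField_spec h Complex.reLm x).2.1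
  · rw [smoothVectorFieldOn_univ_iff, SubmersiveMetric.imField_baseCurrent h]
    exact fun x ↦ (SubmersiveMetric.partField_spec h Complex.imLm x).2.1
  · have hdim : Module.finrank ℝ (EuclideanSpace ℝ (Fin m) × EuclideanSpace ℝ (Fin k)) = q + 1 := by
      rw [Module.finrank_prod, finrank_euclideanSpace_fin, finrank_euclideanSpace_fin, hq]
    have h0 (y : K) : complexDivergence G.gP.inner (Φ.current Ψ) (x, y) = 0 := by
      have hre : divergence G.gP.inner (reField (Φ.current Ψ)) (x, y) = 0 :=
        Φ.divergence_partField_current Ψ hdim hΦ hΨ Complex.reLm (x, y)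
      have him : divergence G.gP.inner (imField (Φ.current Ψ)) (x, y) = 0 :=
        Φ.divergence_partField_current Ψ hdim hΦ hΨ Complex.imLm (x, y)
      rw [complexDivergence, hre, him, Complex.ofReal_zero, mul_zero, add_zero]
    rw [SubmersiveMetric.complexDivergence_baseCurrent h x]
    simp only [h0, integral_zero]
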